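/- **Theorem 2 (strong selection consistency for hyper-pMOM priors).** For each sample size $n\ge 1$ let $X_n$ be a deterministic $n\times p_n$ design matrix and let the data be $y_n = X_n\beta_0+\epsilon_n$, where the entries of $\epsilon_n$ are i.i.d. $N(0,\sigma_0^2)$ with $\sigma_0^2>0$. Let $t\subseteq\{1,\dots,p_n\}$ be the set of indices of the nonzero entries of $\beta_0$ (the true model); $t$, the nonzero entries of $\beta_0$, and $\sigma_0^2$ do not depend on $n$. A model is a subset $k\subseteq\{1,\dots,p_n\}$; $|k|$ is its size, $X_k$ is the matrix of the columns of $X_n$ in $k$, and $A_k$ is the principal submatrix, with indices in $k$, of a symmetric $p_n\times p_n$ matrix $A_{p_n}$. Fix an integer $r\ge 1$ and $\alpha_1,\alpha_2>0$. Consider the hierarchical model with prior probabilities $\pi(k)=\pi_n(k)$ on the models and $$Y_n\mid\beta_k,\sigma^2,k\sim N(X_k\beta_k,\sigma^2 I_n),$$ $$\pi(\beta_k\mid\tau,\sigma^2,k)=d_k(2\pi)^{-|k|/2}(\tau\sigma^2)^{-r|k|-|k|/2}\,|A_k|^{1/2}\exp\Big\{-\frac{\beta_k^{T}A_k\beta_k}{2\tau\sigma^2}\Big\}\prod_{i\in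 k}\beta_i^{2r},$$ $$\pi(\tau)=\frac{(n/2)^{1/2}}{\Gamma(1/2)}\tau^{-3/2}e^{-n/(2\tau)},\qquad \pi(\sigma^2)=\frac{\alpha_2^{\alpha_1}}{\Gamma(\alpha_1)}(\sigma^2)^{-(\alpha_1+1)}e^{-\alpha_2/\sigma^2}\qquad(\tau,\sigma^2>0),$$ where $|A_k|$ is the determinant of $A_k$ and $d_k$ is the normalizing constant, independent of $\tau$ and $\sigma^2$. Let $$m_k(y)=\int_0^\infty\!\int_0^\infty\!\int_{\mathbb R^{k}}\pi(y\mid\beta_k,\sigma^2,k)\,\pi(\beta_k\mid\tau,\sigma^2,k)\,\pi(\tau)\,\pi(\sigma^2)\,d\beta_k\,d\sigma^2\,d\tau,\qquad \pi(k\mid y)=\frac{\pi(k)\,m_k(y)}{\sum_{l}\pi(l)\,m_l(y)}.$$ Assume that there are numbers $\epsilon_n\in(0,1)$, nonnegative integers $q_n$, and constants $\gamma,\xi\in\mathbb R$, $\omega>0$, $0<a_1<a_2<\infty$, not depending on $n$, such that: 1. for all $n\ge1$ and all models $k$ with $|k|\le q_n+|t|$, the $\min(n,|k|)$ largest eigenvalues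 of $X_k^TX_k/n$ (with multiplicity) lie in $[\epsilon_n,\epsilon_n^{-1}]$, and $\epsilon_n^{-1}=O((\log n)^{1/8})$; 2. $p_n=O(n^\gamma)$ with $\gamma<r$; 3. $\pi(k)=0$ whenever $|k|>q_n$, where $q_n=O(n^\xi)$ and $\xi<1$; 4. $\pi(t)/\pi(k)>\omega$ for every $n\ge 1$ and every $k$ with $\pi(k)>0$; 5. for every $n\ge1$ all eigenvalues of $A_{p_n}$ lie in $(a_1,a_2)$. Assume in addition that $\xi<1-\frac{4\gamma}{3r}$. Then $\pi(t\mid y_n)\to1$ in probability as $n\to\infty$. -/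

import Mathlib

open MeasureTheory ProbabilityTheory Filter Topology Asymptotics
open scoped ENNReal NNReal Matrix

noncomputable section

namespace HyperPMOM

/-- The columns of the design matrix `X` that belong to the model `k`. -/
def designSub {n p : ℕ} (X : Matrix (Fin n) (Fin p) ℝ) (k : Finset (Fin p)) :
    Matrix (Fin n) k ℝ :=
  X.submatrix id (fun i : k => (i : Fin p))

/-- The principal submatrix of `A` with rows and columns in the model `k`. -/
def principalSub {p : ℕ} (A : Matrix (Fin p) (Fin p) ℝ) (k : Finset (Fin p)) :
    Matrix k k ℝ :=
  A.submatrix (fun i : k => (i : Fin p)) (fun i : k => (i : Fin p))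

/-- The normalized Gram matrix `X_kᵀ X_k / n`. -/
def gram {n p : ℕ} (X : Matrix (Fin n) (Fin p) ℝ) (k : Finset (Fin p)) : Matrix k k ℝ :=
  (n : ℝ)⁻¹ • ((designSub X k)ᵀ * designSub X k)

theorem gram_isHermitian {n p : ℕ} (X : Matrix (Fin n) (Fin p) ℝ) (k : Finset (Fin p)) :
    (gram X k).IsHermitian := by
  unfold gram
  simp [Matrix.IsHermitian, Matrix.conjTranspose_eq_transpose_of_trivial]

/-- The `min (n, |k|)` largest eigenvalues of `X_kᵀ X_k / n`, counted with multiplicity, all lie in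
`[ε, ε⁻¹]`. For `ε > 0` this says that `X_kᵀ X_k / n` has exactly `min (n, |k|)` nonzero
eigenvalues, and that they lie in `[ε, ε⁻¹]`. (`eigenvalues₀` is sorted in decreasing order.) -/
def EigenvalueBound {n p : ℕ} (X : Matrix (Fin n) (Fin p) ℝ) (ε : ℝ) (k : Finset (Fin p)) :
    Prop :=
  ∀ j : Fin (Fintype.card k), (j : ℕ) < min n k.card →
    ε ≤ (gram_isHermitian X k).eigenvalues₀ j ∧ (gram_isHermitian X k).eigenvalues₀ j ≤ ε⁻¹

/-- The density at `y` of the normal law `N(X_k β, σ² I_n)`; the argument `s` is `σ²`. -/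
def likelihood {n p : ℕ} (X : Matrix (Fin n) (Fin p) ℝ) (k : Finset (Fin p))
    (y : Fin n → ℝ) (β : k → ℝ) (s : ℝ) : ℝ :=
  (2 * Real.pi * s) ^ (-((n : ℝ) / 2)) *
    Real.exp (-((y - designSub X k *ᵥ β) ⬝ᵥ (y - designSub X k *ᵥ β)) / (2 * s))

/-- The pMOM density of order `r` without its normalizing constant; `v` is `τ σ²`. -/
def pmomKernel {p : ℕ} (r : ℕ) (A : Matrix (Fin p) (Fin p) ℝ) (k : Finset (Fin p))
    (v : ℝ) (β : k → ℝ) : ℝ :=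
  (2 * Real.pi) ^ (-((k.card : ℝ) / 2)) *
    v ^ (-((r : ℝ) * k.card) - (k.card : ℝ) / 2) *
    Real.sqrt (principalSub A k).det *
    Real.exp (-(β ⬝ᵥ (principalSub A k *ᵥ β)) / (2 * v)) *
    ∏ i, β i ^ (2 * r)

/-- The normalizing constant `d_k` of the pMOM density. By scaling it does not depend on
`v = τ σ²`, so it is computed at `v = 1`. -/
def pmomConst {p : ℕ} (r : ℕ) (A : Matrix (Fin p) (Fin p) ℝ) (k : Finset (Fin p)) : ℝ :=
  (∫ β : k → ℝ, pmomKernel r A k 1 β)⁻¹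

/-- The pMOM prior density `π(β_k | τ, σ², k)`; `v` is `τ σ²`. -/
def pmomDensity {p : ℕ} (r : ℕ) (A : Matrix (Fin p) (Fin p) ℝ) (k : Finset (Fin p))
    (v : ℝ) (β : k → ℝ) : ℝ :=
  pmomConst r A k * pmomKernel r A k v β

/-- The density on `(0, ∞)` of the inverse-gamma law with shape `a` and scale `b`. -/
def invGammaDensity (a b x : ℝ) : ℝ :=
  b ^ a / Real.Gamma a * x ^ (-(a + 1)) * Real.exp (-b / x)

/-- The marginal density `m_k(y)` under model `k`: here `τ` is inverse-gamma `(1/2, n/2)` and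
`s = σ²` is inverse-gamma `(α₁, α₂)`. -/
def marginal {n p : ℕ} (r : ℕ) (α₁ α₂ : ℝ) (X : Matrix (Fin n) (Fin p) ℝ)
    (A : Matrix (Fin p) (Fin p) ℝ) (k : Finset (Fin p)) (y : Fin n → ℝ) : ℝ≥0∞ :=
  ∫⁻ τ in Set.Ioi (0 : ℝ), ∫⁻ s in Set.Ioi (0 : ℝ), ∫⁻ β : k → ℝ,
    ENNReal.ofReal (likelihood X k y β s * pmomDensity r A k (τ * s) β *
      invGammaDensity (1 / 2) ((n : ℝ) / 2) τ * invGammaDensity α₁ α₂ s)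

/-- The posterior probability `π(k | y)`, with prior `prior` on the space of models. -/
def posterior {n p : ℕ} (r : ℕ) (α₁ α₂ : ℝ) (X : Matrix (Fin n) (Fin p) ℝ)
    (A : Matrix (Fin p) (Fin p) ℝ) (prior : PMF (Finset (Fin p)))
    (k : Finset (Fin p)) (y : Fin n → ℝ) : ℝ :=
  (prior k * marginal r α₁ α₂ X A k y /
    ∑ l : Finset (Fin p), prior l * marginal r α₁ α₂ X A l y).toReal

/-- The model given by a set `t` of indices, as a set of columns of a design with `p` columns. -/
def modelOf (p : ℕ) (t : Finset ℕ) : Finset (Fin p) :=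
  Finset.univ.filter (fun j : Fin p => (j : ℕ) ∈ t)

/-- The responses `X β₀ + e`. -/
def response {n p : ℕ} (X : Matrix (Fin n) (Fin p) ℝ) (β₀ : ℕ → ℝ) (e : Fin n → ℝ) :
    Fin n → ℝ :=
  X *ᵥ (fun j : Fin p => β₀ j) + e

end HyperPMOM

end

/-!
Integrating the coefficients and then the two scales out of the marginal density of a model `k`
leaves an inverse-gamma integral whose scale is essentially half the residual sum of squares
`RSS_k`. As long as the error vector has about its expected length, the ratio of two such integrals
is exponential in the difference of the residual sums of squares, and
`m_k(y) / m_t(y) ≤ C (n ^ (r + 1) / ε) ^ |t| * φ ^ |k| * exp ((RSS_t - RSS_k) / (2 v'))`, where `φ`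
has the order of `q ^ (r + 1 / 2) * n ^ -(r + 1)` up to powers of `ε⁻¹`, and `v'` is slightly
smaller than the error variance.

If `k` misses a true variable, then `RSS_k - RSS_t` is at least a multiple of `n ε ^ 2`, and the
exponential beats every other factor. If `k` strictly contains `t`, then `RSS_t - RSS_k` is the
squared length of the projection of the error to a space of dimension at most `|k| - |t|`. The
expectation of the exponential may be infinite, but that of its `α`-th power is finite for `α < 1`
close to `1` and at most exponential in `|k| - |t|`, so summing over all supermodels gives
`exp (O (p φ ^ α)) - 1`, which tends to `0` if `γ + α (ξ (r + 1 / 2) - (r + 1)) < 0`.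
Markov's inequality for the sum of the `α`-th powers concludes.
-/

noncomputable section

namespace HyperPMOM

/-! ### Inverse-gamma and Gaussian integrals -/

theorem integral_rpow_mul_exp_neg_div {a b : ℝ} (ha : 0 < a) (hb : 0 < b) :
    ∫ x in Set.Ioi (0 : ℝ), x ^ (-(a + 1)) * Real.exp (-b / x) = Real.Gamma a * b ^ (-a) := by
  have h := integral_comp_rpow_Ioi (fun x : ℝ ↦ x ^ (a - 1) * Real.exp (-(b * x)))
    (neg_ne_zero.2 one_ne_zero)
  rw [Real.integral_rpow_mul_exp_neg_mul_Ioi ha hb, one_div, Real.inv_rpow hb.le,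
    ← Real.rpow_neg hb.le, mul_comm] at h
  rw [← h]
  refine setIntegral_congr_fun measurableSet_Ioi fun x hx ↦ ?_
  have hx : 0 < x := hx
  simp only [smul_eq_mul, abs_neg, abs_one, one_mul]
  rw [← Real.rpow_mul hx.le, ← mul_assoc, ← Real.rpow_add hx, Real.rpow_neg_one]
  congr 2 <;> ring

theorem lintegral_rpow_mul_exp_neg_div {a b : ℝ} (ha : 0 < a) (hb : 0 < b) :
    ∫⁻ x in Set.Ioi (0 : ℝ), ENNReal.ofReal (x ^ (-(a + 1)) * Real.exp (-b / x)) =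
      ENNReal.ofReal (Real.Gamma a * b ^ (-a)) := by
  have h := integral_rpow_mul_exp_neg_div ha hb
  have hint : IntegrableOn (fun x : ℝ ↦ x ^ (-(a + 1)) * Real.exp (-b / x)) (Set.Ioi 0) := by
    refine Integrable.of_integral_ne_zero ?_
    rw [h]
    have := Real.Gamma_pos_of_pos ha
    positivity
  rw [← h, ofReal_integral_eq_lintegral_ofReal hint]
  filter_upwards [ae_restrict_mem measurableSet_Ioi] with x hx
  have hx : 0 < x := hx
  positivity

theorem rpow_mul_exp_neg_le {a x : ℝ} (ha : 0 ≤ a) (hx : 0 ≤ x) :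
    x ^ a * Real.exp (-x) ≤ a ^ a := by
  rcases ha.eq_or_lt with rfl | ha
  · simpa using hx
  have h : (x / a) ^ a ≤ Real.exp x := by
    calc (x / a) ^ a ≤ (Real.exp (x / a)) ^ a := by
          gcongr
          linarith [Real.add_one_le_exp (x / a)]
      _ = Real.exp x := by rw [← Real.exp_mul, div_mul_cancel₀ _ ha.ne']
  rw [Real.div_rpow hx ha.le, div_le_iff₀ (by positivity)] at h
  rwa [Real.exp_neg, ← div_eq_mul_inv, div_le_iff₀ (Real.exp_pos _), mul_comm]

theorem rpow_neg_mul_exp_neg_div_le {a c x : ℝ} (ha : 0 ≤ a) (hc : 0 < c) (hx : 0 < x) :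
    x ^ (-a) * Real.exp (-(2 * c) / x) ≤ (a / c) ^ a * Real.exp (-c / x) := by
  have h := rpow_mul_exp_neg_le ha (div_pos hc hx).le
  calc x ^ (-a) * Real.exp (-(2 * c) / x)
      = (c / x) ^ a * Real.exp (-(c / x)) / c ^ a * Real.exp (-c / x) := by
        rw [Real.div_rpow hc.le hx.le, Real.rpow_neg hx.le, mul_div_right_comm, mul_assoc,
          ← Real.exp_add]
        field_simp
        ring_nf
    _ ≤ a ^ a / c ^ a * Real.exp (-c / x) := by gcongr
    _ = (a / c) ^ a * Real.exp (-c / x) := by rw [Real.div_rpow ha hc.le]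

theorem rpow_mul_Gamma_le {x b : ℝ} (hx : 0 < x) (hb : 1 ≤ b) :
    x ^ b * Real.Gamma x ≤ Real.Gamma (x + b) := by
  have hΓ := Real.Gamma_pos_of_pos hx
  have hΓb := Real.Gamma_pos_of_pos (by linarith : 0 < x + b)
  -- log-convexity: the slope of `log Γ` over `[x, x + 1]` is `log x`
  have hslope := Real.convexOn_log_Gamma.secant_mono (a := x) (x := x + 1) (y := x + b) hx
    (Set.mem_Ioi.2 (by linarith)) (Set.mem_Ioi.2 (by linarith)) (by linarith) (by linarith)
    (by linarith)
  simp only [Function.comp_apply, add_sub_cancel_left, div_one, Real.Gamma_add_one hx.ne',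
    Real.log_mul hx.ne' hΓ.ne', add_sub_cancel_right] at hslope
  rw [le_div_iff₀ (by linarith)] at hslope
  rw [← Real.log_le_log_iff (by positivity) hΓb, Real.log_mul (by positivity) hΓ.ne',
    Real.log_rpow hx]
  linarith

theorem pow_mul_exp_neg_le_factorial (r : ℕ) {u : ℝ} (hu : 0 ≤ u) :
    u ^ r * Real.exp (-u) ≤ r.factorial := by
  have h := Real.pow_div_factorial_le_exp u hu r
  rw [div_le_iff₀ (by positivity)] at h
  rwa [Real.exp_neg, ← div_eq_mul_inv, div_le_iff₀ (Real.exp_pos _), mul_comm]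

theorem exp_neg_sq_mul_pow_le (r : ℕ) {a : ℝ} (ha : 0 < a) (b x : ℝ) :
    Real.exp (-a * (x - b) ^ 2) * x ^ (2 * r) ≤
      4 ^ r * (b ^ (2 * r) + r.factorial * (2 / a) ^ r) * Real.exp (-(a / 2) * (x - b) ^ 2) := by
  set E := Real.exp (-(a / 2) * (x - b) ^ 2) with hE
  have hE1 : E ≤ 1 := Real.exp_le_one_iff.2 (by nlinarith [sq_nonneg (x - b)])
  have hpow : x ^ (2 * r) ≤ 4 ^ r * (b ^ (2 * r) + (x - b) ^ (2 * r)) := by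
    have h := (even_two_mul r).add_pow_le (a := b) (b := x - b)
    rw [add_sub_cancel] at h
    have h4 : (2 : ℝ) ^ (2 * r - 1) ≤ 4 ^ r := by
      rw [show (4 : ℝ) = 2 ^ 2 by norm_num, ← pow_mul]
      exact pow_le_pow_right₀ one_le_two (Nat.sub_le _ _)
    refine h.trans (mul_le_mul_of_nonneg_right h4 ?_)
    rw [pow_mul, pow_mul]
    positivity
  have hcentral : E * (x - b) ^ (2 * r) ≤ r.factorial * (2 / a) ^ r := by
    have h := pow_mul_exp_neg_le_factorial r (by positivity : 0 ≤ a / 2 * (x - b) ^ 2)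
    calc E * (x - b) ^ (2 * r)
        = (a / 2 * (x - b) ^ 2) ^ r * Real.exp (-(a / 2 * (x - b) ^ 2)) * (2 / a) ^ r := by
          rw [hE, mul_pow, neg_mul, pow_mul, ← inv_div a 2, inv_pow]
          field_simp
      _ ≤ r.factorial * (2 / a) ^ r := by gcongr
  have hb : E * b ^ (2 * r) ≤ b ^ (2 * r) := by
    rw [pow_mul]
    exact mul_le_of_le_one_left (by positivity) hE1
  calc Real.exp (-a * (x - b) ^ 2) * x ^ (2 * r) = E * E * x ^ (2 * r) := by
        rw [hE, ← Real.exp_add]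
        ring_nf
    _ ≤ E * E * (4 ^ r * (b ^ (2 * r) + (x - b) ^ (2 * r))) := by gcongr
    _ = 4 ^ r * (E * b ^ (2 * r) + E * (x - b) ^ (2 * r)) * E := by ring
    _ ≤ _ := by gcongr

theorem integrable_exp_neg_mul_sub_sq {a : ℝ} (ha : 0 < a) (b : ℝ) :
    Integrable (fun x : ℝ ↦ Real.exp (-a * (x - b) ^ 2)) :=
  (integrable_exp_neg_mul_sq ha).comp_sub_right b

theorem integrable_exp_neg_sq_mul_pow (r : ℕ) {a : ℝ} (ha : 0 < a) (b : ℝ) :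
    Integrable (fun x : ℝ ↦ Real.exp (-a * (x - b) ^ 2) * x ^ (2 * r)) := by
  refine ((integrable_exp_neg_mul_sub_sq (half_pos ha) b).const_mul
    (4 ^ r * (b ^ (2 * r) + r.factorial * (2 / a) ^ r))).mono' ?_ (ae_of_all _ fun x ↦ ?_)
  · exact (by fun_prop : Continuous _).aestronglyMeasurable
  · rw [Real.norm_of_nonneg (by rw [pow_mul]; positivity)]
    exact exp_neg_sq_mul_pow_le r ha b x

theorem integral_exp_neg_sq_mul_pow_le (r : ℕ) {a : ℝ} (ha : 0 < a) (b : ℝ) :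
    ∫ x : ℝ, Real.exp (-a * (x - b) ^ 2) * x ^ (2 * r) ≤
      4 ^ r * (b ^ (2 * r) + r.factorial * (2 / a) ^ r) * √(2 * Real.pi / a) := by
  calc ∫ x : ℝ, Real.exp (-a * (x - b) ^ 2) * x ^ (2 * r)
      ≤ ∫ x : ℝ, 4 ^ r * (b ^ (2 * r) + r.factorial * (2 / a) ^ r) *
          Real.exp (-(a / 2) * (x - b) ^ 2) :=
        integral_mono (integrable_exp_neg_sq_mul_pow r ha b)
          ((integrable_exp_neg_mul_sub_sq (half_pos ha) b).const_mul _)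
          (fun x ↦ exp_neg_sq_mul_pow_le r ha b x)
    _ = _ := by
      rw [integral_const_mul, integral_sub_right_eq_self (fun x ↦ Real.exp (-(a / 2) * x ^ 2)) b,
        integral_gaussian]
      congr 2
      field_simp

section

variable {ι : Type*} [Fintype ι]

theorem exp_neg_mul_dotProduct_self_mul_prod (a : ℝ) (b β : ι → ℝ) (r : ℕ) :
    Real.exp (-a * ((β - b) ⬝ᵥ (β - b))) * ∏ i, β i ^ (2 * r) =
      ∏ i, (Real.exp (-a * (β i - b i) ^ 2) * β i ^ (2 * r)) := by
  rw [Finset.prod_mul_distrib, ← Real.exp_sum, dotProduct, Finset.mul_sum]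
  simp only [Pi.sub_apply, sq]

theorem integrable_exp_neg_mul_dotProduct_self_mul_prod {a : ℝ} (ha : 0 < a) (b : ι → ℝ)
    (r : ℕ) :
    Integrable fun β : ι → ℝ ↦ Real.exp (-a * ((β - b) ⬝ᵥ (β - b))) * ∏ i, β i ^ (2 * r) := by
  simp_rw [exp_neg_mul_dotProduct_self_mul_prod]
  exact Integrable.fintype_prod (f := fun i x ↦ Real.exp (-a * (x - b i) ^ 2) * x ^ (2 * r))
    fun i ↦ integrable_exp_neg_sq_mul_pow r ha (b i)

theorem integral_exp_neg_mul_dotProduct_self_mul_prod (a : ℝ) (b : ι → ℝ) (r : ℕ) :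
    ∫ β : ι → ℝ, Real.exp (-a * ((β - b) ⬝ᵥ (β - b))) * ∏ i, β i ^ (2 * r) =
      ∏ i, ∫ x : ℝ, Real.exp (-a * (x - b i) ^ 2) * x ^ (2 * r) := by
  simp_rw [exp_neg_mul_dotProduct_self_mul_prod]
  exact integral_fintype_prod_volume_eq_prod
    fun i x ↦ Real.exp (-a * (x - b i) ^ 2) * x ^ (2 * r)

theorem prod_even_pow_nonneg (β : ι → ℝ) (r : ℕ) : 0 ≤ ∏ i, β i ^ (2 * r) :=
  Finset.prod_nonneg fun i _ ↦ (even_two_mul r).pow_nonneg (β i)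

theorem lintegral_exp_neg_sq_mul_prod_pow_le (r : ℕ) {a B : ℝ} (ha : 0 < a) (b : ι → ℝ)
    (hb : ∀ i, b i ^ (2 * r) ≤ B) :
    ∫⁻ β : ι → ℝ, ENNReal.ofReal (Real.exp (-a * ((β - b) ⬝ᵥ (β - b))) * ∏ i, β i ^ (2 * r)) ≤
      ENNReal.ofReal
        ((4 ^ r * (B + r.factorial * (2 / a) ^ r) * √(2 * Real.pi / a)) ^ Fintype.card ι) := by
  rw [← ofReal_integral_eq_lintegral_ofReal
      (integrable_exp_neg_mul_dotProduct_self_mul_prod ha b r)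
      (ae_of_all _ fun β ↦ mul_nonneg (Real.exp_pos _).le (prod_even_pow_nonneg β r)),
    integral_exp_neg_mul_dotProduct_self_mul_prod, ← Finset.card_univ, ← Finset.prod_const]
  refine ENNReal.ofReal_le_ofReal <| Finset.prod_le_prod
    (fun i _ ↦ integral_nonneg fun x ↦
      mul_nonneg (Real.exp_pos _).le ((even_two_mul r).pow_nonneg x))
    fun i _ ↦ (integral_exp_neg_sq_mul_pow_le r ha (b i)).trans ?_
  gcongr
  exact hb i

end

/-- The moment of order `2 r` of the Gaussian weight `exp (-a x² / 2)`; one factor of this kind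
per variable bounds the normalizing constant of a pMOM density. -/
def gaussianMoment (r : ℕ) (a : ℝ) : ℝ := ∫ x : ℝ, Real.exp (-(a / 2) * x ^ 2) * x ^ (2 * r)

theorem gaussianMoment_pos (r : ℕ) {a : ℝ} (ha : 0 < a) : 0 < gaussianMoment r a := by
  have hint : Integrable (fun x : ℝ ↦ Real.exp (-(a / 2) * x ^ 2) * x ^ (2 * r)) := by
    simpa using integrable_exp_neg_sq_mul_pow r (half_pos ha) 0
  rw [gaussianMoment, integral_pos_iff_support_of_nonneg
    (fun x ↦ mul_nonneg (Real.exp_pos _).le ((even_two_mul r).pow_nonneg x)) hint]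
  have hsub : Set.Ioi (0 : ℝ) ⊆ Function.support
      (fun x : ℝ ↦ Real.exp (-(a / 2) * x ^ 2) * x ^ (2 * r)) := by
    intro x (hx : 0 < x)
    rw [Function.mem_support]
    positivity
  exact lt_of_lt_of_le (by simp) (measure_mono hsub)

/-! ### Quadratic forms of symmetric matrices -/

section

open scoped MatrixOrder

variable {ι κ : Type*} [DecidableEq ι] [DecidableEq κ] {A : Matrix ι ι ℝ} {a b : ℝ}

/-- The Loewner order bounds `a I ≤ A ≤ b I`. -/
def LoewnerBound (A : Matrix ι ι ℝ) (a b : ℝ) : Prop := a • 1 ≤ A ∧ A ≤ b • 1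

theorem LoewnerBound.submatrix (h : LoewnerBound A a b) {f : κ → ι} (hf : f.Injective) :
    LoewnerBound (A.submatrix f f) a b := by
  have hone (c : ℝ) : (c • (1 : Matrix ι ι ℝ)).submatrix f f = c • 1 := by
    ext i j
    simp [Matrix.one_apply, hf.eq_iff]
  rw [LoewnerBound, Matrix.le_iff, Matrix.le_iff, ← hone, ← hone]
  exact ⟨(Matrix.le_iff.1 h.1).submatrix f, (Matrix.le_iff.1 h.2).submatrix f⟩

variable [Fintype ι]

theorem loewnerBound_of_eigenvalues (hA : A.IsHermitian)
    (h : ∀ i, a ≤ hA.eigenvalues i ∧ hA.eigenvalues i ≤ b) : LoewnerBound A a b := by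
  have hself : IsSelfAdjoint A := hA
  rw [LoewnerBound, ← Algebra.algebraMap_eq_smul_one, ← Algebra.algebraMap_eq_smul_one,
    algebraMap_le_iff_le_spectrum, le_algebraMap_iff_spectrum_le,
    hA.spectrum_real_eq_range_eigenvalues]
  exact ⟨Set.forall_mem_range.2 fun i ↦ (h i).1, Set.forall_mem_range.2 fun i ↦ (h i).2⟩

theorem dotProduct_smul_one_mulVec (a : ℝ) (x : ι → ℝ) :
    x ⬝ᵥ ((a • (1 : Matrix ι ι ℝ)) *ᵥ x) = a * (x ⬝ᵥ x) := by
  rw [Matrix.smul_mulVec, Matrix.one_mulVec, dotProduct_smul, smul_eq_mul]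

theorem LoewnerBound.le_dotProduct (h : LoewnerBound A a b) (x : ι → ℝ) :
    a * (x ⬝ᵥ x) ≤ x ⬝ᵥ (A *ᵥ x) := by
  have hx := (Matrix.le_iff.1 h.1).dotProduct_mulVec_nonneg x
  rwa [star_trivial, Matrix.sub_mulVec, dotProduct_sub, dotProduct_smul_one_mulVec,
    sub_nonneg] at hx

theorem LoewnerBound.dotProduct_le (h : LoewnerBound A a b) (x : ι → ℝ) :
    x ⬝ᵥ (A *ᵥ x) ≤ b * (x ⬝ᵥ x) := by
  have hx := (Matrix.le_iff.1 h.2).dotProduct_mulVec_nonneg x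
  rwa [star_trivial, Matrix.sub_mulVec, dotProduct_sub, dotProduct_smul_one_mulVec,
    sub_nonneg] at hx

theorem LoewnerBound.det_pos (ha : 0 < a) (h : LoewnerBound A a b) : 0 < A.det := by
  have hpos : (a • (1 : Matrix ι ι ℝ)).PosDef := Matrix.PosDef.one.smul ha
  have := (hpos.add_posSemidef (Matrix.le_iff.1 h.1)).det_pos
  rwa [add_sub_cancel] at this

end

section

variable {n p : ℕ} {X : Matrix (Fin n) (Fin p) ℝ} {ε : ℝ} {k : Finset (Fin p)}

/-- The columns of `X` in `k` are well conditioned: the quadratic form of `X_kᵀ X_k / n` lies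
between `ε` and `ε⁻¹`. -/
def DesignBound (X : Matrix (Fin n) (Fin p) ℝ) (ε : ℝ) (k : Finset (Fin p)) : Prop :=
  ∀ b : k → ℝ, n * ε * (b ⬝ᵥ b) ≤ (designSub X k *ᵥ b) ⬝ᵥ (designSub X k *ᵥ b) ∧
    (designSub X k *ᵥ b) ⬝ᵥ (designSub X k *ᵥ b) ≤ n * ε⁻¹ * (b ⬝ᵥ b)

theorem dotProduct_gram_mulVec (X : Matrix (Fin n) (Fin p) ℝ) (k : Finset (Fin p)) (b : k → ℝ) :
    b ⬝ᵥ (gram X k *ᵥ b) = (n : ℝ)⁻¹ * ((designSub X k *ᵥ b) ⬝ᵥ (designSub X k *ᵥ b)) := by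
  rw [gram, Matrix.smul_mulVec, dotProduct_smul, smul_eq_mul, ← Matrix.mulVec_mulVec,
    Matrix.dotProduct_mulVec, Matrix.vecMul_transpose]

theorem EigenvalueBound.designBound (h : EigenvalueBound X ε k) (hn : 0 < n) (hk : k.card ≤ n) :
    DesignBound X ε k := by
  have hgram : LoewnerBound (gram X k) ε ε⁻¹ :=
    loewnerBound_of_eigenvalues (gram_isHermitian X k) fun i ↦ h _ <| by
      rw [min_eq_right hk]
      exact (Fin.is_lt _).trans_eq (Fintype.card_coe k)
  have hn' : (0 : ℝ) < n := by exact_mod_cast hn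
  intro b
  have hlower := hgram.le_dotProduct b
  have hupper := hgram.dotProduct_le b
  rw [dotProduct_gram_mulVec] at hlower hupper
  rw [le_inv_mul_iff₀ hn'] at hlower
  rw [inv_mul_le_iff₀ hn'] at hupper
  constructor <;> linarith

end

/-! ### The pMOM density -/

section

variable {p r : ℕ} {A : Matrix (Fin p) (Fin p) ℝ} {a₁ a₂ : ℝ}

/-- The mass of the unnormalized pMOM kernel at unit scale, without the determinant and the
powers of `2 π`. -/
def pmomMass (r : ℕ) (A : Matrix (Fin p) (Fin p) ℝ) (k : Finset (Fin p)) : ℝ :=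
  ∫ β : k → ℝ, Real.exp (-(β ⬝ᵥ (principalSub A k *ᵥ β)) / 2) * ∏ i, β i ^ (2 * r)

theorem pmomDensity_eq {k : Finset (Fin p)} (hdet : 0 < (principalSub A k).det) (v : ℝ)
    (β : k → ℝ) :
    pmomDensity r A k v β = (pmomMass r A k)⁻¹ * v ^ (-((r + 1 / 2 : ℝ) * k.card)) *
      Real.exp (-(β ⬝ᵥ (principalSub A k *ᵥ β)) / (2 * v)) * ∏ i, β i ^ (2 * r) := by
  have hmass : ∫ β : k → ℝ, pmomKernel r A k 1 β =
      (2 * Real.pi) ^ (-((k.card : ℝ) / 2)) * √(principalSub A k).det * pmomMass r A k := by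
    rw [pmomMass, ← integral_const_mul]
    refine integral_congr_ae (ae_of_all _ fun β ↦ ?_)
    simp only [pmomKernel, Real.one_rpow, mul_one]
    ring
  have : (0 : ℝ) < (2 * Real.pi) ^ (-((k.card : ℝ) / 2)) := by positivity
  have : 0 < √(principalSub A k).det := Real.sqrt_pos.2 hdet
  rw [pmomDensity, pmomConst, hmass, pmomKernel, mul_inv, mul_inv,
    show -((r : ℝ) * k.card) - (k.card : ℝ) / 2 = -((r + 1 / 2 : ℝ) * k.card) by ring]
  field_simp

theorem integral_exp_neg_mul_prod_eq_gaussianMoment_pow {ι : Type*} [Fintype ι] (r : ℕ) (a : ℝ) :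
    ∫ β : ι → ℝ, Real.exp (-(a / 2) * (β ⬝ᵥ β)) * ∏ i, β i ^ (2 * r) =
      gaussianMoment r a ^ Fintype.card ι := by
  have h := integral_exp_neg_mul_dotProduct_self_mul_prod (a / 2) (0 : ι → ℝ) r
  simpa only [gaussianMoment, sub_zero, Pi.zero_apply, Finset.prod_const, Finset.card_univ] using h

theorem pmomMass_bounds (ha₁ : 0 < a₁) (ha₂ : 0 < a₂) {k : Finset (Fin p)}
    (h : LoewnerBound (principalSub A k) a₁ a₂) :
    gaussianMoment r a₂ ^ k.card ≤ pmomMass r A k ∧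
      pmomMass r A k ≤ gaussianMoment r a₁ ^ k.card := by
  have hupper : ∀ β : k → ℝ,
      Real.exp (-(β ⬝ᵥ (principalSub A k *ᵥ β)) / 2) * ∏ i, β i ^ (2 * r) ≤
        Real.exp (-(a₁ / 2) * (β ⬝ᵥ β)) * ∏ i, β i ^ (2 * r) := fun β ↦
    mul_le_mul_of_nonneg_right (Real.exp_le_exp.2 (by linarith [h.le_dotProduct β]))
      (prod_even_pow_nonneg β r)
  have hlower : ∀ β : k → ℝ, Real.exp (-(a₂ / 2) * (β ⬝ᵥ β)) * ∏ i, β i ^ (2 * r) ≤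
      Real.exp (-(β ⬝ᵥ (principalSub A k *ᵥ β)) / 2) * ∏ i, β i ^ (2 * r) := fun β ↦
    mul_le_mul_of_nonneg_right (Real.exp_le_exp.2 (by linarith [h.dotProduct_le β]))
      (prod_even_pow_nonneg β r)
  have hgauss : ∀ {a : ℝ}, 0 < a →
      Integrable fun β : k → ℝ ↦ Real.exp (-(a / 2) * (β ⬝ᵥ β)) * ∏ i, β i ^ (2 * r) :=
    fun ha ↦ by
      simpa using integrable_exp_neg_mul_dotProduct_self_mul_prod (half_pos ha) (0 : k → ℝ) r
  have hint : Integrable fun β : k → ℝ ↦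
      Real.exp (-(β ⬝ᵥ (principalSub A k *ᵥ β)) / 2) * ∏ i, β i ^ (2 * r) := by
    refine (hgauss ha₁).mono' ?_ (ae_of_all _ fun β ↦ ?_)
    · unfold dotProduct Matrix.mulVec dotProduct
      exact Continuous.aestronglyMeasurable (by fun_prop)
    · rw [Real.norm_of_nonneg (mul_nonneg (Real.exp_pos _).le (prod_even_pow_nonneg β r))]
      exact hupper β
  simp only [← Fintype.card_coe k, ← integral_exp_neg_mul_prod_eq_gaussianMoment_pow]
  exact ⟨integral_mono (hgauss ha₂) hint hlower, integral_mono hint (hgauss ha₁) hupper⟩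

end

/-! ### Least squares -/

section

variable {E : Type*} [NormedAddCommGroup E] [InnerProductSpace ℝ E] {U V : Submodule ℝ E}
  [U.HasOrthogonalProjection] [V.HasOrthogonalProjection]

theorem starProjection_starProjection_of_le (h : U ≤ V) (x : E) :
    U.starProjection (V.starProjection x) = U.starProjection x :=
  DFunLike.congr_fun (Submodule.starProjection_comp_starProjection_of_le h) x

theorem norm_starProjection_le_of_le (h : U ≤ V) (x : E) :
    ‖U.starProjection x‖ ≤ ‖V.starProjection x‖ := by
  rw [← starProjection_starProjection_of_le h]
  exact U.norm_starProjection_apply_le _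

theorem starProjection_inf_orthogonal [(V ⊓ Uᗮ).HasOrthogonalProjection] (h : U ≤ V) (x : E) :
    (V ⊓ Uᗮ).starProjection x = Uᗮ.starProjection (V.starProjection x) := by
  have hU := U.starProjection_apply_mem (V.starProjection x)
  refine Submodule.eq_starProjection_of_mem_of_inner_eq_zero
    ⟨?_, Submodule.starProjection_apply_mem _ _⟩ fun w hw ↦ ?_
  · rw [Submodule.starProjection_orthogonal_val]
    exact V.sub_mem (V.starProjection_apply_mem x) (h hU)
  · rw [Submodule.starProjection_orthogonal_val, sub_sub_eq_add_sub, add_sub_right_comm,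
      inner_add_left, V.starProjection_inner_eq_zero x w hw.1,
      (Submodule.mem_orthogonal _ _).1 hw.2 _ hU, add_zero]

theorem norm_sq_starProjection_eq_add [(V ⊓ Uᗮ).HasOrthogonalProjection] (h : U ≤ V) (x : E) :
    ‖V.starProjection x‖ ^ 2 =
      ‖U.starProjection x‖ ^ 2 + ‖(V ⊓ Uᗮ).starProjection x‖ ^ 2 := by
  rw [starProjection_inf_orthogonal h, ← starProjection_starProjection_of_le h x,
    ← Submodule.norm_sq_eq_add_norm_sq_starProjection]

end

theorem dotProduct_self_eq_norm_sq {ι : Type*} [Fintype ι] (x : ι → ℝ) :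
    x ⬝ᵥ x = ‖WithLp.toLp 2 x‖ ^ 2 := by
  rw [EuclideanSpace.real_norm_sq_eq]
  simp only [dotProduct, sq]

section

variable {n p : ℕ} {X : Matrix (Fin n) (Fin p) ℝ} {k l t : Finset (Fin p)}

/-- The span of the columns of `X` with index in `k`. -/
def colSpace (X : Matrix (Fin n) (Fin p) ℝ) (k : Finset (Fin p)) :
    Submodule ℝ (EuclideanSpace ℝ (Fin n)) :=
  Submodule.span ℝ ((fun j ↦ WithLp.toLp 2 (X.col j)) '' k)

theorem mem_colSpace_iff {v : EuclideanSpace ℝ (Fin n)} :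
    v ∈ colSpace X k ↔ ∃ b : k → ℝ, WithLp.toLp 2 (designSub X k *ᵥ b) = v := by
  rw [colSpace, Submodule.mem_span_image_finset_iff_exists_fun]
  refine exists_congr fun b ↦ Eq.congr_left ?_
  ext i
  simp [Matrix.mulVec, dotProduct, designSub, mul_comm]

theorem designSub_mulVec_restrict {x : Fin p → ℝ} (hx : ∀ j ∉ k, x j = 0) :
    designSub X k *ᵥ (fun i : k ↦ x i) = X *ᵥ x := by
  ext i
  simp only [Matrix.mulVec, dotProduct, designSub, Matrix.submatrix_apply, id_eq]
  rw [Finset.sum_coe_sort k fun j ↦ X i j * x j]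
  exact Finset.sum_subset k.subset_univ fun j _ hj ↦ by rw [hx j hj, mul_zero]

theorem toLp_mulVec_mem_colSpace {x : Fin p → ℝ} (hx : ∀ j ∉ k, x j = 0) :
    WithLp.toLp 2 (X *ᵥ x) ∈ colSpace X k :=
  mem_colSpace_iff.2 ⟨fun i ↦ x i, by rw [designSub_mulVec_restrict hx]⟩

theorem exists_mulVec_of_mem_colSpace {v : EuclideanSpace ℝ (Fin n)} (hv : v ∈ colSpace X k) :
    ∃ x : Fin p → ℝ, (∀ j ∉ k, x j = 0) ∧ WithLp.toLp 2 (X *ᵥ x) = v := by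
  obtain ⟨b, rfl⟩ := mem_colSpace_iff.1 hv
  have hzero : ∀ j ∉ k, Function.extend Subtype.val b 0 j = 0 := fun j hj ↦
    Function.extend_apply' _ _ _ (by rintro ⟨i, rfl⟩; exact hj i.2)
  refine ⟨_, hzero, ?_⟩
  rw [← designSub_mulVec_restrict hzero]
  simp only [Subtype.val_injective.extend_apply]

theorem colSpace_mono (h : k ⊆ l) : colSpace X k ≤ colSpace X l :=
  Submodule.span_mono (Set.image_mono h)

theorem finrank_colSpace_le (k : Finset (Fin p)) : Module.finrank ℝ (colSpace X k) ≤ k.card := by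
  classical
  rw [colSpace, ← Finset.coe_image]
  exact (finrank_span_finset_le_card _).trans Finset.card_image_le

/-- The residual sum of squares of the model `k`. -/
def rss (X : Matrix (Fin n) (Fin p) ℝ) (k : Finset (Fin p)) (y : EuclideanSpace ℝ (Fin n)) : ℝ :=
  ‖(colSpace X k)ᗮ.starProjection y‖ ^ 2

theorem norm_sq_eq_add_rss (k : Finset (Fin p)) (y : EuclideanSpace ℝ (Fin n)) :
    ‖y‖ ^ 2 = ‖(colSpace X k).starProjection y‖ ^ 2 + rss X k y :=
  Submodule.norm_sq_eq_add_norm_sq_starProjection y _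

theorem rss_nonneg (k : Finset (Fin p)) (y : EuclideanSpace ℝ (Fin n)) : 0 ≤ rss X k y :=
  sq_nonneg _

theorem rss_le_norm_sq (k : Finset (Fin p)) (y : EuclideanSpace ℝ (Fin n)) :
    rss X k y ≤ ‖y‖ ^ 2 :=
  pow_le_pow_left₀ (norm_nonneg _) (Submodule.norm_starProjection_apply_le _ _) 2

theorem rss_anti (h : k ⊆ l) (y : EuclideanSpace ℝ (Fin n)) : rss X l y ≤ rss X k y :=
  pow_le_pow_left₀ (norm_nonneg _)
    (norm_starProjection_le_of_le (Submodule.orthogonal_le (colSpace_mono h)) y) 2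

theorem rss_add_of_mem {μ : EuclideanSpace ℝ (Fin n)} (hμ : μ ∈ colSpace X k)
    (e : EuclideanSpace ℝ (Fin n)) : rss X k (μ + e) = rss X k e := by
  rw [rss, map_add, Submodule.starProjection_orthogonal_apply_eq_zero hμ, zero_add, rss]

theorem rss_sub_rss_eq_rss_starProjection (h : k ⊆ l) (y : EuclideanSpace ℝ (Fin n)) :
    rss X k y - rss X l y = rss X k ((colSpace X l).starProjection y) := by
  have hk := norm_sq_eq_add_rss (X := X) k y
  have hl := norm_sq_eq_add_rss (X := X) l y
  have hproj := norm_sq_eq_add_rss (X := X) k ((colSpace X l).starProjection y)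
  rw [starProjection_starProjection_of_le (colSpace_mono h)] at hproj
  linarith

/-- The coefficients of a least squares fit of `y` in the model `k`; they are unique only if the
columns of `X` in `k` are linearly independent. -/
def leastSquares (X : Matrix (Fin n) (Fin p) ℝ) (k : Finset (Fin p)) (y : Fin n → ℝ) : k → ℝ :=
  (mem_colSpace_iff.1
    ((colSpace X k).starProjection_apply_mem (WithLp.toLp 2 y))).choose

theorem toLp_designSub_mulVec_leastSquares (k : Finset (Fin p)) (y : Fin n → ℝ) :
    WithLp.toLp 2 (designSub X k *ᵥ leastSquares X k y) =
      (colSpace X k).starProjection (WithLp.toLp 2 y) :=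
  (mem_colSpace_iff.1 ((colSpace X k).starProjection_apply_mem (WithLp.toLp 2 y))).choose_spec

theorem dotProduct_self_sub_designSub_mulVec (y : Fin n → ℝ) (β : k → ℝ) :
    (y - designSub X k *ᵥ β) ⬝ᵥ (y - designSub X k *ᵥ β) =
      rss X k (WithLp.toLp 2 y) + (designSub X k *ᵥ (β - leastSquares X k y)) ⬝ᵥ
        (designSub X k *ᵥ (β - leastSquares X k y)) := by
  have hmem : WithLp.toLp 2 (designSub X k *ᵥ β) ∈ colSpace X k := mem_colSpace_iff.2 ⟨β, rfl⟩
  rw [dotProduct_self_eq_norm_sq, dotProduct_self_eq_norm_sq, WithLp.toLp_sub,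
    norm_sq_eq_add_rss (X := X) k, sub_eq_neg_add, rss_add_of_mem (Submodule.neg_mem _ hmem),
    Matrix.mulVec_sub, WithLp.toLp_sub, toLp_designSub_mulVec_leastSquares, map_add, map_neg,
    Submodule.starProjection_eq_self_iff.2 hmem, add_comm, ← norm_neg, neg_add_rev, neg_neg,
    neg_add_eq_sub]

/-- The part of the column space of a larger model that is orthogonal to the smaller one. -/
def extraSpace (X : Matrix (Fin n) (Fin p) ℝ) (t k : Finset (Fin p)) :
    Submodule ℝ (EuclideanSpace ℝ (Fin n)) :=
  colSpace X k ⊓ (colSpace X t)ᗮ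

theorem finrank_extraSpace_le (h : t ⊆ k) :
    Module.finrank ℝ (extraSpace X t k) ≤ (k \ t).card := by
  have hsup : colSpace X k = colSpace X t ⊔ colSpace X (k \ t) := by
    rw [colSpace, colSpace, colSpace, ← Submodule.span_union, ← Set.image_union,
      ← Finset.coe_union, Finset.union_sdiff_of_subset h]
  have hadd := Submodule.finrank_add_inf_finrank_orthogonal (colSpace_mono (X := X) h)
  have hle := Submodule.finrank_add_le_finrank_add_finrank (colSpace X t) (colSpace X (k \ t))
  rw [← hsup] at hle
  rw [extraSpace, inf_comm]
  linarith [finrank_colSpace_le (X := X) (k \ t)]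

theorem rss_sub_rss_eq_norm_sq_extraSpace (h : t ⊆ k) {μ : EuclideanSpace ℝ (Fin n)}
    (hμ : μ ∈ colSpace X t) (e : EuclideanSpace ℝ (Fin n)) :
    rss X t (μ + e) - rss X k (μ + e) = ‖(extraSpace X t k).starProjection e‖ ^ 2 := by
  have := norm_sq_starProjection_eq_add (colSpace_mono (X := X) h) e
  rw [rss_add_of_mem hμ, rss_add_of_mem (colSpace_mono h hμ), extraSpace]
  linarith [norm_sq_eq_add_rss (X := X) t e, norm_sq_eq_add_rss (X := X) k e]

theorem DesignBound.le_rss {ε : ℝ} (hX : DesignBound X ε l) (hε : 0 ≤ ε) (hkl : k ⊆ l)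
    {x : Fin p → ℝ} (hx : ∀ j ∉ l, x j = 0) {j : Fin p} (hjl : j ∈ l) (hjk : j ∉ k) :
    n * ε * x j ^ 2 ≤ rss X k (WithLp.toLp 2 (X *ᵥ x)) := by
  obtain ⟨z, hzk, hz⟩ := exists_mulVec_of_mem_colSpace
    ((colSpace X k).starProjection_apply_mem (WithLp.toLp 2 (X *ᵥ x)))
  have hsupp : ∀ i ∉ l, (x - z) i = 0 := fun i hi ↦ by
    rw [Pi.sub_apply, hx i hi, hzk i (fun hik ↦ hi (hkl hik)), sub_zero]
  have hcoord : x j ^ 2 ≤ (fun i : l ↦ (x - z) i) ⬝ᵥ (fun i : l ↦ (x - z) i) := by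
    have hj : (x - z) j = x j := by rw [Pi.sub_apply, hzk j hjk, sub_zero]
    rw [← hj, sq]
    exact Finset.single_le_sum (f := fun i : l ↦ (x - z) i * (x - z) i)
      (fun i _ ↦ mul_self_nonneg _) (Finset.mem_univ ⟨j, hjl⟩)
  calc n * ε * x j ^ 2
      ≤ n * ε * ((fun i : l ↦ (x - z) i) ⬝ᵥ (fun i : l ↦ (x - z) i)) := by gcongr
    _ ≤ (X *ᵥ (x - z)) ⬝ᵥ (X *ᵥ (x - z)) := by
      simpa only [designSub_mulVec_restrict hsupp] using (hX fun i ↦ (x - z) i).1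
    _ = rss X k (WithLp.toLp 2 (X *ᵥ x)) := by
      rw [dotProduct_self_eq_norm_sq, Matrix.mulVec_sub, WithLp.toLp_sub, hz, rss,
        Submodule.starProjection_orthogonal_val]

theorem rss_sub_rss_le {x : Fin p → ℝ} (hx : ∀ j ∉ t, x j = 0) {ε h D : ℝ} (hε : 0 ≤ ε)
    (hX : DesignBound X ε (k ∪ t)) {j : Fin p} (hjt : j ∈ t) (hjk : j ∉ k)
    (hD : D ^ 2 ≤ n * ε * x j ^ 2) (hhD : h ≤ D) {e : EuclideanSpace ℝ (Fin n)}
    (he : ‖(colSpace X (k ∪ t)).starProjection e‖ ≤ h) :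
    rss X t (WithLp.toLp 2 (X *ᵥ x) + e) - rss X k (WithLp.toLp 2 (X *ᵥ x) + e) ≤
      h ^ 2 - (D - h) ^ 2 := by
  set μ := WithLp.toLp 2 (X *ᵥ x)
  set Pe := (colSpace X (k ∪ t)).starProjection e
  have hμt : μ ∈ colSpace X t := toLp_mulVec_mem_colSpace hx
  have hμ : μ ∈ colSpace X (k ∪ t) := colSpace_mono Finset.subset_union_right hμt
  have htrue : rss X t (μ + e) - rss X (k ∪ t) (μ + e) ≤ h ^ 2 := by
    rw [rss_add_of_mem hμt, rss_add_of_mem hμ,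
      rss_sub_rss_eq_rss_starProjection Finset.subset_union_right]
    exact (rss_le_norm_sq _ _).trans (pow_le_pow_left₀ (norm_nonneg _) he 2)
  have hwrong : (D - h) ^ 2 ≤ rss X k (μ + e) - rss X (k ∪ t) (μ + e) := by
    rw [rss_sub_rss_eq_rss_starProjection Finset.subset_union_left, map_add,
      Submodule.starProjection_eq_self_iff.2 hμ, rss, map_add]
    refine pow_le_pow_left₀ (sub_nonneg.2 hhD) ?_ 2
    have hbias : D ≤ ‖(colSpace X k)ᗮ.starProjection μ‖ :=
      le_of_sq_le_sq (hD.trans (hX.le_rss hε Finset.subset_union_left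
        (fun i hi ↦ hx i fun hit ↦ hi (Finset.mem_union_right _ hit))
        (Finset.mem_union_right _ hjt) hjk)) (norm_nonneg _)
    have hnoise : ‖(colSpace X k)ᗮ.starProjection Pe‖ ≤ h :=
      (Submodule.norm_starProjection_apply_le _ _).trans he
    linarith [norm_sub_le_norm_add ((colSpace X k)ᗮ.starProjection μ)
      ((colSpace X k)ᗮ.starProjection Pe)]
  linarith

end

/-! ### Integrating out the two scale parameters -/

theorem invGammaDensity_nonneg {a b x : ℝ} (ha : 0 < a) (hb : 0 ≤ b) (hx : 0 ≤ x) :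
    0 ≤ invGammaDensity a b x := by
  have := Real.Gamma_pos_of_pos ha
  rw [invGammaDensity]
  positivity

theorem measurable_invGammaDensity (a b : ℝ) : Measurable (invGammaDensity a b) := by
  unfold invGammaDensity
  fun_prop

theorem lintegral_invGammaDensity_mul {a b c m : ℝ} (ha : 0 < a) (hb : 0 < b) (hm : 0 < m + a)
    (hc : 0 < c + b) :
    ∫⁻ x in Set.Ioi (0 : ℝ),
        ENNReal.ofReal (invGammaDensity a b x * (x ^ (-m) * Real.exp (-c / x))) =
      ENNReal.ofReal (b ^ a / Real.Gamma a * (Real.Gamma (m + a) * (c + b) ^ (-(m + a)))) := by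
  have := Real.Gamma_pos_of_pos ha
  rw [ENNReal.ofReal_mul (by positivity), ← lintegral_rpow_mul_exp_neg_div hm hc,
    ← lintegral_const_mul' _ _ ENNReal.ofReal_ne_top]
  refine setLIntegral_congr_fun measurableSet_Ioi fun x (hx : 0 < x) ↦ ?_
  rw [← ENNReal.ofReal_mul (by positivity), invGammaDensity,
    show -(m + a + 1) = -(a + 1) + -m by ring, Real.rpow_add hx,
    show -(c + b) / x = -b / x + -c / x by ring, Real.exp_add]
  congr 1
  ring

theorem lintegral_invGammaDensity_half_mul_rpow_le {a n : ℝ} (ha : 0 ≤ a) (hn : 0 < n) :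
    ∫⁻ τ in Set.Ioi (0 : ℝ), ENNReal.ofReal (invGammaDensity (1 / 2) (n / 2) τ * τ ^ (-a)) ≤
      ENNReal.ofReal (√2 * (4 * a / n) ^ a) := by
  have : 0 < Real.Gamma (1 / 2) := Real.Gamma_pos_of_pos one_half_pos
  have hpow : (n / 2) ^ (1 / 2 : ℝ) * (n / 4) ^ (-(1 / 2 : ℝ)) = √2 := by
    rw [Real.rpow_neg (by positivity), ← div_eq_mul_inv, ← Real.div_rpow (by positivity)
      (by positivity), Real.sqrt_eq_rpow, div_div_div_cancel_left' _ _ hn.ne']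
    norm_num
  calc ∫⁻ τ in Set.Ioi (0 : ℝ), ENNReal.ofReal (invGammaDensity (1 / 2) (n / 2) τ * τ ^ (-a))
      ≤ ∫⁻ τ in Set.Ioi (0 : ℝ),
          ENNReal.ofReal ((4 * a / n) ^ a * (n / 2) ^ (1 / 2 : ℝ) / Real.Gamma (1 / 2)) *
            ENNReal.ofReal (τ ^ (-(1 / 2 + 1 : ℝ)) * Real.exp (-(n / 4) / τ)) := by
        refine setLIntegral_mono' measurableSet_Ioi fun τ (hτ : 0 < τ) ↦ ?_
        rw [← ENNReal.ofReal_mul (by positivity)]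
        refine ENNReal.ofReal_le_ofReal ?_
        have h := rpow_neg_mul_exp_neg_div_le ha (by positivity : 0 < n / 4) hτ
        rw [show a / (n / 4) = 4 * a / n by field_simp,
          show -(2 * (n / 4)) / τ = -(n / 2) / τ by ring] at h
        calc invGammaDensity (1 / 2) (n / 2) τ * τ ^ (-a)
            = (n / 2) ^ (1 / 2 : ℝ) / Real.Gamma (1 / 2) * τ ^ (-(1 / 2 + 1 : ℝ)) *
                (τ ^ (-a) * Real.exp (-(n / 2) / τ)) := by rw [invGammaDensity]; ring
          _ ≤ (n / 2) ^ (1 / 2 : ℝ) / Real.Gamma (1 / 2) * τ ^ (-(1 / 2 + 1 : ℝ)) *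
                ((4 * a / n) ^ a * Real.exp (-(n / 4) / τ)) := by gcongr
          _ = _ := by ring
    _ = ENNReal.ofReal (√2 * (4 * a / n) ^ a) := by
        rw [lintegral_const_mul' _ _ ENNReal.ofReal_ne_top,
          lintegral_rpow_mul_exp_neg_div one_half_pos (by positivity),
          ← ENNReal.ofReal_mul (by positivity), ← hpow]
        congr 1
        field_simp

theorem le_invGammaDensity_half {n τ : ℝ} (hn : 0 < n) (hτ : τ ∈ Set.Icc n (2 * n)) :
    Real.exp (-(1 / 2)) / (4 * Real.Gamma (1 / 2)) / n ≤ invGammaDensity (1 / 2) (n / 2) τ := by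
  have : 0 < Real.Gamma (1 / 2) := Real.Gamma_pos_of_pos one_half_pos
  have hτ0 : 0 < τ := hn.trans_le hτ.1
  have hpow : (n / 2) ^ (1 / 2 : ℝ) * (2 * n) ^ (-(1 / 2 + 1 : ℝ)) = 1 / (4 * n) := by
    rw [neg_add, Real.rpow_add (by positivity), Real.rpow_neg_one, Real.rpow_neg (by positivity),
      ← mul_assoc, ← div_eq_mul_inv (_ ^ _), ← Real.div_rpow (by positivity) (by positivity),
      show n / 2 / (2 * n) = (1 / 2) ^ (2 : ℝ) by rw [Real.rpow_two]; field_simp,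
      ← Real.rpow_mul (by norm_num)]
    norm_num
    ring
  have hexp : Real.exp (-(1 / 2)) ≤ Real.exp (-(n / 2) / τ) := by
    rw [Real.exp_le_exp, neg_div, neg_le_neg_iff, div_le_iff₀ hτ0]
    linarith [hτ.1]
  calc Real.exp (-(1 / 2)) / (4 * Real.Gamma (1 / 2)) / n
      = (n / 2) ^ (1 / 2 : ℝ) * (2 * n) ^ (-(1 / 2 + 1 : ℝ)) / Real.Gamma (1 / 2) *
          Real.exp (-(1 / 2)) := by
        rw [hpow]
        field_simp
    _ = (n / 2) ^ (1 / 2 : ℝ) / Real.Gamma (1 / 2) * (2 * n) ^ (-(1 / 2 + 1 : ℝ)) *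
          Real.exp (-(1 / 2)) := by ring
    _ ≤ _ := by
        have hmono := Real.rpow_le_rpow_of_nonpos hτ0 hτ.2 (by norm_num : -(1 / 2 + 1 : ℝ) ≤ 0)
        rw [invGammaDensity]
        gcongr

section

variable {n p r : ℕ} {α₁ α₂ : ℝ} {X : Matrix (Fin n) (Fin p) ℝ} {A : Matrix (Fin p) (Fin p) ℝ}
  {k : Finset (Fin p)} {y : Fin n → ℝ}

/-- The density of the data under the model `k` for given scales `τ` and `s = σ²`, obtained by
integrating out the regression coefficients. -/
def condMarginal (r : ℕ) (X : Matrix (Fin n) (Fin p) ℝ) (A : Matrix (Fin p) (Fin p) ℝ)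
    (k : Finset (Fin p)) (y : Fin n → ℝ) (τ s : ℝ) : ℝ≥0∞ :=
  ∫⁻ β : k → ℝ, ENNReal.ofReal (likelihood X k y β s * pmomDensity r A k (τ * s) β)

theorem marginal_eq_lintegral_condMarginal (hα₁ : 0 < α₁) (hα₂ : 0 < α₂) :
    marginal r α₁ α₂ X A k y = ∫⁻ τ in Set.Ioi (0 : ℝ), ∫⁻ s in Set.Ioi (0 : ℝ),
      ENNReal.ofReal (invGammaDensity (1 / 2) ((n : ℝ) / 2) τ) *
        ENNReal.ofReal (invGammaDensity α₁ α₂ s) * condMarginal r X A k y τ s := by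
  refine setLIntegral_congr_fun measurableSet_Ioi fun τ (hτ : 0 < τ) ↦
    setLIntegral_congr_fun measurableSet_Ioi fun s (hs : 0 < s) ↦ ?_
  have hτ' := invGammaDensity_nonneg one_half_pos (by positivity : 0 ≤ (n : ℝ) / 2) hτ.le
  have hs' := invGammaDensity_nonneg hα₁ hα₂.le hs.le
  rw [condMarginal, ← ENNReal.ofReal_mul hτ', ← lintegral_const_mul' _ _ ENNReal.ofReal_ne_top]
  refine lintegral_congr fun β ↦ ?_
  rw [← ENNReal.ofReal_mul (mul_nonneg hτ' hs')]
  congr 1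
  ring

theorem marginal_le_of_condMarginal_le (hn : 0 < n) (hα₁ : 0 < α₁) (hα₂ : 0 < α₂)
    {a c m C : ℝ} (ha : 0 ≤ a) (hm : 0 < m + α₁) (hc : 0 < c + α₂) (hC : 0 ≤ C)
    (h : ∀ τ > 0, ∀ s > 0, condMarginal r X A k y τ s ≤
      ENNReal.ofReal (C * τ ^ (-a) * (s ^ (-m) * Real.exp (-c / s)))) :
    marginal r α₁ α₂ X A k y ≤ ENNReal.ofReal (C * (√2 * (4 * a / n) ^ a) *
      (α₂ ^ α₁ / Real.Gamma α₁ * (Real.Gamma (m + α₁) * (c + α₂) ^ (-(m + α₁))))) := by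
  have hn' : (0 : ℝ) < n := Nat.cast_pos.2 hn
  calc marginal r α₁ α₂ X A k y
      ≤ ∫⁻ τ in Set.Ioi (0 : ℝ), ∫⁻ s in Set.Ioi (0 : ℝ),
          ENNReal.ofReal C *
            ENNReal.ofReal (invGammaDensity (1 / 2) ((n : ℝ) / 2) τ * τ ^ (-a)) *
            ENNReal.ofReal (invGammaDensity α₁ α₂ s * (s ^ (-m) * Real.exp (-c / s))) := by
        rw [marginal_eq_lintegral_condMarginal hα₁ hα₂]
        refine setLIntegral_mono' measurableSet_Ioi fun τ (hτ : 0 < τ) ↦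
          setLIntegral_mono' measurableSet_Ioi fun s (hs : 0 < s) ↦ ?_
        have hτ' := invGammaDensity_nonneg one_half_pos (by positivity : 0 ≤ (n : ℝ) / 2) hτ.le
        have hs' := invGammaDensity_nonneg hα₁ hα₂.le hs.le
        refine (mul_le_mul_right (h τ hτ s hs) _).trans_eq ?_
        rw [← ENNReal.ofReal_mul hτ', ← ENNReal.ofReal_mul (mul_nonneg hτ' hs'),
          ← ENNReal.ofReal_mul hC, ← ENNReal.ofReal_mul (by positivity)]
        congr 1
        ring
    _ = ENNReal.ofReal C *
          (∫⁻ τ in Set.Ioi (0 : ℝ),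
            ENNReal.ofReal (invGammaDensity (1 / 2) ((n : ℝ) / 2) τ * τ ^ (-a))) *
          ∫⁻ s in Set.Ioi (0 : ℝ),
            ENNReal.ofReal (invGammaDensity α₁ α₂ s * (s ^ (-m) * Real.exp (-c / s))) := by
        have hτ := measurable_invGammaDensity (1 / 2) ((n : ℝ) / 2)
        have hs := measurable_invGammaDensity α₁ α₂
        rw [lintegral_lintegral_mul (by fun_prop) (by fun_prop),
          lintegral_const_mul' _ _ ENNReal.ofReal_ne_top]
    _ ≤ _ := by
        rw [ENNReal.ofReal_mul (by positivity), ENNReal.ofReal_mul hC,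
          lintegral_invGammaDensity_mul hα₁ hα₂ hm hc]
        gcongr
        exact lintegral_invGammaDensity_half_mul_rpow_le ha hn'

theorem le_marginal_of_le_condMarginal (hn : 0 < n) (hα₁ : 0 < α₁) (hα₂ : 0 < α₂)
    {c m C : ℝ} (hm : 0 < m + α₁) (hc : 0 < c + α₂) (hC : 0 ≤ C)
    (h : ∀ τ ∈ Set.Icc (n : ℝ) (2 * n), ∀ s > 0,
      ENNReal.ofReal (C * (s ^ (-m) * Real.exp (-c / s))) ≤ condMarginal r X A k y τ s) :
    ENNReal.ofReal (C * (Real.exp (-(1 / 2)) / (4 * Real.Gamma (1 / 2))) *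
      (α₂ ^ α₁ / Real.Gamma α₁ * (Real.Gamma (m + α₁) * (c + α₂) ^ (-(m + α₁))))) ≤
        marginal r α₁ α₂ X A k y := by
  have hn' : (0 : ℝ) < n := Nat.cast_pos.2 hn
  have : 0 < Real.Gamma (1 / 2) := Real.Gamma_pos_of_pos one_half_pos
  set w := Real.exp (-(1 / 2)) / (4 * Real.Gamma (1 / 2))
  have hw : 0 < w := by positivity
  have hvol : ENNReal.ofReal (C * w / n) * volume (Set.Icc (n : ℝ) (2 * n)) =
      ENNReal.ofReal (C * w) := by
    rw [Real.volume_Icc, ← ENNReal.ofReal_mul (by positivity)]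
    congr 1
    field_simp
    ring
  rw [ENNReal.ofReal_mul (by positivity), ← lintegral_invGammaDensity_mul hα₁ hα₂ hm hc, ← hvol,
    ← setLIntegral_const, ← lintegral_lintegral_mul (by fun_prop)
      (by have := measurable_invGammaDensity α₁ α₂; fun_prop),
    marginal_eq_lintegral_condMarginal hα₁ hα₂]
  refine (setLIntegral_mono' measurableSet_Icc fun τ hτ ↦ ?_).trans
    (lintegral_mono_set fun τ (hτ : τ ∈ Set.Icc (n : ℝ) (2 * n)) ↦ hn'.trans_le hτ.1)
  refine setLIntegral_mono' measurableSet_Ioi fun s (hs : 0 < s) ↦ ?_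
  have hs' := invGammaDensity_nonneg hα₁ hα₂.le hs.le
  have hτ' := le_invGammaDensity_half hn' hτ
  calc ENNReal.ofReal (C * w / n) *
        ENNReal.ofReal (invGammaDensity α₁ α₂ s * (s ^ (-m) * Real.exp (-c / s)))
      = ENNReal.ofReal (w / n) * ENNReal.ofReal (invGammaDensity α₁ α₂ s) *
          ENNReal.ofReal (C * (s ^ (-m) * Real.exp (-c / s))) := by
        rw [← ENNReal.ofReal_mul (by positivity), ← ENNReal.ofReal_mul (by positivity),
          ← ENNReal.ofReal_mul (by positivity)]
        congr 1
        ring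
    _ ≤ _ := by
        gcongr
        exact h τ hτ s hs

end

/-! ### Upper bound for the marginal density -/

theorem four_pow_mul_add_le {r : ℕ} (hr : r ≠ 0) {c M s : ℝ} (hc : 1 ≤ c) (hM : 1 ≤ M)
    (hs : 0 < s) :
    4 ^ r * (M ^ r + r.factorial * (2 / (c / (2 * s))) ^ r) ≤
      16 ^ r * r.factorial * M ^ r * (1 + s) ^ r := by
  have hfact : (1 : ℝ) ≤ r.factorial := by exact_mod_cast r.factorial_pos
  have hMr : 1 ≤ M ^ r := one_le_pow₀ hM
  have hscale : 2 / (c / (2 * s)) ≤ 4 * s := by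
    rw [div_div_eq_mul_div]
    exact (div_le_self (by positivity) hc).trans_eq (by ring)
  calc 4 ^ r * (M ^ r + r.factorial * (2 / (c / (2 * s))) ^ r)
      ≤ 4 ^ r * (r.factorial * M ^ r + r.factorial * M ^ r * (4 * s) ^ r) := by
        gcongr
        · exact le_mul_of_one_le_left (by positivity) hfact
        · exact le_mul_of_one_le_right (by positivity) hMr
    _ = 4 ^ r * (r.factorial * M ^ r * (1 ^ r + (4 * s) ^ r)) := by rw [one_pow]; ring
    _ ≤ 4 ^ r * (r.factorial * M ^ r * (4 * (1 + s)) ^ r) := by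
        gcongr
        refine (pow_add_pow_le zero_le_one (by positivity) hr).trans ?_
        gcongr
        linarith
    _ = (4 * 4) ^ r * r.factorial * M ^ r * (1 + s) ^ r := by
        rw [mul_pow, mul_pow]
        ring
    _ = 16 ^ r * r.factorial * M ^ r * (1 + s) ^ r := by norm_num

theorem rpow_neg_mul_one_add_pow_mul_sqrt_le (r : ℕ) {s : ℝ} (hs : 0 < s) :
    s ^ (-(r + 1 / 2 : ℝ)) * ((1 + s) ^ r * √s) ≤ Real.exp (r / s) := by
  have hsqrt : √s ≠ 0 := (Real.sqrt_pos.2 hs).ne'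
  calc s ^ (-(r + 1 / 2 : ℝ)) * ((1 + s) ^ r * √s)
      = (1 / s + 1) ^ r := by
        rw [Real.rpow_neg hs.le, Real.rpow_add hs, Real.rpow_natCast, ← Real.sqrt_eq_rpow,
          div_add_one hs.ne', div_pow]
        field_simp
    _ ≤ Real.exp (1 / s) ^ r := by
        gcongr
        exact Real.add_one_le_exp _
    _ = Real.exp (r / s) := by rw [← Real.exp_nat_mul, mul_one_div]

theorem rpow_neg_mul_four_pow_mul_le {r : ℕ} (hr : r ≠ 0) {c M s : ℝ} (hc : 1 ≤ c) (hM : 1 ≤ M)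
    (hs : 0 < s) :
    s ^ (-(r + 1 / 2 : ℝ)) * (4 ^ r * (M ^ r + r.factorial * (2 / (c / (2 * s))) ^ r) *
        √(2 * Real.pi / (c / (2 * s)))) ≤
      16 ^ r * r.factorial * M ^ r * √(4 * Real.pi / c) * Real.exp (r / s) := by
  have hsqrt : √(2 * Real.pi / (c / (2 * s))) = √s * √(4 * Real.pi / c) := by
    rw [← Real.sqrt_mul hs.le, div_div_eq_mul_div]
    ring_nf
  rw [hsqrt]
  calc _ ≤ s ^ (-(r + 1 / 2 : ℝ)) * (16 ^ r * r.factorial * M ^ r * (1 + s) ^ r *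
        (√s * √(4 * Real.pi / c))) := by
        gcongr ?_ * (?_ * _)
        exact four_pow_mul_add_le hr hc hM hs
    _ = 16 ^ r * r.factorial * M ^ r * √(4 * Real.pi / c) *
          (s ^ (-(r + 1 / 2 : ℝ)) * ((1 + s) ^ r * √s)) := by ring
    _ ≤ _ := by
        gcongr
        exact rpow_neg_mul_one_add_pow_mul_sqrt_le r hs

section

variable {n p r : ℕ} {α₁ α₂ a₁ a₂ ε M : ℝ} {X : Matrix (Fin n) (Fin p) ℝ}
  {A : Matrix (Fin p) (Fin p) ℝ} {k : Finset (Fin p)} {y : Fin n → ℝ}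

theorem likelihood_nonneg {s : ℝ} (hs : 0 ≤ s) (β : k → ℝ) : 0 ≤ likelihood X k y β s := by
  rw [likelihood]
  positivity

theorem likelihood_le {s : ℝ} (hX : DesignBound X ε k) (hs : 0 < s) (β : k → ℝ) :
    likelihood X k y β s ≤ (2 * Real.pi) ^ (-((n : ℝ) / 2)) * s ^ (-((n : ℝ) / 2)) *
      Real.exp (-rss X k (WithLp.toLp 2 y) / (2 * s)) *
      Real.exp (-(n * ε / (2 * s)) *
        ((β - leastSquares X k y) ⬝ᵥ (β - leastSquares X k y))) := by
  rw [likelihood, Real.mul_rpow (by positivity) hs.le, dotProduct_self_sub_designSub_mulVec,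
    mul_assoc _ (Real.exp _), ← Real.exp_add]
  gcongr
  have hquad := (hX (β - leastSquares X k y)).1
  refine (div_le_div_of_nonneg_right (neg_le_neg (add_le_add_right hquad _))
    (by positivity)).trans_eq ?_
  ring

theorem pmomDensity_le (ha₁ : 0 < a₁) (ha₂ : 0 < a₂) (hA : LoewnerBound (principalSub A k) a₁ a₂)
    {v : ℝ} (hv : 0 < v) (β : k → ℝ) :
    pmomDensity r A k v β ≤ (gaussianMoment r a₂ ^ k.card)⁻¹ * v ^ (-((r + 1 / 2 : ℝ) * k.card)) *
      ∏ i, β i ^ (2 * r) := by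
  have hmass := (pmomMass_bounds (r := r) ha₁ ha₂ hA).1
  have hg := gaussianMoment_pos r ha₂
  have hprod := prod_even_pow_nonneg β r
  have hexp : Real.exp (-(β ⬝ᵥ (principalSub A k *ᵥ β)) / (2 * v)) ≤ 1 := by
    have hquad : 0 ≤ β ⬝ᵥ (principalSub A k *ᵥ β) :=
      (mul_nonneg ha₁.le (dotProduct_self_star_nonneg β)).trans (hA.le_dotProduct β)
    rw [Real.exp_le_one_iff, neg_div, neg_nonpos]
    positivity
  rw [pmomDensity_eq (hA.det_pos ha₁)]
  calc _ ≤ (gaussianMoment r a₂ ^ k.card)⁻¹ * v ^ (-((r + 1 / 2 : ℝ) * k.card)) * 1 *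
        ∏ i, β i ^ (2 * r) := by gcongr
    _ = _ := by rw [mul_one]

theorem condMarginal_le_pow (ha₁ : 0 < a₁) (ha₂ : 0 < a₂)
    (hA : LoewnerBound (principalSub A k) a₁ a₂) (hX : DesignBound X ε k) (hε : 0 < n * ε)
    (hb : ∀ i, leastSquares X k y i ^ 2 ≤ M) {τ s : ℝ} (hτ : 0 < τ) (hs : 0 < s) :
    condMarginal r X A k y τ s ≤ ENNReal.ofReal ((2 * Real.pi) ^ (-((n : ℝ) / 2)) *
      s ^ (-((n : ℝ) / 2)) * Real.exp (-rss X k (WithLp.toLp 2 y) / (2 * s)) *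
      ((gaussianMoment r a₂ ^ k.card)⁻¹ * (τ * s) ^ (-((r + 1 / 2 : ℝ) * k.card))) *
      (4 ^ r * (M ^ r + r.factorial * (2 / (n * ε / (2 * s))) ^ r) *
        √(2 * Real.pi / (n * ε / (2 * s)))) ^ k.card) := by
  have hg := gaussianMoment_pos r ha₂
  set b := leastSquares X k y
  set w := (2 * Real.pi) ^ (-((n : ℝ) / 2)) * s ^ (-((n : ℝ) / 2)) *
    Real.exp (-rss X k (WithLp.toLp 2 y) / (2 * s)) *
    ((gaussianMoment r a₂ ^ k.card)⁻¹ * (τ * s) ^ (-((r + 1 / 2 : ℝ) * k.card)))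
  have hw : 0 ≤ w := by positivity
  rw [ENNReal.ofReal_mul hw]
  calc condMarginal r X A k y τ s
      ≤ ∫⁻ β : k → ℝ, ENNReal.ofReal w * ENNReal.ofReal
          (Real.exp (-(n * ε / (2 * s)) * ((β - b) ⬝ᵥ (β - b))) * ∏ i, β i ^ (2 * r)) := by
        refine lintegral_mono fun β ↦ ?_
        have hprod := prod_even_pow_nonneg β r
        rw [← ENNReal.ofReal_mul hw]
        refine ENNReal.ofReal_le_ofReal ((mul_le_mul_of_nonneg (likelihood_le hX hs β)
          (pmomDensity_le ha₁ ha₂ hA (mul_pos hτ hs) β) (likelihood_nonneg hs.le β)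
          (by positivity)).trans_eq ?_)
        ring
    _ ≤ _ := by
        rw [lintegral_const_mul' _ _ ENNReal.ofReal_ne_top, ← Fintype.card_coe k]
        refine mul_le_mul_right (lintegral_exp_neg_sq_mul_prod_pow_le r (by positivity) b
          fun i ↦ ?_) _
        rw [pow_mul]
        exact pow_le_pow_left₀ (sq_nonneg _) (hb i) r

theorem condMarginal_le (hr : r ≠ 0) (ha₁ : 0 < a₁) (ha₂ : 0 < a₂)
    (hA : LoewnerBound (principalSub A k) a₁ a₂) (hX : DesignBound X ε k) (hε : 1 ≤ n * ε)
    (hM : 1 ≤ M) (hb : ∀ i, leastSquares X k y i ^ 2 ≤ M) {τ s : ℝ} (hτ : 0 < τ) (hs : 0 < s) :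
    condMarginal r X A k y τ s ≤ ENNReal.ofReal ((2 * Real.pi) ^ (-((n : ℝ) / 2)) *
      ((gaussianMoment r a₂)⁻¹ *
        (16 ^ r * r.factorial * M ^ r * √(4 * Real.pi / (n * ε)))) ^ k.card *
      τ ^ (-((r + 1 / 2 : ℝ) * k.card)) *
      (s ^ (-((n : ℝ) / 2)) *
        Real.exp (-(rss X k (WithLp.toLp 2 y) / 2 - r * k.card) / s))) := by
  have hg := gaussianMoment_pos r ha₂
  have hfactor := rpow_neg_mul_four_pow_mul_le hr hε hM hs
  refine (condMarginal_le_pow ha₁ ha₂ hA hX (by positivity) hb hτ hs).trans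
    (ENNReal.ofReal_le_ofReal ?_)
  set R := rss X k (WithLp.toLp 2 y)
  set D := 4 ^ r * (M ^ r + r.factorial * (2 / (n * ε / (2 * s))) ^ r) *
    √(2 * Real.pi / (n * ε / (2 * s)))
  set c := (2 * Real.pi) ^ (-((n : ℝ) / 2)) * s ^ (-((n : ℝ) / 2)) * Real.exp (-R / (2 * s))
  calc _ = c * (gaussianMoment r a₂ ^ k.card)⁻¹ * τ ^ (-((r + 1 / 2 : ℝ) * k.card)) *
        (s ^ (-(r + 1 / 2 : ℝ)) * D) ^ k.card := by
        rw [Real.mul_rpow hτ.le hs.le, mul_pow _ D, ← Real.rpow_mul_natCast hs.le, neg_mul]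
        ring
    _ ≤ c * (gaussianMoment r a₂ ^ k.card)⁻¹ * τ ^ (-((r + 1 / 2 : ℝ) * k.card)) *
          (16 ^ r * r.factorial * M ^ r * √(4 * Real.pi / (n * ε)) *
            Real.exp (r / s)) ^ k.card := by gcongr
    _ = _ := by
        have hexp : Real.exp (-(R / 2 - r * k.card) / s) =
            Real.exp (-R / (2 * s)) * Real.exp (r / s) ^ k.card := by
          rw [← Real.exp_nat_mul, ← Real.exp_add]
          congr 1
          field_simp
          ring
        rw [hexp, mul_pow _ (Real.exp (r / s)), mul_pow _ (16 ^ r * _ * _ * _), inv_pow]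
        ring

theorem DesignBound.sq_apply_le (hX : DesignBound X ε k) (hε : 0 < n * ε) (β : k → ℝ) (i : k) :
    β i ^ 2 ≤ ‖WithLp.toLp 2 (designSub X k *ᵥ β)‖ ^ 2 / (n * ε) := by
  rw [le_div_iff₀' hε, ← dotProduct_self_eq_norm_sq]
  refine le_trans ?_ (hX β).1
  gcongr
  rw [sq]
  exact Finset.single_le_sum (f := fun i ↦ β i * β i) (fun i _ ↦ mul_self_nonneg _)
    (Finset.mem_univ i)

/-- The factor common to the bounds for the marginal densities of all models. -/
def commonFactor (n : ℕ) (α₁ α₂ : ℝ) : ℝ :=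
  (2 * Real.pi) ^ (-((n : ℝ) / 2)) * (α₂ ^ α₁ / Real.Gamma α₁) * Real.Gamma (n / 2 + α₁)

theorem commonFactor_pos (n : ℕ) (hα₁ : 0 < α₁) (hα₂ : 0 < α₂) : 0 < commonFactor n α₁ α₂ := by
  have : 0 < Real.Gamma α₁ := Real.Gamma_pos_of_pos hα₁
  have : 0 < Real.Gamma (n / 2 + α₁) := Real.Gamma_pos_of_pos (by positivity)
  rw [commonFactor]
  positivity

/-- The factor that one more variable contributes to the upper bound for a marginal density, up to
powers of `n`, of the model size and of the conditioning of the design. -/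
def upperConst (r : ℕ) (a₂ : ℝ) : ℝ :=
  (gaussianMoment r a₂)⁻¹ * (4 * (r + 1 / 2 : ℝ)) ^ (r + 1 / 2 : ℝ) *
    (16 ^ r * r.factorial * √(4 * Real.pi))

theorem upperConst_pos (r : ℕ) (ha₂ : 0 < a₂) : 0 < upperConst r a₂ := by
  have := gaussianMoment_pos r ha₂
  rw [upperConst]
  positivity

theorem rpow_neg_mul_inv_sqrt {x : ℝ} (hx : 0 < x) (r : ℕ) :
    x ^ (-(r + 1 / 2 : ℝ)) * (√x)⁻¹ = (x ^ (r + 1))⁻¹ := by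
  rw [Real.rpow_neg hx.le, ← mul_inv, Real.sqrt_eq_rpow, ← Real.rpow_add hx, ← Real.rpow_natCast]
  congr 2
  push_cast
  ring

theorem upper_factor_le (hn : 0 < n) (ha₂ : 0 < a₂) (hε0 : 0 < ε) (hε1 : ε ≤ 1) (hM : 0 ≤ M)
    (K : ℕ) :
    (gaussianMoment r a₂)⁻¹ *
        (16 ^ r * r.factorial * (M * ε⁻¹ ^ 2) ^ r * √(4 * Real.pi / (n * ε))) *
        (4 * ((r + 1 / 2 : ℝ) * K) / n) ^ (r + 1 / 2 : ℝ) ≤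
      upperConst r a₂ * M ^ r * (K : ℝ) ^ (r + 1 / 2 : ℝ) * ε⁻¹ ^ (2 * r + 1) / n ^ (r + 1) := by
  have hn' : (0 : ℝ) < n := Nat.cast_pos.2 hn
  have hup := upperConst_pos r ha₂
  have hsqrt : (√ε)⁻¹ ≤ ε⁻¹ := by
    gcongr
    exact Real.le_sqrt_of_sq_le (by nlinarith)
  calc _ = upperConst r a₂ * M ^ r * (K : ℝ) ^ (r + 1 / 2 : ℝ) * (ε⁻¹ ^ (2 * r) * (√ε)⁻¹) *
        ((n : ℝ) ^ (-(r + 1 / 2 : ℝ)) * (√n)⁻¹) := by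
        rw [← mul_assoc 4, Real.div_rpow (by positivity) hn'.le,
          Real.mul_rpow (by positivity) K.cast_nonneg, Real.sqrt_div (by positivity),
          Real.sqrt_mul hn'.le, Real.rpow_neg hn'.le, upperConst, mul_pow, ← pow_mul]
        ring
    _ ≤ upperConst r a₂ * M ^ r * (K : ℝ) ^ (r + 1 / 2 : ℝ) * (ε⁻¹ ^ (2 * r) * ε⁻¹) *
          ((n : ℝ) ^ (-(r + 1 / 2 : ℝ)) * (√n)⁻¹) := by gcongr
    _ = _ := by
        rw [rpow_neg_mul_inv_sqrt hn', ← pow_succ, ← div_eq_mul_inv]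

theorem marginal_le (hr : r ≠ 0) (hα₁ : 0 < α₁) (hα₂ : 0 < α₂) (ha₁ : 0 < a₁) (ha₂ : 0 < a₂)
    (hA : LoewnerBound (principalSub A k) a₁ a₂) (hX : DesignBound X ε k) (hε0 : 0 < ε)
    (hε1 : ε ≤ 1) (hε : 1 ≤ n * ε) (hM : 1 ≤ M)
    (hy : ‖WithLp.toLp 2 y‖ ^ 2 ≤ n * ε⁻¹ * M)
    (hR : 0 < rss X k (WithLp.toLp 2 y) / 2 + α₂ - r * k.card) :
    marginal r α₁ α₂ X A k y ≤ ENNReal.ofReal (commonFactor n α₁ α₂ * √2 *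
      (upperConst r a₂ * M ^ r * (k.card : ℝ) ^ (r + 1 / 2 : ℝ) * ε⁻¹ ^ (2 * r + 1) /
        n ^ (r + 1)) ^ k.card *
      (rss X k (WithLp.toLp 2 y) / 2 + α₂ - r * k.card) ^ (-((n : ℝ) / 2 + α₁))) := by
  have hn : 0 < n := Nat.pos_of_ne_zero fun h ↦ by norm_num [h] at hε
  have hg := gaussianMoment_pos r ha₂
  have hcommon := commonFactor_pos n hα₁ hα₂
  have hfit : ∀ i, leastSquares X k y i ^ 2 ≤ M * ε⁻¹ ^ 2 := fun i ↦
    calc leastSquares X k y i ^ 2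
        ≤ n * ε⁻¹ * M / (n * ε) := by
          refine (hX.sq_apply_le (by positivity) _ i).trans ?_
          rw [toLp_designSub_mulVec_leastSquares]
          gcongr
          refine le_trans ?_ hy
          gcongr
          exact Submodule.norm_starProjection_apply_le _ _
      _ = M * ε⁻¹ ^ 2 := by field_simp
  have hM' : 1 ≤ M * ε⁻¹ ^ 2 :=
    one_le_mul_of_one_le_of_one_le hM (one_le_pow₀ ((one_le_inv₀ hε0).2 hε1))
  have hmarg := marginal_le_of_condMarginal_le (A := A) hn hα₁ hα₂
    (a := (r + 1 / 2 : ℝ) * k.card) (by positivity) (by positivity : 0 < (n : ℝ) / 2 + α₁)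
    (by linarith) (by positivity)
    fun τ hτ s hs ↦ condMarginal_le hr ha₁ ha₂ hA hX hε hM' hfit hτ hs
  refine hmarg.trans (ENNReal.ofReal_le_ofReal ?_)
  rw [sub_add_eq_add_sub, Real.rpow_mul_natCast (by positivity)]
  calc _ = commonFactor n α₁ α₂ * √2 * ((gaussianMoment r a₂)⁻¹ *
        (16 ^ r * r.factorial * (M * ε⁻¹ ^ 2) ^ r * √(4 * Real.pi / (n * ε))) *
        (4 * ((r + 1 / 2 : ℝ) * k.card) / n) ^ (r + 1 / 2 : ℝ)) ^ k.card *
        (rss X k (WithLp.toLp 2 y) / 2 + α₂ - r * k.card) ^ (-((n : ℝ) / 2 + α₁)) := by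
        rw [commonFactor, mul_pow (_ * _) (_ ^ (r + 1 / 2 : ℝ))]
        ring
    _ ≤ _ := by
        gcongr
        exact upper_factor_le hn ha₂ hε0 hε1 (by positivity) _

end

/-! ### Lower bound for the marginal density of the true model -/

section

variable {n p r : ℕ} {α₁ α₂ a₁ a₂ ε B c : ℝ} {X : Matrix (Fin n) (Fin p) ℝ}
  {A : Matrix (Fin p) (Fin p) ℝ} {k : Finset (Fin p)} {y : Fin n → ℝ}

theorem le_likelihood (hn : 0 < n) (hε : 0 < ε) (hX : DesignBound X ε k) {β : k → ℝ}
    (hβ : β ∈ Metric.closedBall (leastSquares X k y) √(ε / n)) {s : ℝ} (hs : 0 < s) :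
    (2 * Real.pi) ^ (-((n : ℝ) / 2)) * s ^ (-((n : ℝ) / 2)) *
        Real.exp (-(rss X k (WithLp.toLp 2 y) + k.card) / (2 * s)) ≤ likelihood X k y β s := by
  have : (0 : ℝ) < n := Nat.cast_pos.2 hn
  have hdist : (β - leastSquares X k y) ⬝ᵥ (β - leastSquares X k y) ≤ k.card * (ε / n) := by
    rw [← nsmul_eq_mul, ← Fintype.card_coe k]
    refine Finset.sum_le_card_nsmul _ _ _ fun i _ ↦ ?_
    rw [← sq, ← sq_abs, ← Real.le_sqrt (abs_nonneg _) (by positivity)]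
    exact (dist_le_pi_dist β _ i).trans hβ
  have hfit : (designSub X k *ᵥ (β - leastSquares X k y)) ⬝ᵥ
      (designSub X k *ᵥ (β - leastSquares X k y)) ≤ k.card :=
    calc _ ≤ n * ε⁻¹ * (k.card * (ε / n)) := (hX _).2.trans (by gcongr)
      _ = k.card := by field_simp
  rw [likelihood, Real.mul_rpow (by positivity) hs.le, dotProduct_self_sub_designSub_mulVec]
  gcongr

theorem le_pmomDensity (ha₁ : 0 < a₁) (ha₂ : 0 < a₂) (hA : LoewnerBound (principalSub A k) a₁ a₂)
    (hc : 0 ≤ c) {β : k → ℝ} (hβ : ∀ i, c ≤ β i ^ (2 * r)) (hB : β ⬝ᵥ β ≤ B) {v : ℝ}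
    (hv : 0 < v) :
    (gaussianMoment r a₁ ^ k.card)⁻¹ * v ^ (-((r + 1 / 2 : ℝ) * k.card)) *
        Real.exp (-(a₂ * B) / (2 * v)) * c ^ k.card ≤ pmomDensity r A k v β := by
  have hmass := pmomMass_bounds (r := r) ha₁ ha₂ hA
  have hmass_pos := (pow_pos (gaussianMoment_pos r ha₂) _).trans_le hmass.1
  have hquad : β ⬝ᵥ (principalSub A k *ᵥ β) ≤ a₂ * B := (hA.dotProduct_le β).trans (by gcongr)
  have hprod : c ^ k.card ≤ ∏ i, β i ^ (2 * r) := by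
    rw [← Fintype.card_coe k, ← Finset.card_univ, ← Finset.prod_const]
    exact Finset.prod_le_prod (fun _ _ ↦ hc) fun i _ ↦ hβ i
  rw [pmomDensity_eq (hA.det_pos ha₁)]
  gcongr
  exact hmass.2

theorem le_pmomDensity_mul (hn : 0 < n) (ha₁ : 0 < a₁) (ha₂ : 0 < a₂)
    (hA : LoewnerBound (principalSub A k) a₁ a₂) (hc : 0 ≤ c) {β : k → ℝ}
    (hβ : ∀ i, c ≤ β i ^ (2 * r)) (hB : β ⬝ᵥ β ≤ B) {τ s : ℝ}
    (hτ : τ ∈ Set.Icc (n : ℝ) (2 * n)) (hs : 0 < s) :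
    (gaussianMoment r a₁ ^ k.card)⁻¹ * (2 * n * s) ^ (-((r + 1 / 2 : ℝ) * k.card)) *
        Real.exp (-(a₂ * B) / (2 * s)) * c ^ k.card ≤ pmomDensity r A k (τ * s) β := by
  have hg := gaussianMoment_pos r ha₁
  have hτ1 : 1 ≤ τ := (Nat.one_le_cast.2 hn).trans hτ.1
  have hB0 : 0 ≤ B := (dotProduct_self_star_nonneg β).trans hB
  refine le_trans ?_ (le_pmomDensity ha₁ ha₂ hA hc hβ hB (by positivity : 0 < τ * s))
  have hpow : (2 * n * s) ^ (-((r + 1 / 2 : ℝ) * k.card)) ≤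
      (τ * s) ^ (-((r + 1 / 2 : ℝ) * k.card)) :=
    Real.rpow_le_rpow_of_nonpos (by positivity) (by gcongr; exact hτ.2)
      (neg_nonpos.2 (by positivity))
  rw [neg_div, neg_div]
  gcongr
  exact le_mul_of_one_le_left hs.le hτ1

theorem le_condMarginal (hn : 0 < n) (ha₁ : 0 < a₁) (ha₂ : 0 < a₂)
    (hA : LoewnerBound (principalSub A k) a₁ a₂) (hε : 0 < ε) (hX : DesignBound X ε k)
    (hc : 0 ≤ c)
    (hbox : ∀ β ∈ Metric.closedBall (leastSquares X k y) √(ε / n),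
      (∀ i, c ≤ β i ^ (2 * r)) ∧ β ⬝ᵥ β ≤ B) {τ s : ℝ}
    (hτ : τ ∈ Set.Icc (n : ℝ) (2 * n)) (hs : 0 < s) :
    ENNReal.ofReal ((2 * Real.pi) ^ (-((n : ℝ) / 2)) *
      ((gaussianMoment r a₁)⁻¹ * (2 * n : ℝ) ^ (-(r + 1 / 2 : ℝ)) * c *
        (2 * √(ε / n))) ^ k.card *
      (s ^ (-((n : ℝ) / 2 + (r + 1 / 2 : ℝ) * k.card)) *
        Real.exp (-((rss X k (WithLp.toLp 2 y) + k.card + a₂ * B) / 2) / s))) ≤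
      condMarginal r X A k y τ s := by
  set R := rss X k (WithLp.toLp 2 y)
  have hg := gaussianMoment_pos r ha₁
  set L := (2 * Real.pi) ^ (-((n : ℝ) / 2)) * s ^ (-((n : ℝ) / 2)) *
    Real.exp (-(R + k.card) / (2 * s))
  set Q := (gaussianMoment r a₁ ^ k.card)⁻¹ * (2 * n * s) ^ (-((r + 1 / 2 : ℝ) * k.card)) *
    Real.exp (-(a₂ * B) / (2 * s)) * c ^ k.card
  have hexp : Real.exp (-((R + k.card + a₂ * B) / 2) / s) =
      Real.exp (-(R + k.card) / (2 * s)) * Real.exp (-(a₂ * B) / (2 * s)) := by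
    rw [← Real.exp_add]
    congr 1
    field_simp
    ring
  calc _ = ENNReal.ofReal (L * Q) *
        volume (Metric.closedBall (leastSquares X k y) √(ε / n)) := by
        rw [Real.volume_pi_closedBall _ (by positivity), Fintype.card_coe,
          ← ENNReal.ofReal_mul (by positivity), hexp,
          neg_add (n / 2 : ℝ), Real.rpow_add hs]
        simp only [L, Q]
        rw [Real.mul_rpow (by positivity) hs.le, ← neg_mul _ (k.card : ℝ),
          Real.rpow_mul_natCast (x := 2 * n) (by positivity), mul_pow, mul_pow, mul_pow, inv_pow]
        congr 1
        ring
    _ = ∫⁻ _ in Metric.closedBall (leastSquares X k y) √(ε / n), ENNReal.ofReal (L * Q) := by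
        rw [setLIntegral_const]
    _ ≤ ∫⁻ β in Metric.closedBall (leastSquares X k y) √(ε / n),
          ENNReal.ofReal (likelihood X k y β s * pmomDensity r A k (τ * s) β) := by
        refine setLIntegral_mono' Metric.isClosed_closedBall.measurableSet fun β hβ ↦
          ENNReal.ofReal_le_ofReal (mul_le_mul (le_likelihood hn hε hX hβ hs)
            (le_pmomDensity_mul hn ha₁ ha₂ hA hc (hbox β hβ).1 (hbox β hβ).2 hτ hs)
            (by positivity) (likelihood_nonneg hs.le β))
    _ ≤ condMarginal r X A k y τ s := setLIntegral_le_lintegral _ _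

theorem rpow_mul_Gamma_mul_rpow_le (hr : r ≠ 0) {N H : ℝ} (hN : 0 < N) (hH : 0 < H) (K : ℕ) :
    ((N / H) ^ (r + 1 / 2 : ℝ)) ^ K * Real.Gamma N * H ^ (-N) ≤
      Real.Gamma (N + (r + 1 / 2 : ℝ) * K) * H ^ (-(N + (r + 1 / 2 : ℝ) * K)) := by
  have hΓ : N ^ ((r + 1 / 2 : ℝ) * K) * Real.Gamma N ≤ Real.Gamma (N + (r + 1 / 2 : ℝ) * K) := by
    rcases eq_or_ne K 0 with rfl | hK
    · simp
    · have hr1 : (1 : ℝ) ≤ r := by exact_mod_cast Nat.one_le_iff_ne_zero.2 hr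
      have hK1 : (1 : ℝ) ≤ K := by exact_mod_cast Nat.one_le_iff_ne_zero.2 hK
      exact rpow_mul_Gamma_le hN (by nlinarith)
  calc _ = N ^ ((r + 1 / 2 : ℝ) * K) * Real.Gamma N * H ^ (-(N + (r + 1 / 2 : ℝ) * K)) := by
        rw [← Real.rpow_mul_natCast (by positivity), Real.div_rpow hN.le hH.le, neg_add,
          Real.rpow_add hH, Real.rpow_neg hH.le ((r + 1 / 2 : ℝ) * K)]
        ring
    _ ≤ _ := by gcongr

/-- The factor that one variable contributes to the lower bound for the marginal density of the
true model, up to powers of `n` and of the conditioning of the design, when the true coefficients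
are bounded below by `b` and the scale of the posterior of `σ²` is at most `h n`. -/
def lowerConst (r : ℕ) (a₁ b h : ℝ) : ℝ :=
  (gaussianMoment r a₁)⁻¹ * (b / 2) ^ (2 * r) * 2 ^ (-(r + 1 / 2 : ℝ)) * 2 *
    (1 / (2 * h)) ^ (r + 1 / 2 : ℝ)

theorem lowerConst_pos (r : ℕ) {b h : ℝ} (ha₁ : 0 < a₁) (hb : 0 < b) (hh : 0 < h) :
    0 < lowerConst r a₁ b h := by
  have := gaussianMoment_pos r ha₁
  rw [lowerConst]
  positivity

theorem lower_factor_le (hn : 0 < n) (ha₁ : 0 < a₁) (hε : 0 < ε) {b h N H : ℝ} (hb : 0 ≤ b)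
    (hN : n / 2 ≤ N) (hH : 0 < H) (hHh : H ≤ h * n) :
    lowerConst r a₁ b h * √ε / n ^ (r + 1) ≤
      (gaussianMoment r a₁)⁻¹ * (2 * n : ℝ) ^ (-(r + 1 / 2 : ℝ)) * (b / 2) ^ (2 * r) *
        (2 * √(ε / n)) * (N / H) ^ (r + 1 / 2 : ℝ) := by
  have hn' : (0 : ℝ) < n := Nat.cast_pos.2 hn
  have hh : 0 < h := pos_of_mul_pos_left (hH.trans_le hHh) hn'.le
  have hg := gaussianMoment_pos r ha₁
  have hNH : 1 / (2 * h) ≤ N / H := by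
    rw [div_le_div_iff₀ (by positivity) hH]
    nlinarith [hN, hHh, hh]
  calc _ = (gaussianMoment r a₁)⁻¹ * (2 * n : ℝ) ^ (-(r + 1 / 2 : ℝ)) * (b / 2) ^ (2 * r) *
        (2 * √(ε / n)) * (1 / (2 * h)) ^ (r + 1 / 2 : ℝ) := by
        rw [lowerConst, Real.mul_rpow zero_le_two hn'.le, Real.sqrt_div hε.le,
          div_eq_mul_inv _ ((n : ℝ) ^ (r + 1)), ← rpow_neg_mul_inv_sqrt hn']
        ring
    _ ≤ _ := by
        gcongr

theorem le_marginal (hr : r ≠ 0) (hn : 0 < n) (hα₁ : 0 < α₁) (hα₂ : 0 < α₂) (ha₁ : 0 < a₁)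
    (ha₂ : 0 < a₂) (hA : LoewnerBound (principalSub A k) a₁ a₂) (hε : 0 < ε)
    (hX : DesignBound X ε k) {b h H : ℝ} (hb : 0 < b) (hB : 0 ≤ B)
    (hbox : ∀ β ∈ Metric.closedBall (leastSquares X k y) √(ε / n),
      (∀ i, (b / 2) ^ (2 * r) ≤ β i ^ (2 * r)) ∧ β ⬝ᵥ β ≤ B)
    (hH : H = (rss X k (WithLp.toLp 2 y) + k.card + a₂ * B) / 2 + α₂) (hHh : H ≤ h * n) :
    ENNReal.ofReal (commonFactor n α₁ α₂ * (Real.exp (-(1 / 2)) / (4 * Real.Gamma (1 / 2))) *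
      (lowerConst r a₁ b h * √ε / n ^ (r + 1)) ^ k.card * H ^ (-((n : ℝ) / 2 + α₁))) ≤
      marginal r α₁ α₂ X A k y := by
  have hn' : (0 : ℝ) < n := Nat.cast_pos.2 hn
  have hR := rss_nonneg (X := X) k (WithLp.toLp 2 y)
  have hH0 : 0 < H := by rw [hH]; positivity
  have hg := gaussianMoment_pos r ha₁
  have hcommon := commonFactor_pos n hα₁ hα₂
  have hlower := lowerConst_pos r ha₁ hb (pos_of_mul_pos_left (hH0.trans_le hHh) hn'.le)
  have : 0 < Real.Gamma (1 / 2) := Real.Gamma_pos_of_pos one_half_pos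
  have : 0 < Real.Gamma α₁ := Real.Gamma_pos_of_pos hα₁
  have hmarg := le_marginal_of_le_condMarginal (A := A) hn hα₁ hα₂ (by positivity) (by positivity)
    (by positivity) fun τ hτ s hs ↦ le_condMarginal hn ha₁ ha₂ hA hε hX (by positivity) hbox hτ hs
  refine (ENNReal.ofReal_le_ofReal ?_).trans hmarg
  rw [← hH]
  set w := Real.exp (-(1 / 2)) / (4 * Real.Gamma (1 / 2))
  set F := (gaussianMoment r a₁)⁻¹ * (2 * n : ℝ) ^ (-(r + 1 / 2 : ℝ)) * (b / 2) ^ (2 * r) *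
    (2 * √(ε / n))
  calc _ ≤ commonFactor n α₁ α₂ * w * (F * ((n / 2 + α₁) / H) ^ (r + 1 / 2 : ℝ)) ^ k.card *
        H ^ (-((n : ℝ) / 2 + α₁)) := by
        gcongr
        exact lower_factor_le hn ha₁ hε hb.le (by linarith) hH0 hHh
    _ = (2 * Real.pi) ^ (-((n : ℝ) / 2)) * F ^ k.card * w * (α₂ ^ α₁ / Real.Gamma α₁ *
          ((((n / 2 + α₁) / H) ^ (r + 1 / 2 : ℝ)) ^ k.card * Real.Gamma (n / 2 + α₁) *
            H ^ (-((n : ℝ) / 2 + α₁)))) := by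
        rw [commonFactor, mul_pow]
        ring
    _ ≤ _ := by
        rw [add_right_comm]
        gcongr _ * (_ * ?_)
        exact rpow_mul_Gamma_mul_rpow_le hr (by positivity) hH0 _

end

/-! ### Comparison with the true model -/

section

variable {n p : ℕ} {X : Matrix (Fin n) (Fin p) ℝ} {k : Finset (Fin p)}

theorem DesignBound.abs_leastSquares_sub_le {ε g : ℝ} (hX : DesignBound X ε k) (hε : 0 < n * ε)
    {x : Fin p → ℝ} (hx : ∀ j ∉ k, x j = 0) {e : Fin n → ℝ}
    (he : ‖(colSpace X k).starProjection (WithLp.toLp 2 e)‖ ^ 2 ≤ g) (i : k) :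
    |leastSquares X k (X *ᵥ x + e) i - x i| ≤ √(g / (n * ε)) := by
  have hfit : WithLp.toLp 2 (designSub X k *ᵥ (leastSquares X k (X *ᵥ x + e) - fun i : k ↦ x i)) =
      (colSpace X k).starProjection (WithLp.toLp 2 e) := by
    rw [Matrix.mulVec_sub, WithLp.toLp_sub, toLp_designSub_mulVec_leastSquares,
      designSub_mulVec_restrict hx, WithLp.toLp_add, map_add,
      (colSpace X k).starProjection_eq_self_iff.2 (toLp_mulVec_mem_colSpace hx),
      add_sub_cancel_left]
  refine Real.abs_le_sqrt ((hX.sq_apply_le hε (leastSquares X k (X *ᵥ x + e) - fun i : k ↦ x i)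
    i).trans ?_)
  rw [hfit]
  gcongr

theorem half_le_abs_of_abs_sub_le {b x z : ℝ} (h : |z - x| ≤ b / 2) (hx : b ≤ |x|) :
    b / 2 ≤ |z| := by
  linarith [abs_sub_abs_le_abs_sub x z, abs_sub_comm x z]

theorem mul_self_le_of_abs_sub_le {b x z : ℝ} (h : |z - x| ≤ b / 2) (hx : b ≤ |x|) :
    z * z ≤ 9 / 4 * (x * x) := by
  have habs : |z| ≤ 3 / 2 * |x| := by linarith [abs_sub_abs_le_abs_sub z x]
  nlinarith [mul_self_le_mul_self (abs_nonneg z) habs, abs_mul_abs_self x, abs_mul_abs_self z]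

theorem dotProduct_restrict_le (k : Finset (Fin p)) (x : Fin p → ℝ) :
    (fun i : k ↦ x i) ⬝ᵥ (fun i : k ↦ x i) ≤ x ⬝ᵥ x := by
  simp only [dotProduct]
  rw [Finset.sum_coe_sort k fun i ↦ x i * x i]
  exact Finset.sum_le_sum_of_subset_of_nonneg k.subset_univ fun i _ _ ↦ mul_self_nonneg _

theorem bounds_of_mem_closedBall_leastSquares {ε g b B : ℝ} (hX : DesignBound X ε k)
    (hε : 0 < n * ε) {x : Fin p → ℝ} (hx : ∀ j ∉ k, x j = 0) (hb : 0 ≤ b)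
    (hxb : ∀ j ∈ k, b ≤ |x j|) (hB : x ⬝ᵥ x ≤ B) {e : Fin n → ℝ}
    (he : ‖(colSpace X k).starProjection (WithLp.toLp 2 e)‖ ^ 2 ≤ g) {ρ : ℝ}
    (hρ : √(g / (n * ε)) + ρ ≤ b / 2) (r : ℕ) {β : k → ℝ}
    (hβ : β ∈ Metric.closedBall (leastSquares X k (X *ᵥ x + e)) ρ) :
    (∀ i, (b / 2) ^ (2 * r) ≤ β i ^ (2 * r)) ∧ β ⬝ᵥ β ≤ 9 / 4 * B := by
  have hclose (i : k) : |β i - x i| ≤ b / 2 :=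
    calc |β i - x i| ≤ |β i - leastSquares X k (X *ᵥ x + e) i| +
          |leastSquares X k (X *ᵥ x + e) i - x i| := abs_sub_le _ _ _
      _ ≤ ρ + √(g / (n * ε)) :=
        add_le_add ((dist_le_pi_dist β _ i).trans hβ) (hX.abs_leastSquares_sub_le hε hx he i)
      _ ≤ b / 2 := by rwa [add_comm]
  refine ⟨fun i ↦ ?_, ?_⟩
  · rw [← (even_two_mul r).pow_abs (β i)]
    exact pow_le_pow_left₀ (by positivity) (half_le_abs_of_abs_sub_le (hclose i) (hxb i i.2)) _
  · calc β ⬝ᵥ β ≤ ∑ i : k, 9 / 4 * (x i * x i) :=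
          Finset.sum_le_sum fun i _ ↦ mul_self_le_of_abs_sub_le (hclose i) (hxb i i.2)
      _ = 9 / 4 * ((fun i : k ↦ x i) ⬝ᵥ (fun i : k ↦ x i)) := (Finset.mul_sum ..).symm
      _ ≤ 9 / 4 * B := by gcongr; exact (dotProduct_restrict_le k x).trans hB

end

theorem div_rpow_le_exp {a b s : ℝ} (ha : 0 ≤ a) (hb : 0 < b) (hs : 0 ≤ s) :
    (a / b) ^ s ≤ Real.exp (s / b * (a - b)) := by
  have hbase : a / b ≤ Real.exp ((a - b) / b) := by
    simpa [sub_div, div_self hb.ne'] using Real.add_one_le_exp ((a - b) / b)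
  calc (a / b) ^ s ≤ Real.exp ((a - b) / b) ^ s := Real.rpow_le_rpow (by positivity) hbase hs
    _ = Real.exp (s / b * (a - b)) := by rw [← Real.exp_mul]; congr 1; ring

/-- The quantities of the theorem that do not vary with the sample size: the order `r` of the pMOM
density, the parameters `α₁`, `α₂` of the prior on the error variance, the bounds `a₁`, `a₂` for the
eigenvalues of the prior matrix, the true error variance `v`, a lower bound `b` for the absolute
values of the nonzero regression coefficients and an upper bound `B` for the sum of their squares,
and the size `T` of the true model. The number `κ` fixes how far `‖e‖² / (n v)` may fall below `1`
for a typical error vector `e`. -/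
structure Setting where
  (r T : ℕ)
  (α₁ α₂ a₁ a₂ v b B κ : ℝ)
  r_ne_zero : r ≠ 0
  α₁_pos : 0 < α₁
  α₂_pos : 0 < α₂
  a₁_pos : 0 < a₁
  a₂_pos : 0 < a₂
  v_pos : 0 < v
  b_pos : 0 < b
  B_nonneg : 0 ≤ B
  κ_pos : 0 < κ
  κ_lt_half : κ < 1 / 2

namespace Setting

variable (S : Setting)

/-- `‖y‖² ≤ n ε⁻¹ S.sizeConst` for a typical vector `y` of responses. -/
def sizeConst : ℝ := 1 + 2 * S.B + 8 * S.v

/-- The coefficients occurring in the lower bound for the marginal density of the true model have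
squared norm at most `9/4 * S.B`; the scale in that bound exceeds half the residual sum of squares
by `S.lowerShift`. -/
def lowerShift : ℝ := (S.T + S.a₂ * (9 / 4 * S.B)) / 2 + S.α₂

/-- The scale of the inverse-gamma integral that bounds the marginal density of the true model from
below. -/
def lowerScale {n p : ℕ} (X : Matrix (Fin n) (Fin p) ℝ) (t : Finset (Fin p)) (y : Fin n → ℝ) : ℝ :=
  rss X t (WithLp.toLp 2 y) / 2 + S.lowerShift

/-- The scale of the inverse-gamma integral that bounds the marginal density of the model `k` from
above. -/
def upperScale {n p : ℕ} (X : Matrix (Fin n) (Fin p) ℝ) (k : Finset (Fin p)) (y : Fin n → ℝ) : ℝ :=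
  rss X k (WithLp.toLp 2 y) / 2 + S.α₂ - S.r * k.card

/-- The shape of the inverse-gamma integrals that bound the marginal densities. -/
def shape (n : ℕ) : ℝ := n / 2 + S.α₁

/-- The difference of `lowerScale` and `upperScale` exceeds half the difference of the residual sums
of squares by at most `S.scaleGap` for each variable of the model, and one more. -/
def scaleGap : ℝ := (S.T + S.a₂ * (9 / 4 * S.B)) / 2 + S.r

/-- An upper bound for `S.shape n / S.upperScale X k y`. -/
def rate : ℝ := 1 / ((1 - 2 * S.κ) * S.v)

/-- The constant of `lowerConst` for the true model. -/
def trueConst : ℝ := lowerConst S.r S.a₁ S.b (2 * S.v + S.lowerShift)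

/-- The constant factor of `ratioWeight`. -/
def weightConst : ℝ :=
  √2 / (Real.exp (-(1 / 2)) / (4 * Real.Gamma (1 / 2))) * Real.exp (S.rate * S.scaleGap) *
    S.trueConst⁻¹ ^ S.T

/-- The constant that each variable of the model contributes to `ratioWeight`. -/
def weightBase : ℝ :=
  upperConst S.r S.a₂ * S.sizeConst ^ S.r * Real.exp (S.rate * S.scaleGap)

/-- The part that depends only on the number `K` of variables in the bound for the ratio of the
marginal density of a model to that of the true model. -/
def ratioWeight (n : ℕ) (ε : ℝ) (K : ℕ) : ℝ :=
  S.weightConst * (n ^ (S.r + 1) * ε⁻¹) ^ S.T *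
    (S.weightBase * (K : ℝ) ^ (S.r + 1 / 2 : ℝ) * ε⁻¹ ^ (2 * S.r + 1) / n ^ (S.r + 1)) ^ K

/-- The exponential rate at which the marginal density of a model that misses a true variable
decays, relative to that of the true model. -/
def missRate : ℝ := S.b ^ 2 / (16 * (S.sizeConst / 2 + S.α₂))

/-- The number of observations per degree of freedom beyond which the bounds on
ratios of marginal densities hold. -/
def load : ℝ :=
  1 + 16 / S.b ^ 2 + 16 * S.v / S.b ^ 2 + 8 * S.scaleGap / S.b ^ 2 +
    (2 * S.α₁ * S.v + S.v + 2 * S.r) / (S.κ * S.v)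

theorem rate_pos : 0 < S.rate :=
  one_div_pos.2 (mul_pos (by linarith [S.κ_lt_half]) S.v_pos)

theorem one_le_sizeConst : 1 ≤ S.sizeConst := by
  rw [sizeConst]
  linarith [S.B_nonneg, S.v_pos]

theorem lowerShift_pos : 0 < S.lowerShift := by
  have := S.a₂_pos
  have := S.B_nonneg
  have := S.α₂_pos
  rw [lowerShift]
  positivity

theorem scaleGap_nonneg : 0 ≤ S.scaleGap := by
  have := S.a₂_pos
  have := S.B_nonneg
  rw [scaleGap]
  positivity

theorem shape_pos (n : ℕ) : 0 < S.shape n :=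
  add_pos_of_nonneg_of_pos (by positivity) S.α₁_pos

theorem trueConst_pos : 0 < S.trueConst :=
  lowerConst_pos S.r S.a₁_pos S.b_pos (add_pos (mul_pos two_pos S.v_pos) S.lowerShift_pos)

theorem weightConst_pos : 0 < S.weightConst := by
  have := S.trueConst_pos
  have : 0 < Real.Gamma (1 / 2) := Real.Gamma_pos_of_pos one_half_pos
  rw [weightConst]
  positivity

theorem weightBase_pos : 0 < S.weightBase := by
  have := upperConst_pos S.r S.a₂_pos
  have := zero_lt_one.trans_le S.one_le_sizeConst
  rw [weightBase]
  positivity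

theorem ratioWeight_nonneg (n : ℕ) {ε : ℝ} (hε : 0 ≤ ε) (K : ℕ) : 0 ≤ S.ratioWeight n ε K := by
  have := S.weightConst_pos
  have := S.weightBase_pos
  rw [ratioWeight]
  positivity

theorem missRate_pos : 0 < S.missRate := by
  have := S.b_pos
  have := S.α₂_pos
  have := zero_lt_one.trans_le S.one_le_sizeConst
  rw [missRate]
  positivity

theorem lowerScale_pos {n p : ℕ} (X : Matrix (Fin n) (Fin p) ℝ) (t : Finset (Fin p))
    (y : Fin n → ℝ) : 0 < S.lowerScale X t y :=
  add_pos_of_nonneg_of_pos (div_nonneg (rss_nonneg _ _) zero_le_two) S.lowerShift_pos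

theorem lowerScale_sub_upperScale_le {n p : ℕ} (X : Matrix (Fin n) (Fin p) ℝ)
    (t k : Finset (Fin p)) (y : Fin n → ℝ) :
    S.lowerScale X t y - S.upperScale X k y ≤
      (rss X t (WithLp.toLp 2 y) - rss X k (WithLp.toLp 2 y)) / 2 +
        S.scaleGap * (1 + k.card) := by
  have hgap : (0 : ℝ) ≤ (S.scaleGap - S.r) * k.card := by
    have := S.a₂_pos
    have := S.B_nonneg
    rw [scaleGap, add_sub_cancel_right]
    positivity
  have : (0 : ℝ) ≤ S.r := Nat.cast_nonneg _
  have hshift : S.lowerShift = S.scaleGap - S.r + S.α₂ := by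
    rw [lowerShift, scaleGap, add_sub_cancel_right]
  rw [lowerScale, upperScale, hshift]
  linarith

/-- What the bounds for the marginal densities require of the design `X`, the prior matrix `A`, the
true model `t` and the vector `x` of regression coefficients; `q` bounds the size of the models and
`h` is the bound used in `IsTypical`. -/
structure IsRegular {n p : ℕ} (X : Matrix (Fin n) (Fin p) ℝ) (A : Matrix (Fin p) (Fin p) ℝ)
    (ε h : ℝ) (q : ℕ) (t : Finset (Fin p)) (x : Fin p → ℝ) : Prop where
  loewnerBound : LoewnerBound A S.a₁ S.a₂
  ε_pos : 0 < ε
  ε_lt_one : ε < 1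
  card_eq : t.card = S.T
  T_le : S.T ≤ q
  designBound : ∀ k : Finset (Fin p), k.card ≤ q + S.T → DesignBound X ε k
  eq_zero : ∀ j ∉ t, x j = 0
  le_abs : ∀ j ∈ t, S.b ≤ |x j|
  dotProduct_le : x ⬝ᵥ x ≤ S.B
  h_nonneg : 0 ≤ h
  load_mul_le : S.load * (h + q + 1) ≤ n * ε

/-- Error vectors of about the expected length whose projections to the column spaces of small
models are short. -/
structure IsTypical {n p : ℕ} (X : Matrix (Fin n) (Fin p) ℝ) (h : ℝ) (q : ℕ)
    (t : Finset (Fin p)) (e : Fin n → ℝ) : Prop where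
  norm_sq_le : ‖WithLp.toLp 2 e‖ ^ 2 ≤ 4 * n * S.v
  le_norm_sq : (1 - S.κ) * n * S.v ≤ ‖WithLp.toLp 2 e‖ ^ 2
  norm_sq_starProjection_le : ∀ k : Finset (Fin p), k.card ≤ q →
    ‖(colSpace X (k ∪ t)).starProjection (WithLp.toLp 2 e)‖ ^ 2 ≤ S.v * h

theorem le_load : 1 ≤ S.load ∧ 16 / S.b ^ 2 ≤ S.load ∧ 16 * S.v / S.b ^ 2 ≤ S.load ∧
    8 * S.scaleGap / S.b ^ 2 ≤ S.load ∧
    (2 * S.α₁ * S.v + S.v + 2 * S.r) / (S.κ * S.v) ≤ S.load := by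
  have := S.b_pos
  have := S.v_pos
  have := S.κ_pos
  have := S.α₁_pos
  have hb : 0 ≤ 16 / S.b ^ 2 := by positivity
  have hv : 0 ≤ 16 * S.v / S.b ^ 2 := by positivity
  have hgap : 0 ≤ 8 * S.scaleGap / S.b ^ 2 :=
    div_nonneg (mul_nonneg (by norm_num) S.scaleGap_nonneg) (by positivity)
  have hκ : 0 ≤ (2 * S.α₁ * S.v + S.v + 2 * S.r) / (S.κ * S.v) := by positivity
  rw [load]
  refine ⟨?_, ?_, ?_, ?_, ?_⟩ <;> linarith

section

variable {S} {n p q : ℕ} {X : Matrix (Fin n) (Fin p) ℝ} {A : Matrix (Fin p) (Fin p) ℝ}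
  {ε h : ℝ} {k t : Finset (Fin p)} {x : Fin p → ℝ} {e : Fin n → ℝ}

namespace IsRegular

variable (hS : S.IsRegular X A ε h q t x)
include hS

theorem mul_le {c z : ℝ} (hc : c ≤ S.load) (hz : 0 ≤ z) (hzh : z ≤ h + q + 1) : c * z ≤ n * ε :=
  (mul_le_mul hc hzh hz (zero_le_one.trans S.le_load.1)).trans hS.load_mul_le

theorem one_le_h_add : 1 ≤ h + q + 1 := by
  have := hS.h_nonneg
  have : (0 : ℝ) ≤ q := Nat.cast_nonneg _
  linarith

theorem one_le_mul : 1 ≤ n * ε := by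
  simpa using hS.mul_le S.le_load.1 zero_le_one hS.one_le_h_add

theorem one_le_n : (1 : ℝ) ≤ n :=
  hS.one_le_mul.trans (mul_le_of_le_one_right n.cast_nonneg hS.ε_lt_one.le)

theorem n_pos : 0 < n := Nat.cast_pos.1 (zero_lt_one.trans_le hS.one_le_n)

theorem one_le_ε_inv : 1 ≤ ε⁻¹ := (one_le_inv₀ hS.ε_pos).2 hS.ε_lt_one.le

theorem card_union_le (hk : k.card ≤ q) : (k ∪ t).card ≤ q + S.T :=
  (Finset.card_union_le _ _).trans (add_le_add hk hS.card_eq.le)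

theorem designBound_of_card_le (hk : k.card ≤ q) : DesignBound X ε k :=
  hS.designBound k (hk.trans (Nat.le_add_right _ _))

theorem card_le : t.card ≤ q := hS.card_eq.trans_le hS.T_le

theorem norm_sq_response_le (he : S.IsTypical X h q t e) :
    ‖WithLp.toLp 2 (X *ᵥ x + e)‖ ^ 2 ≤ n * ε⁻¹ * S.sizeConst := by
  have hn : (0 : ℝ) ≤ n * ε⁻¹ := mul_nonneg n.cast_nonneg (inv_nonneg.2 hS.ε_pos.le)
  have hmean : ‖WithLp.toLp 2 (X *ᵥ x)‖ ^ 2 ≤ n * ε⁻¹ * S.B := by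
    have hfit := (hS.designBound_of_card_le hS.card_le fun i : t ↦ x i).2
    rw [designSub_mulVec_restrict hS.eq_zero, dotProduct_self_eq_norm_sq (X *ᵥ x)] at hfit
    refine hfit.trans ?_
    gcongr
    exact (dotProduct_restrict_le t x).trans hS.dotProduct_le
  have herror : ‖WithLp.toLp 2 e‖ ^ 2 ≤ n * ε⁻¹ * (4 * S.v) := by
    have := le_mul_of_one_le_right (mul_nonneg n.cast_nonneg S.v_pos.le) hS.one_le_ε_inv
    linarith [he.norm_sq_le]
  calc ‖WithLp.toLp 2 (X *ᵥ x + e)‖ ^ 2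
      ≤ (‖WithLp.toLp 2 (X *ᵥ x)‖ + ‖WithLp.toLp 2 e‖) ^ 2 := by
        rw [WithLp.toLp_add]
        gcongr
        exact norm_add_le _ _
    _ ≤ 2 * (n * ε⁻¹ * S.B + n * ε⁻¹ * (4 * S.v)) := add_sq_le.trans (by gcongr)
    _ ≤ n * ε⁻¹ * S.sizeConst := by rw [sizeConst]; linarith

theorem le_rss (he : S.IsTypical X h q t e) (hk : k.card ≤ q) :
    (1 - S.κ) * n * S.v - S.v * h ≤ rss X k (WithLp.toLp 2 (X *ᵥ x + e)) := by
  have hmem : WithLp.toLp 2 (X *ᵥ x) ∈ colSpace X (k ∪ t) :=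
    colSpace_mono Finset.subset_union_right (toLp_mulVec_mem_colSpace hS.eq_zero)
  have hsplit := norm_sq_eq_add_rss (X := X) (k ∪ t) (WithLp.toLp 2 e)
  have hproj := he.norm_sq_starProjection_le k hk
  calc (1 - S.κ) * n * S.v - S.v * h
      ≤ rss X (k ∪ t) (WithLp.toLp 2 e) := by linarith [he.le_norm_sq]
    _ = rss X (k ∪ t) (WithLp.toLp 2 (X *ᵥ x + e)) := by
      rw [WithLp.toLp_add, rss_add_of_mem hmem]
    _ ≤ rss X k (WithLp.toLp 2 (X *ᵥ x + e)) := rss_anti Finset.subset_union_left _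

theorem shape_le_rate_mul_upperScale (he : S.IsTypical X h q t e) (hk : k.card ≤ q) :
    S.shape n ≤ S.rate * S.upperScale X k (X *ᵥ x + e) := by
  have := S.v_pos
  have := S.α₁_pos
  have hq : (k.card : ℝ) ≤ q := Nat.cast_le.2 hk
  have hload : (2 * S.α₁ * S.v + S.v + 2 * S.r) * (h + q + 1) ≤ S.κ * S.v * n := by
    have hpos : 0 < S.κ * S.v := mul_pos S.κ_pos S.v_pos
    have := hS.mul_le S.le_load.2.2.2.2 (zero_le_one.trans hS.one_le_h_add) le_rfl
    rw [div_mul_eq_mul_div, div_le_iff₀' hpos] at this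
    exact this.trans (by gcongr; exact mul_le_of_le_one_right n.cast_nonneg hS.ε_lt_one.le)
  have hpieces : 2 * S.α₁ * S.v + S.v * h + 2 * (S.r * k.card) ≤
      (2 * S.α₁ * S.v + S.v + 2 * S.r) * (h + q + 1) := by
    calc 2 * S.α₁ * S.v + S.v * h + 2 * (S.r * k.card)
        = 2 * S.α₁ * S.v * 1 + S.v * h + 2 * S.r * k.card := by ring
      _ ≤ 2 * S.α₁ * S.v * (h + q + 1) + S.v * (h + q + 1) + 2 * S.r * (h + q + 1) := by
          gcongr <;> linarith [hS.h_nonneg, hS.one_le_h_add, Nat.cast_nonneg (α := ℝ) q]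
      _ = _ := by ring
  have hpos : 0 < (1 - 2 * S.κ) * S.v := mul_pos (by linarith [S.κ_lt_half]) S.v_pos
  rw [rate, div_mul_eq_mul_div, one_mul, le_div_iff₀ hpos, upperScale, shape]
  have := mul_pos (mul_pos S.κ_pos S.α₁_pos) S.v_pos
  linarith [hS.le_rss he hk, S.α₂_pos]

theorem upperScale_pos (he : S.IsTypical X h q t e) (hk : k.card ≤ q) :
    0 < S.upperScale X k (X *ᵥ x + e) :=
  pos_of_mul_pos_right ((S.shape_pos n).trans_le (hS.shape_le_rate_mul_upperScale he hk))
    S.rate_pos.le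

theorem shape_div_upperScale_le (he : S.IsTypical X h q t e) (hk : k.card ≤ q) :
    S.shape n / S.upperScale X k (X *ᵥ x + e) ≤ S.rate :=
  (div_le_iff₀ (hS.upperScale_pos he hk)).2 (hS.shape_le_rate_mul_upperScale he hk)

end IsRegular

end

end Setting

namespace Setting

variable (S : Setting)

/-- The lower bound for the marginal density of the true model. -/
def lowerBound {n p : ℕ} (X : Matrix (Fin n) (Fin p) ℝ) (ε : ℝ) (t : Finset (Fin p))
    (y : Fin n → ℝ) : ℝ :=
  commonFactor n S.α₁ S.α₂ * (Real.exp (-(1 / 2)) / (4 * Real.Gamma (1 / 2))) *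
    (S.trueConst * √ε / n ^ (S.r + 1)) ^ S.T * S.lowerScale X t y ^ (-S.shape n)

/-- The upper bound for the marginal density of the model `k`. -/
def upperBound {n p : ℕ} (X : Matrix (Fin n) (Fin p) ℝ) (ε : ℝ) (k : Finset (Fin p))
    (y : Fin n → ℝ) : ℝ :=
  commonFactor n S.α₁ S.α₂ * √2 *
    (upperConst S.r S.a₂ * S.sizeConst ^ S.r * (k.card : ℝ) ^ (S.r + 1 / 2 : ℝ) *
      ε⁻¹ ^ (2 * S.r + 1) / n ^ (S.r + 1)) ^ k.card *
    S.upperScale X k y ^ (-S.shape n)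

section

variable {S} {n p q : ℕ} {X : Matrix (Fin n) (Fin p) ℝ} {A : Matrix (Fin p) (Fin p) ℝ}
  {ε h : ℝ} {k t : Finset (Fin p)} {x : Fin p → ℝ} {e : Fin n → ℝ}

theorem lowerBound_pos (hn : 0 < n) (hε : 0 < ε) (t : Finset (Fin p)) (y : Fin n → ℝ) :
    0 < S.lowerBound X ε t y := by
  have := commonFactor_pos n S.α₁_pos S.α₂_pos
  have : 0 < Real.Gamma (1 / 2) := Real.Gamma_pos_of_pos one_half_pos
  have := S.trueConst_pos
  have := S.lowerScale_pos X t y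
  rw [lowerBound]
  positivity

theorem ratioWeight_mul_lowerBound (hn : 0 < n) (hε : 0 < ε) (t : Finset (Fin p)) (y : Fin n → ℝ)
    (K : ℕ) (F : ℝ) :
    S.ratioWeight n ε K * F * S.lowerBound X ε t y =
      commonFactor n S.α₁ S.α₂ * √2 *
        (upperConst S.r S.a₂ * S.sizeConst ^ S.r * (K : ℝ) ^ (S.r + 1 / 2 : ℝ) *
          ε⁻¹ ^ (2 * S.r + 1) / n ^ (S.r + 1)) ^ K *
        (Real.exp (S.rate * S.scaleGap * (1 + K)) * F * S.lowerScale X t y ^ (-S.shape n)) *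
        (ε⁻¹ * √ε) ^ S.T := by
  have hw : Real.exp (-(1 / 2)) / (4 * Real.Gamma (1 / 2)) ≠ 0 :=
    (div_pos (Real.exp_pos _) (mul_pos four_pos (Real.Gamma_pos_of_pos one_half_pos))).ne'
  have hcancel : S.trueConst⁻¹ ^ S.T * (n ^ (S.r + 1) * ε⁻¹) ^ S.T *
      (S.trueConst * √ε / n ^ (S.r + 1)) ^ S.T = (ε⁻¹ * √ε) ^ S.T := by
    have := S.trueConst_pos
    rw [← mul_pow, ← mul_pow]
    field_simp
  rw [mul_one_add, Real.exp_add, mul_comm _ (K : ℝ), Real.exp_nat_mul, ← hcancel, ratioWeight,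
    weightConst, weightBase, lowerBound]
  generalize Real.exp (-(1 / 2)) / (4 * Real.Gamma (1 / 2)) = w at hw
  generalize Real.exp (S.rate * S.scaleGap) = E
  rw [show upperConst S.r S.a₂ * S.sizeConst ^ S.r * E * (K : ℝ) ^ (S.r + 1 / 2 : ℝ) *
    ε⁻¹ ^ (2 * S.r + 1) / n ^ (S.r + 1) = E * (upperConst S.r S.a₂ * S.sizeConst ^ S.r *
      (K : ℝ) ^ (S.r + 1 / 2 : ℝ) * ε⁻¹ ^ (2 * S.r + 1) / n ^ (S.r + 1)) by ring, mul_pow E]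
  field_simp

theorem upperBound_le (hn : 0 < n) (hε : 0 < ε) (hε1 : ε ≤ 1) {y : Fin n → ℝ}
    (hk : 0 < S.upperScale X k y) {F : ℝ} (hF0 : 0 ≤ F)
    (hF : (S.lowerScale X t y / S.upperScale X k y) ^ S.shape n ≤
      Real.exp (S.rate * S.scaleGap * (1 + k.card)) * F) :
    S.upperBound X ε k y ≤ S.ratioWeight n ε k.card * F * S.lowerBound X ε t y := by
  have hL := S.lowerScale_pos X t y
  have := commonFactor_pos n S.α₁_pos S.α₂_pos
  have := upperConst_pos S.r S.a₂_pos
  have := zero_lt_one.trans_le S.one_le_sizeConst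
  have hscale : S.upperScale X k y ^ (-S.shape n) ≤
      Real.exp (S.rate * S.scaleGap * (1 + k.card)) * F * S.lowerScale X t y ^ (-S.shape n) := by
    rw [Real.rpow_neg hL.le, Real.rpow_neg hk.le, ← div_eq_mul_inv,
      le_div_iff₀ (Real.rpow_pos_of_pos hL _), inv_mul_eq_div, ← Real.div_rpow hL.le hk.le]
    exact hF
  have hT : 1 ≤ (ε⁻¹ * √ε) ^ S.T := by
    refine one_le_pow₀ ?_
    rw [inv_mul_eq_div, one_le_div hε]
    exact Real.le_sqrt_of_sq_le (pow_le_of_le_one hε.le hε1 two_ne_zero)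
  rw [ratioWeight_mul_lowerBound hn hε, upperBound]
  exact (mul_le_mul_of_nonneg_left hscale (by positivity)).trans
    (le_mul_of_one_le_right (by positivity) hT)

namespace IsRegular

variable (hS : S.IsRegular X A ε h q t x)
include hS

theorem v_mul_h_le : S.v * h ≤ (S.b / 4) ^ 2 * (n * ε) := by
  have := S.b_pos
  have := hS.mul_le S.le_load.2.2.1 hS.h_nonneg
    (by linarith [Nat.cast_nonneg (α := ℝ) q] : h ≤ h + q + 1)
  calc S.v * h = (S.b / 4) ^ 2 * (16 * S.v / S.b ^ 2 * h) := by field_simp; ring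
    _ ≤ (S.b / 4) ^ 2 * (n * ε) := by gcongr

theorem sqrt_add_sqrt_le : √(S.v * h / (n * ε)) + √(ε / n) ≤ S.b / 2 := by
  have hb := S.b_pos
  have hn : (0 : ℝ) < n := Nat.cast_pos.2 hS.n_pos
  have hnε := zero_lt_one.trans_le hS.one_le_mul
  have hleft : √(S.v * h / (n * ε)) ≤ S.b / 4 :=
    Real.sqrt_le_iff.2 ⟨by positivity, (div_le_iff₀ hnε).2 hS.v_mul_h_le⟩
  have hright : √(ε / n) ≤ S.b / 4 := by
    refine Real.sqrt_le_iff.2 ⟨by positivity, (div_le_iff₀ hn).2 ?_⟩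
    have hload := hS.mul_le S.le_load.2.1 zero_le_one hS.one_le_h_add
    calc ε ≤ (S.b / 4) ^ 2 * (16 / S.b ^ 2 * 1) := by
          field_simp
          linarith [hS.ε_lt_one]
      _ ≤ (S.b / 4) ^ 2 * n := by
          gcongr
          exact hload.trans (mul_le_of_le_one_right hn.le hS.ε_lt_one.le)
  linarith

theorem lowerScale_le (he : S.IsTypical X h q t e) :
    S.lowerScale X t (X *ᵥ x + e) ≤ (2 * S.v + S.lowerShift) * n := by
  have hrss : rss X t (WithLp.toLp 2 (X *ᵥ x + e)) ≤ ‖WithLp.toLp 2 e‖ ^ 2 := by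
    rw [WithLp.toLp_add, rss_add_of_mem (toLp_mulVec_mem_colSpace hS.eq_zero)]
    exact rss_le_norm_sq _ _
  have hshift := le_mul_of_one_le_right S.lowerShift_pos.le hS.one_le_n
  rw [lowerScale]
  linarith [he.norm_sq_le]

theorem lowerBound_le_marginal (he : S.IsTypical X h q t e) :
    ENNReal.ofReal (S.lowerBound X ε t (X *ᵥ x + e)) ≤
      marginal S.r S.α₁ S.α₂ X A t (X *ᵥ x + e) := by
  have hX := hS.designBound_of_card_le hS.card_le
  have hproj := he.norm_sq_starProjection_le ∅ (Nat.zero_le q)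
  rw [Finset.empty_union] at hproj
  have hscale : S.lowerScale X t (X *ᵥ x + e) =
      (rss X t (WithLp.toLp 2 (X *ᵥ x + e)) + t.card + S.a₂ * (9 / 4 * S.B)) / 2 + S.α₂ := by
    rw [lowerScale, lowerShift, hS.card_eq]
    ring
  have := le_marginal S.r_ne_zero hS.n_pos S.α₁_pos S.α₂_pos S.a₁_pos S.a₂_pos
    (hS.loewnerBound.submatrix Subtype.val_injective) hS.ε_pos hX S.b_pos
    (mul_nonneg (by norm_num) S.B_nonneg)
    (fun β hβ ↦ bounds_of_mem_closedBall_leastSquares hX (zero_lt_one.trans_le hS.one_le_mul)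
      hS.eq_zero S.b_pos.le hS.le_abs hS.dotProduct_le hproj hS.sqrt_add_sqrt_le S.r hβ)
    hscale (hS.lowerScale_le he)
  rwa [hS.card_eq] at this

theorem marginal_le_upperBound (he : S.IsTypical X h q t e) (hk : k.card ≤ q) :
    marginal S.r S.α₁ S.α₂ X A k (X *ᵥ x + e) ≤
      ENNReal.ofReal (S.upperBound X ε k (X *ᵥ x + e)) :=
  marginal_le S.r_ne_zero S.α₁_pos S.α₂_pos S.a₁_pos S.a₂_pos
    (hS.loewnerBound.submatrix Subtype.val_injective) (hS.designBound_of_card_le hk) hS.ε_pos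
    hS.ε_lt_one.le hS.one_le_mul S.one_le_sizeConst (hS.norm_sq_response_le he)
    (hS.upperScale_pos he hk)

theorem marginal_true_pos (he : S.IsTypical X h q t e) :
    0 < marginal S.r S.α₁ S.α₂ X A t (X *ᵥ x + e) :=
  (ENNReal.ofReal_pos.2 (lowerBound_pos hS.n_pos hS.ε_pos t _)).trans_le
    (hS.lowerBound_le_marginal he)

theorem marginal_true_ne_top (he : S.IsTypical X h q t e) :
    marginal S.r S.α₁ S.α₂ X A t (X *ᵥ x + e) ≠ ∞ :=
  ((hS.marginal_le_upperBound he hS.card_le).trans_lt ENNReal.ofReal_lt_top).ne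

theorem marginal_le_mul_exp (he : S.IsTypical X h q t e) (hk : k.card ≤ q) {z : ℝ}
    (hz : S.shape n / S.upperScale X k (X *ᵥ x + e) *
      (S.lowerScale X t (X *ᵥ x + e) - S.upperScale X k (X *ᵥ x + e)) ≤
        S.rate * S.scaleGap * (1 + k.card) + z) :
    marginal S.r S.α₁ S.α₂ X A k (X *ᵥ x + e) ≤
      ENNReal.ofReal (S.ratioWeight n ε k.card * Real.exp z) *
        marginal S.r S.α₁ S.α₂ X A t (X *ᵥ x + e) := by
  have hupper := hS.upperScale_pos he hk
  have hF : (S.lowerScale X t (X *ᵥ x + e) / S.upperScale X k (X *ᵥ x + e)) ^ S.shape n ≤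
      Real.exp (S.rate * S.scaleGap * (1 + k.card)) * Real.exp z := by
    rw [← Real.exp_add]
    exact (div_rpow_le_exp (S.lowerScale_pos X t _).le hupper (S.shape_pos n).le).trans
      (Real.exp_le_exp.2 hz)
  refine (hS.marginal_le_upperBound he hk).trans ?_
  refine (ENNReal.ofReal_le_ofReal
    (upperBound_le hS.n_pos hS.ε_pos hS.ε_lt_one.le hupper (Real.exp_pos _).le hF)).trans ?_
  rw [ENNReal.ofReal_mul
    (mul_nonneg (S.ratioWeight_nonneg n hS.ε_pos.le _) (Real.exp_pos _).le)]
  gcongr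
  exact hS.lowerBound_le_marginal he

theorem marginal_le_of_subset (he : S.IsTypical X h q t e) (hk : k.card ≤ q) (htk : t ⊆ k) :
    marginal S.r S.α₁ S.α₂ X A k (X *ᵥ x + e) ≤
      ENNReal.ofReal (S.ratioWeight n ε k.card * Real.exp (S.rate / 2 *
        ‖(extraSpace X t k).starProjection (WithLp.toLp 2 e)‖ ^ 2)) *
        marginal S.r S.α₁ S.α₂ X A t (X *ᵥ x + e) := by
  refine hS.marginal_le_mul_exp he hk ?_
  have hscale := S.lowerScale_sub_upperScale_le X t k (X *ᵥ x + e)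
  rw [WithLp.toLp_add, rss_sub_rss_eq_norm_sq_extraSpace htk
    (toLp_mulVec_mem_colSpace hS.eq_zero)] at hscale
  have hgap := S.scaleGap_nonneg
  calc S.shape n / S.upperScale X k (X *ᵥ x + e) *
        (S.lowerScale X t (X *ᵥ x + e) - S.upperScale X k (X *ᵥ x + e))
      ≤ S.shape n / S.upperScale X k (X *ᵥ x + e) *
        (‖(extraSpace X t k).starProjection (WithLp.toLp 2 e)‖ ^ 2 / 2 +
          S.scaleGap * (1 + k.card)) :=
        mul_le_mul_of_nonneg_left hscale
          (div_nonneg (S.shape_pos n).le (hS.upperScale_pos he hk).le)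
    _ ≤ S.rate * (‖(extraSpace X t k).starProjection (WithLp.toLp 2 e)‖ ^ 2 / 2 +
          S.scaleGap * (1 + k.card)) :=
        mul_le_mul_of_nonneg_right (hS.shape_div_upperScale_le he hk) (by positivity)
    _ = _ := by ring

theorem rss_sub_rss_le_of_not_subset (he : S.IsTypical X h q t e) (hk : k.card ≤ q)
    (htk : ¬ t ⊆ k) :
    rss X t (WithLp.toLp 2 (X *ᵥ x + e)) - rss X k (WithLp.toLp 2 (X *ᵥ x + e)) ≤
      -(S.b ^ 2 / 2 * (n * ε)) := by
  obtain ⟨j, hjt, hjk⟩ := Finset.not_subset.1 htk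
  have := S.b_pos
  have hnε := zero_lt_one.trans_le hS.one_le_mul
  have hsq : √(n * ε) ^ 2 = n * ε := Real.sq_sqrt hnε.le
  have hproj : ‖(colSpace X (k ∪ t)).starProjection (WithLp.toLp 2 e)‖ ≤ S.b / 4 * √(n * ε) := by
    refine le_of_sq_le_sq ?_ (by positivity)
    rw [mul_pow, hsq]
    exact (he.norm_sq_starProjection_le k hk).trans hS.v_mul_h_le
  have hD : (S.b * √(n * ε)) ^ 2 ≤ n * ε * x j ^ 2 := by
    rw [mul_pow, hsq, mul_comm, ← sq_abs (x j)]
    gcongr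
    exact hS.le_abs j hjt
  rw [WithLp.toLp_add]
  refine (rss_sub_rss_le hS.eq_zero hS.ε_pos.le (hS.designBound _ (hS.card_union_le hk)) hjt hjk hD
    (by gcongr; linarith) hproj).trans_eq ?_
  linear_combination (-(S.b ^ 2 / 2)) * hsq

theorem le_shape_div_upperScale (he : S.IsTypical X h q t e) (hk : k.card ≤ q) :
    ε / (2 * (S.sizeConst / 2 + S.α₂)) ≤ S.shape n / S.upperScale X k (X *ᵥ x + e) := by
  have hε := hS.ε_pos
  have hα := S.α₂_pos
  have hsize := zero_lt_one.trans_le S.one_le_sizeConst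
  have hupper : S.upperScale X k (X *ᵥ x + e) ≤ n * ε⁻¹ * (S.sizeConst / 2 + S.α₂) := by
    have hrss := (rss_le_norm_sq (X := X) k _).trans (hS.norm_sq_response_le he)
    have hα' := le_mul_of_one_le_left hα.le
      (one_le_mul_of_one_le_of_one_le hS.one_le_n hS.one_le_ε_inv)
    have : (0 : ℝ) ≤ S.r * k.card := by positivity
    rw [upperScale]
    linarith
  rw [div_le_div_iff₀ (by positivity) (hS.upperScale_pos he hk)]
  calc ε * S.upperScale X k (X *ᵥ x + e) ≤ ε * (n * ε⁻¹ * (S.sizeConst / 2 + S.α₂)) := by gcongr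
    _ = n / 2 * (2 * (S.sizeConst / 2 + S.α₂)) := by field_simp
    _ ≤ S.shape n * (2 * (S.sizeConst / 2 + S.α₂)) := by
      rw [shape]
      gcongr
      linarith [S.α₁_pos]

theorem marginal_le_of_not_subset (he : S.IsTypical X h q t e) (hk : k.card ≤ q)
    (htk : ¬ t ⊆ k) :
    marginal S.r S.α₁ S.α₂ X A k (X *ᵥ x + e) ≤
      ENNReal.ofReal (S.ratioWeight n ε k.card * Real.exp (-(S.missRate * (n * ε ^ 2)))) *
        marginal S.r S.α₁ S.α₂ X A t (X *ᵥ x + e) := by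
  refine hS.marginal_le_mul_exp he hk ?_
  have hb := S.b_pos
  have hα := S.α₂_pos
  have hε := hS.ε_pos
  have hsize := zero_lt_one.trans_le S.one_le_sizeConst
  have hgap : S.scaleGap * (1 + k.card) ≤ S.b ^ 2 / 8 * (n * ε) := by
    have hcard : (k.card : ℝ) ≤ q := Nat.cast_le.2 hk
    have hload := hS.mul_le S.le_load.2.2.2.1 (by positivity : (0 : ℝ) ≤ 1 + k.card)
      (by linarith [hS.h_nonneg])
    calc S.scaleGap * (1 + k.card)
        = S.b ^ 2 / 8 * (8 * S.scaleGap / S.b ^ 2 * (1 + k.card)) := by field_simp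
      _ ≤ S.b ^ 2 / 8 * (n * ε) := by gcongr
  have hscale : S.lowerScale X t (X *ᵥ x + e) - S.upperScale X k (X *ᵥ x + e) ≤
      -(S.b ^ 2 / 8 * (n * ε)) := by
    linarith [S.lowerScale_sub_upperScale_le X t k (X *ᵥ x + e),
      hS.rss_sub_rss_le_of_not_subset he hk htk]
  have hrate : 0 ≤ S.rate * S.scaleGap * (1 + k.card) :=
    mul_nonneg (mul_nonneg S.rate_pos.le S.scaleGap_nonneg) (by positivity)
  calc S.shape n / S.upperScale X k (X *ᵥ x + e) *
        (S.lowerScale X t (X *ᵥ x + e) - S.upperScale X k (X *ᵥ x + e))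
      ≤ S.shape n / S.upperScale X k (X *ᵥ x + e) * -(S.b ^ 2 / 8 * (n * ε)) :=
        mul_le_mul_of_nonneg_left hscale
          (div_nonneg (S.shape_pos n).le (hS.upperScale_pos he hk).le)
    _ ≤ ε / (2 * (S.sizeConst / 2 + S.α₂)) * -(S.b ^ 2 / 8 * (n * ε)) :=
        mul_le_mul_of_nonpos_right (hS.le_shape_div_upperScale he hk)
          (neg_nonpos.2 (by positivity))
    _ = -(S.missRate * (n * ε ^ 2)) := by rw [missRate]; field_simp; ring
    _ ≤ _ := le_add_of_nonneg_left hrate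

end IsRegular

end

end Setting

/-! ### Gaussian vectors -/

theorem mgf_sq_gaussianReal {θ : ℝ} (hθ : 2 * θ < 1) :
    mgf (fun x ↦ x ^ 2) (gaussianReal 0 1) θ = (√(1 - 2 * θ))⁻¹ := by
  have h_density (x : ℝ) : gaussianPDFReal 0 1 x • Real.exp (θ * x ^ 2) =
      (√(2 * Real.pi))⁻¹ * Real.exp (-(1 / 2 - θ) * x ^ 2) := by
    rw [gaussianPDFReal, smul_eq_mul, mul_assoc, ← Real.exp_add, NNReal.coe_one, mul_one]
    congr 2
    ring
  have : 1 - 2 * θ ≠ 0 := by linarith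
  simp_rw [mgf, integral_gaussianReal_eq_integral_smul one_ne_zero, h_density]
  rw [integral_const_mul, integral_gaussian, ← Real.sqrt_inv, ← Real.sqrt_mul (by positivity),
    ← Real.sqrt_inv]
  congr 1
  field_simp

section StdGaussian

variable {V : Type*} [NormedAddCommGroup V] [InnerProductSpace ℝ V] [FiniteDimensional ℝ V]
  [MeasurableSpace V] [BorelSpace V]

theorem stdGaussian_map_orthogonalProjectionOnto (W : Submodule ℝ V) :
    (stdGaussian V).map W.orthogonalProjectionOnto = stdGaussian W := by
  refine Measure.ext_of_charFun (funext fun w ↦ ?_)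
  rw [charFun_apply, integral_map (by fun_prop) (by fun_prop), charFun_stdGaussian,
    ← W.norm_coe w, ← charFun_stdGaussian, charFun_apply]
  simp only [W.inner_orthogonalProjectionOnto_eq_of_mem_right]

theorem mgf_norm_sq_stdGaussian {θ : ℝ} (hθ : 2 * θ < 1) :
    mgf (fun x ↦ ‖x‖ ^ 2) (stdGaussian V) θ = (√(1 - 2 * θ))⁻¹ ^ Module.finrank ℝ V := by
  have h_norm (x : Fin (Module.finrank ℝ V) → ℝ) :
      ‖∑ i, x i • stdOrthonormalBasis ℝ V i‖ ^ 2 = ∑ i, x i ^ 2 := by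
    simp [← (stdOrthonormalBasis ℝ V).sum_sq_norm_inner_right, inner_sum,
      inner_smul_right, (stdOrthonormalBasis ℝ V).inner_eq_ite]
  rw [mgf, stdGaussian, integral_map (Measurable.aemeasurable (by fun_prop)) (by fun_prop)]
  simp_rw [h_norm, Finset.mul_sum, Real.exp_sum]
  rw [integral_fintype_prod_eq_prod (f := fun _ x ↦ Real.exp (θ * x ^ 2))]
  simp [← mgf_sq_gaussianReal hθ, mgf]

variable (V) in
/-- The centred normal law on `V` with covariance `v` times the identity. -/
def isotropicGaussian (v : ℝ) : Measure V :=
  (stdGaussian V).map (fun x ↦ √v • x)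

theorem hasLaw_toLp_isotropicGaussian {Ω ι : Type*} [MeasurableSpace Ω] [Fintype ι]
    {P : Measure Ω} [IsProbabilityMeasure P] {v : ℝ≥0} {E : ι → Ω → ℝ}
    (hlaw : ∀ i, HasLaw (E i) (gaussianReal 0 v) P) (hind : iIndepFun E P) :
    HasLaw (fun ω ↦ WithLp.toLp 2 fun i ↦ E i ω)
      (isotropicGaussian (EuclideanSpace ℝ ι) v) P := by
  have h_scale : (Measure.pi fun _ : ι ↦ gaussianReal 0 1).map (fun x i ↦ √v * x i) =
      Measure.pi fun _ ↦ gaussianReal 0 v := by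
    rw [Measure.pi_map_pi fun _ ↦ by fun_prop]
    simp [gaussianReal_map_const_mul]
  refine HasLaw.fun_comp ⟨by fun_prop, ?_⟩ (hind.hasLaw_pi hlaw)
  rw [isotropicGaussian, ← map_pi_eq_stdGaussian, ← h_scale,
    Measure.map_map (by fun_prop) (by fun_prop), Measure.map_map (by fun_prop) (by fun_prop)]
  rfl

variable {Ω : Type*} [MeasurableSpace Ω] {P : Measure Ω} {v θ : ℝ} {Z : Ω → V}

theorem mgf_norm_sq_starProjection (hv : 0 ≤ v) (hZ : HasLaw Z (isotropicGaussian V v) P)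
    (W : Submodule ℝ V) (hθ : 2 * (θ * v) < 1) :
    mgf (fun ω ↦ ‖W.starProjection (Z ω)‖ ^ 2) P θ =
      (√(1 - 2 * (θ * v)))⁻¹ ^ Module.finrank ℝ W := by
  have h_scale (x : V) : θ * ‖W.starProjection (√v • x)‖ ^ 2 =
      θ * v * ‖W.orthogonalProjectionOnto x‖ ^ 2 := by
    rw [map_smul, norm_smul, mul_pow, Real.norm_eq_abs, sq_abs, Real.sq_sqrt hv, mul_assoc]
    rfl
  have h_law := hZ.integral_comp (f := fun x ↦ Real.exp (θ * ‖W.starProjection x‖ ^ 2))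
    (by fun_prop)
  rw [isotropicGaussian, integral_map (by fun_prop) (by fun_prop)] at h_law
  simp_rw [h_scale] at h_law
  rw [← mgf_norm_sq_stdGaussian hθ, ← stdGaussian_map_orthogonalProjectionOnto, mgf, mgf,
    integral_map (by fun_prop) (by fun_prop)]
  exact h_law

theorem integrable_exp_norm_sq_starProjection [IsProbabilityMeasure P] (hv : 0 ≤ v)
    (hZ : HasLaw Z (isotropicGaussian V v) P) (W : Submodule ℝ V) (hθ : 2 * (θ * v) < 1) :
    Integrable (fun ω ↦ Real.exp (θ * ‖W.starProjection (Z ω)‖ ^ 2)) P := by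
  rw [← mgf_pos_iff (X := fun ω ↦ ‖W.starProjection (Z ω)‖ ^ 2),
    mgf_norm_sq_starProjection hv hZ W hθ]
  have : 0 < 1 - 2 * (θ * v) := by linarith
  positivity

theorem measureReal_le_norm_sq_starProjection [IsProbabilityMeasure P] (hv : 0 ≤ v)
    (hZ : HasLaw Z (isotropicGaussian V v) P)
    (W : Submodule ℝ V) (hθ : 2 * (θ * v) < 1) (hθ₀ : 0 ≤ θ) (h : ℝ) :
    P.real {ω | h ≤ ‖W.starProjection (Z ω)‖ ^ 2} ≤
      Real.exp (-θ * h) * (√(1 - 2 * (θ * v)))⁻¹ ^ Module.finrank ℝ W := by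
  rw [← mgf_norm_sq_starProjection hv hZ W hθ]
  exact measure_ge_le_exp_mul_mgf h hθ₀ (integrable_exp_norm_sq_starProjection hv hZ W hθ)

theorem measureReal_norm_sq_starProjection_le [IsProbabilityMeasure P] (hv : 0 ≤ v)
    (hZ : HasLaw Z (isotropicGaussian V v) P)
    (W : Submodule ℝ V) (hθ₀ : θ ≤ 0) (h : ℝ) :
    P.real {ω | ‖W.starProjection (Z ω)‖ ^ 2 ≤ h} ≤
      Real.exp (-θ * h) * (√(1 - 2 * (θ * v)))⁻¹ ^ Module.finrank ℝ W := by
  have hθ : 2 * (θ * v) < 1 := by nlinarith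
  rw [← mgf_norm_sq_starProjection hv hZ W hθ]
  exact measure_le_le_exp_mul_mgf h hθ₀ (integrable_exp_norm_sq_starProjection hv hZ W hθ)

end StdGaussian

/-! ### Sums over models -/

section Models

variable {ι : Type*} [Fintype ι]

theorem one_add_pow_le_exp {φ : ℝ} (hφ : 0 ≤ φ) (m : ℕ) : (1 + φ) ^ m ≤ Real.exp (m * φ) := by
  rw [Real.exp_nat_mul]
  gcongr
  linarith [Real.add_one_le_exp φ]

theorem sum_pow_card_le_exp {φ : ℝ} (hφ : 0 ≤ φ) :
    ∑ k : Finset ι, φ ^ k.card ≤ Real.exp (Fintype.card ι * φ) := by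
  have h_sum := Fintype.sum_pow_mul_eq_add_pow ι φ 1
  simp only [one_pow, mul_one] at h_sum
  rw [h_sum, add_comm]
  exact one_add_pow_le_exp hφ _

theorem card_filter_card_le (q : ℕ) :
    (({k : Finset ι | k.card ≤ q} : Finset _).card : ℝ) ≤
      Real.exp 1 * (Fintype.card ι + 1) ^ q := by
  set φ : ℝ := (Fintype.card ι + 1 : ℝ)⁻¹ with hφ_def
  have hφ₀ : 0 ≤ φ := by positivity
  have hφ₁ : φ ≤ 1 := inv_le_one_of_one_le₀ (by simp)
  have hφ : Fintype.card ι * φ ≤ 1 := by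
    rw [hφ_def, ← div_eq_mul_inv, div_le_one (by positivity)]
    linarith
  rw [← div_le_iff₀ (by positivity), div_eq_mul_inv, ← inv_pow]
  calc _ = ∑ k : Finset ι with k.card ≤ q, φ ^ q := by rw [Finset.sum_const, nsmul_eq_mul]
    _ ≤ ∑ k : Finset ι with k.card ≤ q, φ ^ k.card := Finset.sum_le_sum fun k hk ↦
        pow_le_pow_of_le_one hφ₀ hφ₁ (Finset.mem_filter.1 hk).2
    _ ≤ ∑ k : Finset ι, φ ^ k.card :=
        Finset.sum_le_sum_of_subset_of_nonneg (Finset.filter_subset _ _) fun _ _ _ ↦ by positivity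
    _ ≤ Real.exp 1 := (sum_pow_card_le_exp hφ₀).trans (Real.exp_le_exp.2 hφ)

theorem sum_ssuperset_pow_le [DecidableEq ι] {t : Finset ι} {F : Finset (Finset ι)}
    (hF : ∀ k ∈ F, t ⊂ k) {φ : ℝ} (hφ : 0 ≤ φ) :
    ∑ k ∈ F, φ ^ (k \ t).card ≤ Real.exp (Fintype.card ι * φ) - 1 := by
  have h_inj : Set.InjOn (· \ t) (F : Set (Finset ι)) := fun k hk l hl h ↦ by
    rw [← Finset.sdiff_union_of_subset (hF k hk).subset, show k \ t = l \ t from h,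
      Finset.sdiff_union_of_subset (hF l hl).subset]
  have h_image : F.image (· \ t) ⊆ Finset.univ.erase ∅ := by
    intro s hs
    obtain ⟨k, hk, rfl⟩ := Finset.mem_image.1 hs
    simpa [Finset.sdiff_eq_empty_iff_subset] using (hF k hk).2
  calc ∑ k ∈ F, φ ^ (k \ t).card
      = ∑ s ∈ F.image (· \ t), φ ^ s.card :=
        (Finset.sum_image (f := fun s : Finset ι ↦ φ ^ s.card) h_inj).symm
    _ ≤ ∑ s ∈ (Finset.univ : Finset (Finset ι)).erase ∅, φ ^ s.card :=
        Finset.sum_le_sum_of_subset_of_nonneg h_image fun _ _ _ ↦ by positivity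
    _ = ∑ s : Finset ι, φ ^ s.card - 1 := by
        rw [Finset.sum_erase_eq_sub (Finset.mem_univ _), Finset.card_empty, pow_zero]
    _ ≤ Real.exp (Fintype.card ι * φ) - 1 := by gcongr; exact sum_pow_card_le_exp hφ

end Models

theorem sum_le_of_sum_rpow_le {ι : Type*} {F : Finset ι} {ρ : ι → ℝ} (hρ : ∀ k ∈ F, 0 ≤ ρ k)
    {α s : ℝ} (hα₀ : 0 < α) (hα₁ : α ≤ 1) (hs : s ≤ 1) (h : ∑ k ∈ F, ρ k ^ α ≤ s) :
    ∑ k ∈ F, ρ k ≤ s := by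
  refine (Finset.sum_le_sum fun k hk ↦ ?_).trans h
  have h_rpow : ρ k ^ α ≤ 1 :=
    (Finset.single_le_sum (fun k hk ↦ Real.rpow_nonneg (hρ k hk) α) hk).trans (h.trans hs)
  exact Real.self_le_rpow_of_le_one (hρ k hk)
    ((Real.rpow_le_rpow_iff (hρ k hk) zero_le_one hα₀).1 (by rwa [Real.one_rpow])) hα₁

/-! ### Geometric bounds for the weights -/

namespace Setting

variable (S : Setting)

/-- The factor of `growthConst` by which the variables of the true model are absorbed into a bound
that is geometric in the number of the other variables. -/
def absorbConst : ℝ :=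
  max 1 S.weightConst *
    (max 1 (S.weightBase * (S.T + 1) ^ (S.r + 1 / 2 : ℝ)) * 2 ^ (S.r + 1 / 2 : ℝ)) ^ S.T

/-- The constant factor of `growthFactor`. -/
def growthConst : ℝ := S.absorbConst * S.weightBase

/-- The exponent of `ε⁻¹` in `growthFactor`. -/
def growthExponent : ℕ := (2 * S.r + 2) * S.T + (2 * S.r + 1)

/-- A bound for the contribution of each variable outside the true model to `ratioWeight`, for
models of size at most `q`. -/
def growthFactor (n : ℕ) (ε : ℝ) (q : ℕ) : ℝ :=
  S.growthConst * ε⁻¹ ^ S.growthExponent * (q : ℝ) ^ (S.r + 1 / 2 : ℝ) / n ^ (S.r + 1)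

theorem one_le_absorbConst : 1 ≤ S.absorbConst :=
  one_le_mul_of_one_le_of_one_le (le_max_left _ _) <| one_le_pow₀ <|
    one_le_mul_of_one_le_of_one_le (le_max_left _ _) <|
      Real.one_le_rpow one_le_two (by positivity)

theorem growthConst_pos : 0 < S.growthConst :=
  mul_pos (zero_lt_one.trans_le S.one_le_absorbConst) S.weightBase_pos

theorem growthFactor_nonneg (n : ℕ) {ε : ℝ} (hε : 0 ≤ ε) (q : ℕ) : 0 ≤ S.growthFactor n ε q := by
  have := S.growthConst_pos
  rw [growthFactor]
  positivity

section

variable {n q K m : ℕ} {ε : ℝ}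

theorem ratioWeight_le_mul_growthFactor_pow (hε : 1 ≤ ε⁻¹) (hK : K ≤ q) :
    S.ratioWeight n ε K ≤
      S.weightConst * (n ^ (S.r + 1) * ε⁻¹) ^ S.T * S.growthFactor n ε q ^ K := by
  have := S.weightConst_pos
  have := S.weightBase_pos
  have := S.growthConst_pos
  have : 0 ≤ ε⁻¹ := zero_le_one.trans hε
  have : S.weightBase ≤ S.growthConst := le_mul_of_one_le_left S.weightBase_pos.le
    S.one_le_absorbConst
  have : ε⁻¹ ^ (2 * S.r + 1) ≤ ε⁻¹ ^ S.growthExponent :=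
    pow_le_pow_right₀ hε (Nat.le_add_left _ _)
  rw [ratioWeight, growthFactor, mul_right_comm S.weightBase]
  gcongr

theorem ratioWeight_add (hn : 0 < n) (m : ℕ) :
    S.ratioWeight n ε (S.T + m) =
      S.weightConst *
          (S.weightBase * ((S.T + m : ℕ) : ℝ) ^ (S.r + 1 / 2 : ℝ) * ε⁻¹ ^ (2 * S.r + 2)) ^ S.T *
        (S.weightBase * ((S.T + m : ℕ) : ℝ) ^ (S.r + 1 / 2 : ℝ) * ε⁻¹ ^ (2 * S.r + 1) /
          n ^ (S.r + 1)) ^ m := by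
  rw [ratioWeight, pow_add _ S.T m, ← mul_assoc, mul_assoc S.weightConst, ← mul_pow,
    pow_succ ε⁻¹ (2 * S.r + 1)]
  congr 3
  field_simp

theorem weightBase_mul_rpow_add_le (hm : m ≠ 0) :
    S.weightBase * ((S.T + m : ℕ) : ℝ) ^ (S.r + 1 / 2 : ℝ) ≤
      (max 1 (S.weightBase * (S.T + 1) ^ (S.r + 1 / 2 : ℝ)) * 2 ^ (S.r + 1 / 2 : ℝ)) ^ m := by
  have hsize : ((S.T + m : ℕ) : ℝ) ≤ (S.T + 1) * 2 ^ m := by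
    have : m < 2 ^ m := Nat.lt_two_pow_self
    have : 1 ≤ m := Nat.one_le_iff_ne_zero.2 hm
    exact_mod_cast (by nlinarith : S.T + m ≤ (S.T + 1) * 2 ^ m)
  calc S.weightBase * ((S.T + m : ℕ) : ℝ) ^ (S.r + 1 / 2 : ℝ)
      ≤ S.weightBase * ((S.T + 1) * 2 ^ m) ^ (S.r + 1 / 2 : ℝ) :=
        mul_le_mul_of_nonneg_left (Real.rpow_le_rpow (Nat.cast_nonneg _) hsize (by positivity))
          S.weightBase_pos.le
    _ = S.weightBase * (S.T + 1) ^ (S.r + 1 / 2 : ℝ) * (2 ^ (S.r + 1 / 2 : ℝ)) ^ m := by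
        rw [Real.mul_rpow (by positivity) (by positivity), Real.rpow_pow_comm zero_le_two,
          mul_assoc]
    _ ≤ max 1 (S.weightBase * (S.T + 1) ^ (S.r + 1 / 2 : ℝ)) ^ m *
          (2 ^ (S.r + 1 / 2 : ℝ)) ^ m := by
        gcongr
        exact (le_max_right _ _).trans (le_self_pow₀ (le_max_left _ _) hm)
    _ = _ := (mul_pow _ _ _).symm

theorem ratioWeight_le_growthFactor_pow (hn : 0 < n) (hε : 1 ≤ ε⁻¹) (hm : m ≠ 0)
    (hq : S.T + m ≤ q) : S.ratioWeight n ε (S.T + m) ≤ S.growthFactor n ε q ^ m := by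
  have := S.weightConst_pos
  have := S.weightBase_pos
  set M : ℝ := max 1 (S.weightBase * (S.T + 1) ^ (S.r + 1 / 2 : ℝ)) * 2 ^ (S.r + 1 / 2 : ℝ)
    with hM
  have hconst : S.weightConst ≤ max 1 S.weightConst ^ m :=
    (le_max_right _ _).trans (le_self_pow₀ (le_max_left _ _) hm)
  have hinv : ε⁻¹ ^ (2 * S.r + 2) ≤ (ε⁻¹ ^ (2 * S.r + 2)) ^ m :=
    le_self_pow₀ (one_le_pow₀ hε) hm
  rw [S.ratioWeight_add hn]
  calc S.weightConst *
          (S.weightBase * ((S.T + m : ℕ) : ℝ) ^ (S.r + 1 / 2 : ℝ) * ε⁻¹ ^ (2 * S.r + 2)) ^ S.T *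
        (S.weightBase * ((S.T + m : ℕ) : ℝ) ^ (S.r + 1 / 2 : ℝ) * ε⁻¹ ^ (2 * S.r + 1) /
          n ^ (S.r + 1)) ^ m
      ≤ max 1 S.weightConst ^ m * (M ^ m * (ε⁻¹ ^ (2 * S.r + 2)) ^ m) ^ S.T *
        (S.weightBase * (q : ℝ) ^ (S.r + 1 / 2 : ℝ) * ε⁻¹ ^ (2 * S.r + 1) / n ^ (S.r + 1)) ^ m := by
        gcongr
        exact S.weightBase_mul_rpow_add_le hm
    _ = S.growthFactor n ε q ^ m := by
        rw [growthFactor, growthConst, absorbConst, ← hM, growthExponent, pow_add ε⁻¹, pow_mul]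
        ring

end

end Setting

/-! ### Posterior probabilities -/

theorem dist_toReal_div_sum_one_le {ι : Type*} [Fintype ι] [DecidableEq ι] {a : ι → ℝ≥0∞} {i : ι}
    (hpos : a i ≠ 0) (hfin : a i ≠ ∞) {s : ℝ} (hs : 0 ≤ s)
    (h : ∑ j ∈ Finset.univ.erase i, a j ≤ ENNReal.ofReal s * a i) :
    dist (a i / ∑ j, a j).toReal 1 ≤ s := by
  have hrest_ne : ∑ j ∈ Finset.univ.erase i, a j ≠ ∞ :=
    ne_top_of_le_ne_top (ENNReal.mul_ne_top ENNReal.ofReal_ne_top hfin) h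
  rw [← Finset.add_sum_erase _ _ (Finset.mem_univ i), ENNReal.toReal_div,
    ENNReal.toReal_add hfin hrest_ne]
  have hrest := ENNReal.toReal_mono (ENNReal.mul_ne_top ENNReal.ofReal_ne_top hfin) h
  rw [ENNReal.toReal_mul, ENNReal.toReal_ofReal hs] at hrest
  set x := (a i).toReal
  set u := (∑ j ∈ Finset.univ.erase i, a j).toReal
  have hx : 0 < x := ENNReal.toReal_pos hpos hfin
  have hu : 0 ≤ u := ENNReal.toReal_nonneg
  have hsplit : 1 - x / (x + u) = u / (x + u) := by field_simp; ring
  rw [dist_comm, Real.dist_eq, hsplit, abs_of_nonneg (by positivity), div_le_iff₀ (by positivity)]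
  exact hrest.trans (by gcongr; linarith)

section Odds

variable {ι : Type*} {prior : PMF ι} {i : ι} {w : ℝ} (hw : 0 < w)
  (hodds : ∀ j, 0 < prior j → w < (prior i).toReal / (prior j).toReal)

include hw hodds

theorem prior_le_of_odds (j : ι) : prior j ≤ ENNReal.ofReal w⁻¹ * prior i := by
  rcases eq_zero_or_pos (a := prior j) with hj | hj
  · exact hj ▸ zero_le
  · have h := hodds j hj
    rw [lt_div_iff₀ (ENNReal.toReal_pos hj.ne' (prior.apply_ne_top j)), ← lt_div_iff₀' hw,
      div_eq_inv_mul] at h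
    rw [← ENNReal.ofReal_toReal (prior.apply_ne_top j),
      ← ENNReal.ofReal_toReal (prior.apply_ne_top i), ← ENNReal.ofReal_mul (inv_nonneg.2 hw.le)]
    exact ENNReal.ofReal_le_ofReal h.le

theorem prior_ne_zero_of_odds : prior i ≠ 0 := by
  obtain ⟨j, hj⟩ := prior.support_nonempty
  intro hi
  have := prior_le_of_odds hw hodds j
  rw [hi, mul_zero, nonpos_iff_eq_zero] at this
  exact (PMF.mem_support_iff _ _).1 hj this

end Odds

section Posterior

variable {n p r : ℕ} {α₁ α₂ : ℝ} {X : Matrix (Fin n) (Fin p) ℝ} {A : Matrix (Fin p) (Fin p) ℝ}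
  {prior : PMF (Finset (Fin p))} {t : Finset (Fin p)} {y : Fin n → ℝ} {w : ℝ}

theorem dist_posterior_le {F : Finset (Finset (Fin p))} {ρ : Finset (Fin p) → ℝ} (hw : 0 < w)
    (hodds : ∀ k, 0 < prior k → w < (prior t).toReal / (prior k).toReal)
    (hF : ∀ k ∉ F, k ≠ t → prior k = 0)
    (hpos : 0 < marginal r α₁ α₂ X A t y) (hfin : marginal r α₁ α₂ X A t y ≠ ∞)
    (hρ₀ : ∀ k ∈ F, 0 ≤ ρ k)
    (hρ : ∀ k ∈ F,
      marginal r α₁ α₂ X A k y ≤ ENNReal.ofReal (ρ k) * marginal r α₁ α₂ X A t y) :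
    dist (posterior r α₁ α₂ X A prior t y) 1 ≤ (∑ k ∈ F, ρ k) / w := by
  set a : Finset (Fin p) → ℝ≥0∞ := fun k ↦ prior k * marginal r α₁ α₂ X A k y with ha
  refine dist_toReal_div_sum_one_le (a := a)
    (mul_ne_zero (prior_ne_zero_of_odds hw hodds) hpos.ne')
    (ENNReal.mul_ne_top (prior.apply_ne_top t) hfin)
    (div_nonneg (Finset.sum_nonneg hρ₀) hw.le) ?_
  have hterm : ∀ k ∈ F, a k ≤ ENNReal.ofReal (ρ k / w) * a t := fun k hk ↦
    calc a k ≤ ENNReal.ofReal w⁻¹ * prior t *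
          (ENNReal.ofReal (ρ k) * marginal r α₁ α₂ X A t y) :=
          mul_le_mul' (prior_le_of_odds hw hodds k) (hρ k hk)
      _ = ENNReal.ofReal (ρ k / w) * a t := by
          rw [div_eq_mul_inv, ENNReal.ofReal_mul (hρ₀ k hk), ha]
          ring
  calc ∑ k ∈ Finset.univ.erase t, a k ≤ ∑ k ∈ F, a k :=
        Finset.sum_le_sum_of_ne_zero fun k hk ha_ne ↦ by
          by_contra hkF
          exact ha_ne (by simp [ha, hF k hkF (Finset.ne_of_mem_erase hk)])
    _ ≤ ∑ k ∈ F, ENNReal.ofReal (ρ k / w) * a t := Finset.sum_le_sum hterm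
    _ = ENNReal.ofReal ((∑ k ∈ F, ρ k) / w) * a t := by
        rw [← Finset.sum_mul, Finset.sum_div,
          ENNReal.ofReal_sum_of_nonneg fun k hk ↦ div_nonneg (hρ₀ k hk) hw.le]

end Posterior

/-- The models of size at most `q` that strictly contain `t`. -/
def properSupermodels {p : ℕ} (t : Finset (Fin p)) (q : ℕ) : Finset (Finset (Fin p)) :=
  {k | t ⊂ k ∧ k.card ≤ q}

/-- The models of size at most `q` that do not contain `t`. -/
def missingModels {p : ℕ} (t : Finset (Fin p)) (q : ℕ) : Finset (Finset (Fin p)) :=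
  {k | ¬ t ⊆ k ∧ k.card ≤ q}

theorem disjoint_properSupermodels_missingModels {p : ℕ} (t : Finset (Fin p)) (q : ℕ) :
    Disjoint (properSupermodels t q) (missingModels t q) :=
  Finset.disjoint_left.2 fun _ hk hk' ↦
    (Finset.mem_filter.1 hk').2.1 (Finset.mem_filter.1 hk).2.1.subset

theorem mem_properSupermodels_union_missingModels {p q : ℕ} {t k : Finset (Fin p)}
    (hk : k.card ≤ q) (hkt : k ≠ t) : k ∈ properSupermodels t q ∪ missingModels t q := by
  by_cases htk : t ⊆ k
  · exact Finset.mem_union_left _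
      (Finset.mem_filter.2 ⟨Finset.mem_univ _, htk.ssubset_of_ne hkt.symm, hk⟩)
  · exact Finset.mem_union_right _ (Finset.mem_filter.2 ⟨Finset.mem_univ _, htk, hk⟩)

namespace Setting

variable (S : Setting)

/-- The bound for the ratio of the marginal density of a model `k` containing the true model `t` to
that of `t`, for the error vector `e`. -/
def supermodelRatio {n p : ℕ} (X : Matrix (Fin n) (Fin p) ℝ) (ε : ℝ) (t : Finset (Fin p))
    (e : Fin n → ℝ) (k : Finset (Fin p)) : ℝ :=
  S.ratioWeight n ε k.card *
    Real.exp (S.rate / 2 * ‖(extraSpace X t k).starProjection (WithLp.toLp 2 e)‖ ^ 2)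

/-- The bound for the sum of the ratios of the marginal densities of the models of size at most `q`
that miss a true variable to that of the true model. -/
def missBound (n p : ℕ) (ε : ℝ) (q : ℕ) : ℝ :=
  S.weightConst * (n ^ (S.r + 1) * ε⁻¹) ^ S.T * Real.exp (-(S.missRate * (n * ε ^ 2))) *
    Real.exp (p * S.growthFactor n ε q)

variable {S} {n p q : ℕ} {X : Matrix (Fin n) (Fin p) ℝ} {A : Matrix (Fin p) (Fin p) ℝ}
  {ε h : ℝ} {k t : Finset (Fin p)} {x : Fin p → ℝ} {e : Fin n → ℝ}

theorem supermodelRatio_nonneg (hε : 0 ≤ ε) (k : Finset (Fin p)) :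
    0 ≤ S.supermodelRatio X ε t e k :=
  mul_nonneg (S.ratioWeight_nonneg n hε _) (Real.exp_pos _).le

theorem sum_missingModels_le (hε₀ : 0 < ε) (hε₁ : ε < 1) :
    ∑ k ∈ missingModels t q,
        S.ratioWeight n ε k.card * Real.exp (-(S.missRate * (n * ε ^ 2))) ≤
      S.missBound n p ε q := by
  set D : ℝ := S.weightConst * (n ^ (S.r + 1) * ε⁻¹) ^ S.T *
    Real.exp (-(S.missRate * (n * ε ^ 2))) with hD_def
  have hD : 0 ≤ D := by
    have := S.weightConst_pos
    positivity
  have hφ : 0 ≤ S.growthFactor n ε q := S.growthFactor_nonneg n hε₀.le q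
  calc ∑ k ∈ missingModels t q,
        S.ratioWeight n ε k.card * Real.exp (-(S.missRate * (n * ε ^ 2)))
      ≤ ∑ k ∈ missingModels t q, D * S.growthFactor n ε q ^ k.card := by
        refine Finset.sum_le_sum fun k hk ↦ ?_
        rw [hD_def, mul_right_comm]
        gcongr
        exact S.ratioWeight_le_mul_growthFactor_pow ((one_le_inv₀ hε₀).2 hε₁.le)
          (Finset.mem_filter.1 hk).2.2
    _ ≤ ∑ k : Finset (Fin p), D * S.growthFactor n ε q ^ k.card :=
        Finset.sum_le_sum_of_subset_of_nonneg (Finset.subset_univ _) fun _ _ _ ↦ by positivity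
    _ ≤ S.missBound n p ε q := by
        rw [← Finset.mul_sum, missBound]
        gcongr
        simpa using sum_pow_card_le_exp (ι := Fin p) hφ

theorem IsRegular.dist_posterior_le {prior : PMF (Finset (Fin p))} {w α s : ℝ}
    (hS : S.IsRegular X A ε h q t x) (he : S.IsTypical X h q t e) (hw : 0 < w)
    (hodds : ∀ k, 0 < prior k → w < (prior t).toReal / (prior k).toReal)
    (hprior : ∀ k, q < k.card → prior k = 0) (hα₀ : 0 < α) (hα₁ : α ≤ 1) (hs : s ≤ 1)
    (hsum : ∑ k ∈ properSupermodels t q, S.supermodelRatio X ε t e k ^ α ≤ s) :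
    dist (posterior S.r S.α₁ S.α₂ X A prior t (X *ᵥ x + e)) 1 ≤
      (s + S.missBound n p ε q) / w := by
  set ρ : Finset (Fin p) → ℝ := fun k ↦ if t ⊆ k then S.supermodelRatio X ε t e k
    else S.ratioWeight n ε k.card * Real.exp (-(S.missRate * (n * ε ^ 2))) with hρ_def
  have hρ₀ (k : Finset (Fin p)) : 0 ≤ ρ k := by
    have := S.ratioWeight_nonneg n hS.ε_pos.le k.card
    have := supermodelRatio_nonneg (S := S) (X := X) (t := t) (e := e) hS.ε_pos.le k
    rw [hρ_def]
    positivity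
  have hρ : ∀ k : Finset (Fin p), k.card ≤ q → marginal S.r S.α₁ S.α₂ X A k (X *ᵥ x + e) ≤
      ENNReal.ofReal (ρ k) * marginal S.r S.α₁ S.α₂ X A t (X *ᵥ x + e) := by
    intro k hk
    simp only [hρ_def]
    split_ifs with htk
    exacts [hS.marginal_le_of_subset he hk htk, hS.marginal_le_of_not_subset he hk htk]
  refine (HyperPMOM.dist_posterior_le (F := properSupermodels t q ∪ missingModels t q) hw hodds
    (fun k hk hkt ↦ hprior k (not_le.1 fun hkq ↦
      hk (mem_properSupermodels_union_missingModels hkq hkt)))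
    (hS.marginal_true_pos he) (hS.marginal_true_ne_top he) (fun k _ ↦ hρ₀ k)
    fun k hk ↦ hρ k ?_).trans ?_
  · rcases Finset.mem_union.1 hk with hk | hk
    exacts [(Finset.mem_filter.1 hk).2.2, (Finset.mem_filter.1 hk).2.2]
  · rw [Finset.sum_union (disjoint_properSupermodels_missingModels t q)]
    gcongr
    · rw [Finset.sum_congr rfl fun k hk ↦ if_pos (Finset.mem_filter.1 hk).2.1.subset]
      exact sum_le_of_sum_rpow_le (fun k _ ↦ supermodelRatio_nonneg hS.ε_pos.le k) hα₀ hα₁ hs hsum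
    · rw [Finset.sum_congr rfl fun k hk ↦ if_neg (Finset.mem_filter.1 hk).2.1]
      exact sum_missingModels_le hS.ε_pos hS.ε_lt_one

end Setting

/-! ### Probabilities of atypical errors -/

section Tails

variable {V : Type*} [NormedAddCommGroup V] [InnerProductSpace ℝ V] [FiniteDimensional ℝ V]
  [MeasurableSpace V] [BorelSpace V] {Ω : Type*} [MeasurableSpace Ω] {P : Measure Ω}
  [IsProbabilityMeasure P] {v : ℝ} {Z : Ω → V}

theorem measureReal_mul_le_norm_sq_starProjection (hv : 0 < v)
    (hZ : HasLaw Z (isotropicGaussian V v) P) (W : Submodule ℝ V) (h : ℝ) :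
    P.real {ω | v * h ≤ ‖W.starProjection (Z ω)‖ ^ 2} ≤
      Real.exp (-h / 4) * √2 ^ Module.finrank ℝ W := by
  have hθ : 1 - 2 * (1 / (4 * v) * v) = 2⁻¹ := by field_simp; norm_num
  have hexp : -(1 / (4 * v)) * (v * h) = -h / 4 := by field_simp
  have := measureReal_le_norm_sq_starProjection hv.le hZ W (θ := 1 / (4 * v)) (by linarith)
    (by positivity) (v * h)
  rwa [hθ, hexp, Real.sqrt_inv, inv_inv] at this

theorem measureReal_biUnion_mul_le_norm_sq_starProjection (hv : 0 < v)
    (hZ : HasLaw Z (isotropicGaussian V v) P) {ι : Type*} (F : Finset ι) (W : ι → Submodule ℝ V)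
    {d : ℕ} (hW : ∀ i ∈ F, Module.finrank ℝ (W i) ≤ d) (h : ℝ) :
    P.real (⋃ i ∈ F, {ω | v * h ≤ ‖(W i).starProjection (Z ω)‖ ^ 2}) ≤
      F.card * (Real.exp (-h / 4) * √2 ^ d) := by
  refine (measureReal_biUnion_finset_le F _).trans ?_
  rw [← nsmul_eq_mul]
  refine Finset.sum_le_card_nsmul F _ _ fun i hi ↦
    (measureReal_mul_le_norm_sq_starProjection hv hZ (W i) h).trans ?_
  gcongr
  exacts [Real.one_le_sqrt.2 one_le_two, hW i hi]

theorem measureReal_mul_le_norm_sq (hv : 0 < v) (hZ : HasLaw Z (isotropicGaussian V v) P) :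
    P.real {ω | 4 * Module.finrank ℝ V * v ≤ ‖Z ω‖ ^ 2} ≤
      (Real.exp (-1) * √2) ^ Module.finrank ℝ V := by
  have := measureReal_mul_le_norm_sq_starProjection hv hZ ⊤ (4 * Module.finrank ℝ V)
  rw [finrank_top, neg_div, mul_div_cancel_left₀ _ four_ne_zero] at this
  simp only [Submodule.starProjection_eq_self_iff.2 Submodule.mem_top] at this
  rwa [mul_pow, ← Real.exp_nat_mul, mul_neg_one, mul_comm _ v]

/-- The base of the geometric bound for the probability that the squared norm of a Gaussian vector
is at most `1 - κ` times its mean. -/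
def lowerTailBase (κ : ℝ) : ℝ := Real.exp (κ * (1 - κ) / 2) * (√(1 + κ))⁻¹

theorem measureReal_norm_sq_le (hv : 0 < v) (hZ : HasLaw Z (isotropicGaussian V v) P) {κ : ℝ}
    (hκ : 0 ≤ κ) :
    P.real {ω | ‖Z ω‖ ^ 2 ≤ (1 - κ) * Module.finrank ℝ V * v} ≤
      lowerTailBase κ ^ Module.finrank ℝ V := by
  have hθ : 1 - 2 * (-(κ / (2 * v)) * v) = 1 + κ := by field_simp; ring
  have hexp : -(-(κ / (2 * v))) * ((1 - κ) * Module.finrank ℝ V * v) =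
      Module.finrank ℝ V * (κ * (1 - κ) / 2) := by field_simp
  have := measureReal_norm_sq_starProjection_le hv.le hZ ⊤ (θ := -(κ / (2 * v)))
    (neg_nonpos.2 (by positivity)) ((1 - κ) * Module.finrank ℝ V * v)
  rw [hθ, hexp, finrank_top, Real.exp_nat_mul, ← mul_pow] at this
  simp only [Submodule.starProjection_eq_self_iff.2 Submodule.mem_top] at this
  exact this

theorem lowerTailBase_nonneg (κ : ℝ) : 0 ≤ lowerTailBase κ := by
  rw [lowerTailBase]
  positivity

theorem lowerTailBase_lt_one {κ : ℝ} (hκ : 0 < κ) : lowerTailBase κ < 1 := by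
  have hexp : 1 - κ * (1 - κ) ≤ Real.exp (-(κ * (1 - κ))) := by
    linarith [Real.add_one_le_exp (-(κ * (1 - κ)))]
  have hprod : 1 < (1 + κ) * Real.exp (-(κ * (1 - κ))) :=
    calc 1 < 1 + κ ^ 3 := by linarith [pow_pos hκ 3]
      _ = (1 + κ) * (1 - κ * (1 - κ)) := by ring
      _ ≤ (1 + κ) * Real.exp (-(κ * (1 - κ))) := by gcongr
  rw [Real.exp_neg, ← div_eq_mul_inv, one_lt_div (Real.exp_pos _)] at hprod
  rw [lowerTailBase, ← div_eq_mul_inv, div_lt_one (by positivity), Real.exp_half]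
  exact Real.sqrt_lt_sqrt (Real.exp_pos _).le hprod

theorem exp_neg_one_mul_sqrt_two_lt_one : Real.exp (-1) * √2 < 1 := by
  rw [Real.exp_neg, inv_mul_lt_one₀ (Real.exp_pos 1)]
  exact Real.sqrt_two_lt_three_halves.trans (by linarith [Real.exp_one_gt_d9])

end Tails

section Models

variable {Ω : Type*} [MeasurableSpace Ω] {P : Measure Ω} [IsProbabilityMeasure P] {n p : ℕ}
  {Z : Ω → EuclideanSpace ℝ (Fin n)} {X : Matrix (Fin n) (Fin p) ℝ}

theorem measureReal_exists_le_norm_sq_starProjection {v : ℝ} (hv : 0 < v)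
    (hZ : HasLaw Z (isotropicGaussian _ v) P) (t : Finset (Fin p)) (q : ℕ) (h : ℝ) :
    P.real {ω | ∃ k : Finset (Fin p), k.card ≤ q ∧
        v * h ≤ ‖(colSpace X (k ∪ t)).starProjection (Z ω)‖ ^ 2} ≤
      Real.exp 1 * (p + 1) ^ q * (Real.exp (-h / 4) * √2 ^ (q + t.card)) := by
  have h_union : {ω | ∃ k : Finset (Fin p), k.card ≤ q ∧
      v * h ≤ ‖(colSpace X (k ∪ t)).starProjection (Z ω)‖ ^ 2} ⊆
      ⋃ k ∈ ({k | k.card ≤ q} : Finset (Finset (Fin p))),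
        {ω | v * h ≤ ‖(colSpace X (k ∪ t)).starProjection (Z ω)‖ ^ 2} := by
    rintro ω ⟨k, hk, hω⟩
    exact Set.mem_biUnion (Finset.mem_filter.2 ⟨Finset.mem_univ k, hk⟩) hω
  have h_finrank (k : Finset (Fin p)) (hk : k ∈ ({k | k.card ≤ q} : Finset (Finset (Fin p)))) :
      Module.finrank ℝ (colSpace X (k ∪ t)) ≤ q + t.card :=
    (finrank_colSpace_le _).trans <| (Finset.card_union_le k t).trans <|
      Nat.add_le_add_right (Finset.mem_filter.1 hk).2 _
  refine (measureReal_mono h_union (measure_ne_top P _)).trans <|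
    (measureReal_biUnion_mul_le_norm_sq_starProjection hv hZ _ _ h_finrank h).trans ?_
  have h_card := card_filter_card_le (ι := Fin p) q
  rw [Fintype.card_fin] at h_card
  exact mul_le_mul_of_nonneg_right h_card (by positivity)

namespace Setting

variable (S : Setting)

/-- The bound for the probability that the error vector is not typical. -/
def atypicalBound (n p : ℕ) (h : ℝ) (q : ℕ) : ℝ :=
  (Real.exp (-1) * √2) ^ n + lowerTailBase S.κ ^ n +
    Real.exp 1 * (p + 1) ^ q * (Real.exp (-h / 4) * √2 ^ (q + S.T))

variable {S}

theorem measureReal_not_isTypical_le (hZ : HasLaw Z (isotropicGaussian _ S.v) P)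
    {t : Finset (Fin p)} (ht : t.card = S.T) (q : ℕ) (h : ℝ) :
    P.real {ω | ¬ S.IsTypical X h q t (Z ω)} ≤ S.atypicalBound n p h q := by
  have h_upper := measureReal_mul_le_norm_sq S.v_pos hZ
  have h_lower := measureReal_norm_sq_le S.v_pos hZ S.κ_pos.le
  have h_proj := measureReal_exists_le_norm_sq_starProjection (X := X) S.v_pos hZ t q h
  rw [finrank_euclideanSpace_fin] at h_upper h_lower
  rw [ht] at h_proj
  refine (measureReal_mono fun ω hω ↦ ?_).trans <| (measureReal_union_le _ _).trans <|
    add_le_add ((measureReal_union_le _ _).trans (add_le_add h_upper h_lower)) h_proj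
  contrapose! hω
  simp only [Set.mem_union, Set.mem_ofPred_eq, not_or, not_le, not_exists, not_and] at hω
  obtain ⟨⟨hω_upper, hω_lower⟩, hω_proj⟩ := hω
  exact not_not.2 ⟨hω_upper.le, hω_lower.le, fun k hk ↦ (hω_proj k hk).le⟩

end Setting

end Models

namespace Setting

variable (S : Setting)

/-- The bound for the expectation of `exp (α * S.rate / 2 * ‖W.starProjection e‖ ^ 2)` that each
dimension of `W` contributes when `e` is the error vector. -/
def expMoment (α : ℝ) : ℝ := (√(1 - α / (1 - 2 * S.κ)))⁻¹

/-- The bound for the expectation of the sum of the `α`-th powers of `supermodelRatio` over the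
proper supermodels of the true model. -/
def supermodelBound (n p : ℕ) (ε : ℝ) (q : ℕ) (α : ℝ) : ℝ :=
  Real.exp (p * (S.growthFactor n ε q ^ α * S.expMoment α)) - 1

variable {S} {Ω : Type*} [MeasurableSpace Ω] {P : Measure Ω} {n p q : ℕ}
  {Z : Ω → EuclideanSpace ℝ (Fin n)} {X : Matrix (Fin n) (Fin p) ℝ} {ε α : ℝ}
  {t k : Finset (Fin p)}

theorem two_mul_rate_lt_one (hα : α < 1 - 2 * S.κ) : 2 * (α * (S.rate / 2) * S.v) < 1 := by
  have := S.v_pos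
  have hκ : 0 < 1 - 2 * S.κ := by linarith [S.κ_lt_half]
  rw [rate]
  field_simp
  linarith

theorem expMoment_eq : (√(1 - 2 * (α * (S.rate / 2) * S.v)))⁻¹ = S.expMoment α := by
  have := S.v_pos
  have hκ : 1 - 2 * S.κ ≠ 0 := by linarith [S.κ_lt_half]
  rw [rate, expMoment]
  field_simp

theorem one_le_expMoment (hα₀ : 0 ≤ α) (hα₁ : α < 1 - 2 * S.κ) : 1 ≤ S.expMoment α := by
  have hκ : 0 < 1 - 2 * S.κ := by linarith [S.κ_lt_half]
  have hle : 0 ≤ α / (1 - 2 * S.κ) := by positivity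
  have hlt : α / (1 - 2 * S.κ) < 1 := (div_lt_one hκ).2 hα₁
  exact (one_le_inv₀ (Real.sqrt_pos.2 (by linarith))).2 (Real.sqrt_le_one.2 (by linarith))

theorem supermodelRatio_rpow (hε : 0 ≤ ε) (e : Fin n → ℝ) (k : Finset (Fin p)) :
    S.supermodelRatio X ε t e k ^ α = S.ratioWeight n ε k.card ^ α *
      Real.exp (α * (S.rate / 2) *
        ‖(extraSpace X t k).starProjection (WithLp.toLp 2 e)‖ ^ 2) := by
  rw [supermodelRatio, Real.mul_rpow (S.ratioWeight_nonneg n hε _) (Real.exp_pos _).le,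
    ← Real.exp_mul, mul_comm _ α, mul_assoc]

theorem integral_supermodelRatio_rpow_le (hZ : HasLaw Z (isotropicGaussian _ S.v) P)
    (hn : 0 < n) (hε₀ : 0 < ε) (hε₁ : ε < 1) (hα₀ : 0 ≤ α) (hα₁ : α < 1 - 2 * S.κ)
    (ht : t.card = S.T) (hk : k ∈ properSupermodels t q) :
    ∫ ω, S.supermodelRatio X ε t (Z ω) k ^ α ∂P ≤
      (S.growthFactor n ε q ^ α * S.expMoment α) ^ (k \ t).card := by
  obtain ⟨-, htk, hkq⟩ := Finset.mem_filter.1 hk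
  have hcard : S.T + (k \ t).card = k.card := by
    rw [← ht, add_comm, Finset.card_sdiff_add_card_eq_card htk.subset]
  have hm : (k \ t).card ≠ 0 := (Finset.card_pos.2 (Finset.sdiff_nonempty.2 htk.2)).ne'
  have hφ : 0 ≤ S.growthFactor n ε q := S.growthFactor_nonneg n hε₀.le q
  have hweight := S.ratioWeight_le_growthFactor_pow hn ((one_le_inv₀ hε₀).2 hε₁.le) hm
    (hcard.trans_le hkq)
  rw [hcard] at hweight
  have hmgf := mgf_norm_sq_starProjection S.v_pos.le hZ (extraSpace X t k)
    (two_mul_rate_lt_one hα₁)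
  rw [mgf, expMoment_eq] at hmgf
  simp only [supermodelRatio_rpow hε₀.le, WithLp.toLp_ofLp]
  rw [integral_const_mul, hmgf, mul_pow, Real.rpow_pow_comm hφ]
  have hone := one_le_expMoment hα₀ hα₁
  gcongr
  exacts [S.ratioWeight_nonneg n hε₀.le _, finrank_extraSpace_le htk.subset]

variable [IsProbabilityMeasure P]

theorem integrable_supermodelRatio_rpow (hZ : HasLaw Z (isotropicGaussian _ S.v) P) (hε : 0 ≤ ε)
    (hα : α < 1 - 2 * S.κ) (k : Finset (Fin p)) :
    Integrable (fun ω ↦ S.supermodelRatio X ε t (Z ω) k ^ α) P := by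
  simp only [supermodelRatio_rpow hε, WithLp.toLp_ofLp]
  exact (integrable_exp_norm_sq_starProjection S.v_pos.le hZ _ (two_mul_rate_lt_one hα)).const_mul _

theorem measureReal_le_sum_supermodelRatio (hZ : HasLaw Z (isotropicGaussian _ S.v) P)
    (hn : 0 < n) (hε₀ : 0 < ε) (hε₁ : ε < 1) (hα₀ : 0 ≤ α) (hα₁ : α < 1 - 2 * S.κ)
    (ht : t.card = S.T) {s : ℝ} (hs : 0 < s) :
    P.real {ω | s ≤ ∑ k ∈ properSupermodels t q, S.supermodelRatio X ε t (Z ω) k ^ α} ≤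
      S.supermodelBound n p ε q α / s := by
  have hsum_nonneg : 0 ≤ᵐ[P]
      fun ω ↦ ∑ k ∈ properSupermodels t q, S.supermodelRatio X ε t (Z ω) k ^ α :=
    ae_of_all _ fun ω ↦ Finset.sum_nonneg fun k _ ↦
      Real.rpow_nonneg (supermodelRatio_nonneg hε₀.le k) α
  have hint (k : Finset (Fin p)) : Integrable (fun ω ↦ S.supermodelRatio X ε t (Z ω) k ^ α) P :=
    integrable_supermodelRatio_rpow hZ hε₀.le hα₁ k
  have hφ : 0 ≤ S.growthFactor n ε q ^ α * S.expMoment α :=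
    mul_nonneg (Real.rpow_nonneg (S.growthFactor_nonneg n hε₀.le q) α)
      (zero_le_one.trans (one_le_expMoment hα₀ hα₁))
  rw [le_div_iff₀' hs]
  refine (mul_meas_ge_le_integral_of_nonneg hsum_nonneg
    (integrable_finsetSum _ fun k _ ↦ hint k) s).trans ?_
  rw [integral_finsetSum _ fun k _ ↦ hint k]
  refine (Finset.sum_le_sum fun k hk ↦
    integral_supermodelRatio_rpow_le hZ hn hε₀ hε₁ hα₀ hα₁ ht hk).trans ?_
  simpa [supermodelBound] using
    sum_ssuperset_pow_le (F := properSupermodels t q) (fun k hk ↦ (Finset.mem_filter.1 hk).2.1) hφ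

theorem IsRegular.measureReal_le_dist_posterior {A : Matrix (Fin p) (Fin p) ℝ} {x : Fin p → ℝ}
    {prior : PMF (Finset (Fin p))} {h w s δ : ℝ} (hS : S.IsRegular X A ε h q t x)
    (hZ : HasLaw Z (isotropicGaussian _ S.v) P) (hw : 0 < w)
    (hodds : ∀ k, 0 < prior k → w < (prior t).toReal / (prior k).toReal)
    (hprior : ∀ k, q < k.card → prior k = 0) (hα₀ : 0 < α) (hα₁ : α < 1 - 2 * S.κ)
    (hs₀ : 0 < s) (hs₁ : s ≤ 1) (hδ : (s + S.missBound n p ε q) / w < δ) :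
    P.real {ω | δ ≤ dist (posterior S.r S.α₁ S.α₂ X A prior t (X *ᵥ x + Z ω)) 1} ≤
      S.atypicalBound n p h q + S.supermodelBound n p ε q α / s := by
  have hα : α ≤ 1 := by linarith [S.κ_pos]
  refine (measureReal_mono fun ω hω ↦ ?_).trans <| (measureReal_union_le _ _).trans <|
    add_le_add (measureReal_not_isTypical_le (X := X) hZ hS.card_eq q h)
      (measureReal_le_sum_supermodelRatio (X := X) hZ hS.n_pos hS.ε_pos hS.ε_lt_one hα₀.le hα₁
        hS.card_eq hs₀)
  by_contra hω'
  simp only [Set.mem_union, Set.mem_ofPred_eq, not_or, not_not, not_le] at hω'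
  exact (hS.dist_posterior_le hω'.1 hw hodds hprior hα₀ hα hs₁ hω'.2.le).not_gt
    (hδ.trans_le hω)

end Setting

/-! ### Asymptotics -/

section Powers

theorem isBigO_natCast_rpow_of_le {a b : ℝ} (h : a ≤ b) :
    (fun n : ℕ ↦ (n : ℝ) ^ a) =O[atTop] fun n ↦ (n : ℝ) ^ b := by
  refine IsBigO.of_bound' ?_
  filter_upwards [eventually_ge_atTop 1] with n hn
  rw [Real.norm_of_nonneg (by positivity), Real.norm_of_nonneg (by positivity)]
  exact Real.rpow_le_rpow_of_exponent_le (Nat.one_le_cast.2 hn) h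

theorem isLittleO_natCast_rpow_of_lt {a b : ℝ} (h : a < b) :
    (fun n : ℕ ↦ (n : ℝ) ^ a) =o[atTop] fun n ↦ (n : ℝ) ^ b := by
  refine ((isLittleO_one_iff ℝ).2 <| (tendsto_rpow_neg_atTop (sub_pos.2 h)).comp
    tendsto_natCast_atTop_atTop).mul_isBigO (isBigO_refl (fun n : ℕ ↦ (n : ℝ) ^ b) atTop)
    |>.congr' ?_ (by simp)
  filter_upwards [eventually_gt_atTop 0] with n hn
  rw [Function.comp_apply, ← Real.rpow_add (Nat.cast_pos.2 hn), neg_sub, sub_add_cancel]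

theorem isBigO_rpow_of_isBigO_natCast_rpow {f : ℕ → ℝ} {a b : ℝ} (hb : 0 ≤ b)
    (h : f =O[atTop] fun n : ℕ ↦ (n : ℝ) ^ a) :
    (fun n ↦ f n ^ b) =O[atTop] fun n : ℕ ↦ (n : ℝ) ^ (a * b) := by
  simpa only [Real.rpow_mul (Nat.cast_nonneg _)] using
    h.rpow hb (Eventually.of_forall fun n ↦ by positivity)

theorem isBigO_pow_of_isBigO_natCast_rpow {f : ℕ → ℝ} {a : ℝ}
    (h : f =O[atTop] fun n : ℕ ↦ (n : ℝ) ^ a) (E : ℕ) :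
    (fun n ↦ f n ^ E) =O[atTop] fun n : ℕ ↦ (n : ℝ) ^ (a * E) := by
  simpa only [Real.rpow_mul_natCast (Nat.cast_nonneg _)] using h.pow E

theorem tendsto_zero_of_isBigO_natCast_rpow {f : ℕ → ℝ} {a : ℝ} (ha : a < 0)
    (h : f =O[atTop] fun n : ℕ ↦ (n : ℝ) ^ a) : Tendsto f atTop (𝓝 0) := by
  refine h.trans_tendsto ?_
  simpa [Function.comp_def] using
    (tendsto_rpow_neg_atTop (neg_pos.2 ha)).comp tendsto_natCast_atTop_atTop

theorem isBigO_log_add_one_of_isBigO_natCast_rpow {f : ℕ → ℝ} {γ η : ℝ} (hη : 0 < η)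
    (hf₀ : ∀ n, 0 ≤ f n) (hf : f =O[atTop] fun n : ℕ ↦ (n : ℝ) ^ γ) :
    (fun n ↦ Real.log (f n + 1)) =O[atTop] fun n : ℕ ↦ (n : ℝ) ^ η := by
  have hg : 0 < max γ 1 := lt_max_of_lt_right one_pos
  have hone : (fun _ ↦ 1 : ℕ → ℝ) =O[atTop] fun n : ℕ ↦ (n : ℝ) ^ max γ 1 := by
    simpa only [Real.rpow_zero] using isBigO_natCast_rpow_of_le hg.le
  have hadd : (fun n ↦ f n + 1) =O[atTop] fun n : ℕ ↦ (n : ℝ) ^ max γ 1 :=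
    (hf.trans (isBigO_natCast_rpow_of_le (le_max_left γ 1))).add hone
  have hlog : (fun n ↦ Real.log (f n + 1)) =O[atTop] fun n ↦ (f n + 1) ^ (η / max γ 1) := by
    refine IsBigO.of_bound (η / max γ 1)⁻¹ (Eventually.of_forall fun n ↦ ?_)
    have := hf₀ n
    rw [Real.norm_of_nonneg (Real.log_nonneg (by linarith)), Real.norm_of_nonneg (by positivity),
      inv_mul_eq_div]
    exact Real.log_le_rpow_div (by positivity) (by positivity)
  simpa only [mul_div_cancel₀ _ hg.ne'] using
    hlog.trans (isBigO_rpow_of_isBigO_natCast_rpow (by positivity) hadd)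

end Powers

variable {p q : ℕ → ℕ} {ε : ℕ → ℝ} {γ ξ ζ α : ℝ}

theorem eventually_sqrt_le_mul_sq (hε₀ : ∀ n, 1 ≤ n → 0 < ε n)
    (hε : ∀ η : ℝ, 0 < η → (fun n ↦ (ε n)⁻¹) =O[atTop] fun n : ℕ ↦ (n : ℝ) ^ η) :
    ∀ᶠ n : ℕ in atTop, (n : ℝ) ^ (1 / 2 : ℝ) ≤ n * ε n ^ 2 := by
  have hsq : (fun n ↦ (ε n)⁻¹ ^ 2) =o[atTop] fun n : ℕ ↦ (n : ℝ) ^ (1 / 2 : ℝ) :=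
    (isBigO_pow_of_isBigO_natCast_rpow (hε (1 / 8) (by norm_num)) 2).trans_isLittleO
      (isLittleO_natCast_rpow_of_lt (by norm_num))
  filter_upwards [hsq.bound one_pos, eventually_ge_atTop 1] with n hbound hn
  have hn' : (0 : ℝ) < n := Nat.cast_pos.2 hn
  rw [one_mul, Real.norm_of_nonneg (by positivity), Real.norm_of_nonneg (by positivity),
    inv_pow] at hbound
  rw [← mul_inv_le_iff₀ (pow_pos (hε₀ n hn) 2)]
  calc (n : ℝ) ^ (1 / 2 : ℝ) * (ε n ^ 2)⁻¹
      ≤ (n : ℝ) ^ (1 / 2 : ℝ) * (n : ℝ) ^ (1 / 2 : ℝ) := by gcongr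
    _ = n := by rw [← Real.rpow_add hn', add_halves, Real.rpow_one]

theorem eventually_mul_rpow_add_add_one_le (C : ℝ) (hε₀ : ∀ n, 1 ≤ n → 0 < ε n)
    (hε : ∀ η : ℝ, 0 < η → (fun n ↦ (ε n)⁻¹) =O[atTop] fun n : ℕ ↦ (n : ℝ) ^ η)
    (hq : (fun n ↦ (q n : ℝ)) =O[atTop] fun n : ℕ ↦ (n : ℝ) ^ ξ) (hξζ : ξ ≤ ζ) (hζ₀ : 0 ≤ ζ)
    (hζ₁ : ζ < 1) :
    ∀ᶠ n : ℕ in atTop, C * ((n : ℝ) ^ ζ + q n + 1) ≤ n * ε n := by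
  have hone : (fun _ ↦ 1 : ℕ → ℝ) =O[atTop] fun n : ℕ ↦ (n : ℝ) ^ ζ := by
    simpa using isBigO_natCast_rpow_of_le hζ₀
  have hsize : (fun n : ℕ ↦ C * ((n : ℝ) ^ ζ + q n + 1)) =O[atTop]
      fun n : ℕ ↦ (n : ℝ) ^ ζ :=
    (((isBigO_refl _ _).add (hq.trans (isBigO_natCast_rpow_of_le hξζ))).add hone).const_mul_left _
  have hmul : (fun n : ℕ ↦ C * ((n : ℝ) ^ ζ + q n + 1) * (ε n)⁻¹) =o[atTop]
      fun n : ℕ ↦ (n : ℝ) ^ (1 : ℝ) :=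
    (hsize.mul_atTop_rpow_natCast_of_isBigO_rpow _ _ _ (hε ((1 - ζ) / 2) (by linarith))
      le_rfl).trans_isLittleO (isLittleO_natCast_rpow_of_lt (by linarith))
  filter_upwards [hmul.bound one_pos, eventually_ge_atTop 1] with n hbound hn
  rw [Real.rpow_one, one_mul, Real.norm_of_nonneg (Nat.cast_nonneg n)] at hbound
  exact (mul_inv_le_iff₀ (hε₀ n hn)).1 ((le_abs_self _).trans hbound)

theorem tendsto_pow_mul_exp_neg_rpow (T : ℕ)
    (hp : (fun n ↦ (p n : ℝ)) =O[atTop] fun n : ℕ ↦ (n : ℝ) ^ γ)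
    (hq : (fun n ↦ (q n : ℝ)) =O[atTop] fun n : ℕ ↦ (n : ℝ) ^ ξ) (hξζ : ξ < ζ) (hζ : 0 < ζ) :
    Tendsto (fun n : ℕ ↦ Real.exp 1 * ((p n : ℝ) + 1) ^ q n *
      (Real.exp (-(n : ℝ) ^ ζ / 4) * √2 ^ (q n + T))) atTop (𝓝 0) := by
  set f : ℕ → ℝ := fun n ↦
    1 + q n * Real.log (p n + 1) + (q n + T : ℕ) * Real.log √2 with hf_def
  have hlog : (fun n ↦ q n * Real.log (p n + 1)) =o[atTop] fun n : ℕ ↦ (n : ℝ) ^ ζ :=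
    (hq.mul_atTop_rpow_natCast_of_isBigO_rpow _ _ _
      (isBigO_log_add_one_of_isBigO_natCast_rpow (half_pos (sub_pos.2 hξζ))
        (fun n ↦ Nat.cast_nonneg (p n)) hp) le_rfl).trans_isLittleO
      (isLittleO_natCast_rpow_of_lt (by linarith))
  have hconst (c : ℝ) : (fun _ ↦ c : ℕ → ℝ) =o[atTop] fun n : ℕ ↦ (n : ℝ) ^ ζ := by
    simpa using (isLittleO_natCast_rpow_of_lt hζ).const_mul_left c
  have hq' : (fun n ↦ (q n : ℝ)) =o[atTop] fun n : ℕ ↦ (n : ℝ) ^ ζ :=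
    hq.trans_isLittleO (isLittleO_natCast_rpow_of_lt hξζ)
  have hf : f =o[atTop] fun n : ℕ ↦ (n : ℝ) ^ ζ := by
    simp only [hf_def, Nat.cast_add, mul_comm _ (Real.log √2)]
    exact ((hconst 1).add hlog).add ((hq'.add (hconst T)).const_mul_left _)
  have hlim : Tendsto (fun n : ℕ ↦ f n + -(n : ℝ) ^ ζ / 4) atTop atBot := by
    have hpow : Tendsto (fun n : ℕ ↦ (n : ℝ) ^ ζ / 8) atTop atTop :=
      ((tendsto_rpow_atTop hζ).comp tendsto_natCast_atTop_atTop).atTop_div_const (by norm_num)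
    refine tendsto_atBot_mono' _ ?_ (tendsto_neg_atTop_atBot.comp hpow)
    filter_upwards [hf.bound (show (0 : ℝ) < 1 / 8 by norm_num)] with n hn
    rw [Real.norm_of_nonneg (show 0 ≤ (n : ℝ) ^ ζ by positivity)] at hn
    have := (le_abs_self _).trans hn
    rw [Function.comp_apply]
    linarith
  refine (Real.tendsto_exp_atBot.comp hlim).congr fun n ↦ ?_
  rw [Function.comp_apply, hf_def, Real.exp_add, Real.exp_add, Real.exp_add, Real.exp_nat_mul,
    Real.exp_nat_mul, Real.exp_log (by positivity), Real.exp_log (by positivity)]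
  ring

namespace Setting

variable (S : Setting)

theorem isBigO_growthFactor
    (hε : ∀ η : ℝ, 0 < η → (fun n ↦ (ε n)⁻¹) =O[atTop] fun n : ℕ ↦ (n : ℝ) ^ η)
    (hq : (fun n ↦ (q n : ℝ)) =O[atTop] fun n : ℕ ↦ (n : ℝ) ^ ξ) {a : ℝ}
    (ha : ξ * (S.r + 1 / 2) - (S.r + 1) < a) :
    (fun n ↦ S.growthFactor n (ε n) (q n)) =O[atTop] fun n : ℕ ↦ (n : ℝ) ^ a := by
  have hE : (S.growthExponent : ℝ) ≠ 0 := by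
    rw [growthExponent]
    positivity
  set η : ℝ := (a - (ξ * (S.r + 1 / 2) - (S.r + 1))) / S.growthExponent with hη_def
  have hη : 0 < η := by
    have : 0 ≤ (S.growthExponent : ℝ) := Nat.cast_nonneg _
    have := sub_pos.2 ha
    positivity
  have hε_pow := isBigO_pow_of_isBigO_natCast_rpow (hε η hη) S.growthExponent
  have hq_pow := isBigO_rpow_of_isBigO_natCast_rpow (b := S.r + 1 / 2) (by positivity) hq
  refine (((hε_pow.const_mul_left S.growthConst).mul hq_pow).mul
    (isBigO_refl (fun n : ℕ ↦ ((n : ℝ) ^ (S.r + 1))⁻¹) atTop)).congr' ?_ ?_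
  · exact Eventually.of_forall fun n ↦ (div_eq_mul_inv _ _).symm
  · filter_upwards [eventually_gt_atTop 0] with n hn
    have hn' : (0 : ℝ) < n := Nat.cast_pos.2 hn
    rw [← Real.rpow_natCast _ (S.r + 1), ← Real.rpow_neg hn'.le, ← Real.rpow_add hn',
      ← Real.rpow_add hn', hη_def, div_mul_cancel₀ _ hE]
    push_cast
    congr 1
    ring

theorem tendsto_mul_growthFactor_rpow
    (hε : ∀ η : ℝ, 0 < η → (fun n ↦ (ε n)⁻¹) =O[atTop] fun n : ℕ ↦ (n : ℝ) ^ η)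
    (hp : (fun n ↦ (p n : ℝ)) =O[atTop] fun n : ℕ ↦ (n : ℝ) ^ γ)
    (hq : (fun n ↦ (q n : ℝ)) =O[atTop] fun n : ℕ ↦ (n : ℝ) ^ ξ) (hα : 0 < α)
    (h : γ + α * (ξ * (S.r + 1 / 2) - (S.r + 1)) < 0) :
    Tendsto (fun n ↦ p n * S.growthFactor n (ε n) (q n) ^ α) atTop (𝓝 0) := by
  have hlt : ξ * (S.r + 1 / 2) - (S.r + 1) < -γ / α := (lt_div_iff₀' hα).2 (by linarith)
  obtain ⟨a, ha, haγ⟩ := exists_between hlt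
  have hgrowth := isBigO_rpow_of_isBigO_natCast_rpow hα.le (S.isBigO_growthFactor hε hq ha)
  rw [lt_div_iff₀ hα] at haγ
  refine tendsto_zero_of_isBigO_natCast_rpow (a := γ + a * α) (by linarith) ?_
  exact hp.mul_atTop_rpow_natCast_of_isBigO_rpow _ _ _ hgrowth le_rfl

theorem tendsto_supermodelBound
    (hε : ∀ η : ℝ, 0 < η → (fun n ↦ (ε n)⁻¹) =O[atTop] fun n : ℕ ↦ (n : ℝ) ^ η)
    (hp : (fun n ↦ (p n : ℝ)) =O[atTop] fun n : ℕ ↦ (n : ℝ) ^ γ)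
    (hq : (fun n ↦ (q n : ℝ)) =O[atTop] fun n : ℕ ↦ (n : ℝ) ^ ξ) (hα : 0 < α)
    (h : γ + α * (ξ * (S.r + 1 / 2) - (S.r + 1)) < 0) :
    Tendsto (fun n ↦ S.supermodelBound n (p n) (ε n) (q n) α) atTop (𝓝 0) := by
  have hlim := (S.tendsto_mul_growthFactor_rpow hε hp hq hα h).mul_const (S.expMoment α)
  simp only [zero_mul, mul_assoc] at hlim
  simpa [supermodelBound] using ((Real.continuous_exp.tendsto 0).comp hlim).sub_const 1

theorem tendsto_pow_mul_exp_neg (hε₀ : ∀ n, 1 ≤ n → 0 < ε n)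
    (hε : ∀ η : ℝ, 0 < η → (fun n ↦ (ε n)⁻¹) =O[atTop] fun n : ℕ ↦ (n : ℝ) ^ η) :
    Tendsto (fun n : ℕ ↦ S.weightConst * (n ^ (S.r + 1) * (ε n)⁻¹) ^ S.T *
      Real.exp (-(S.missRate * (n * ε n ^ 2)))) atTop (𝓝 0) := by
  have hpow : (fun n : ℕ ↦ (n : ℝ) ^ (S.r + 1) * (ε n)⁻¹) =O[atTop]
      fun n : ℕ ↦ (n : ℝ) ^ (S.r + 2 : ℝ) := by
    refine IsBigO.mul_atTop_rpow_natCast_of_isBigO_rpow (S.r + 1) 1 _ ?_ (hε 1 one_pos)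
      (by linarith)
    simpa only [← Real.rpow_natCast, Nat.cast_add, Nat.cast_one] using isBigO_refl _ _
  have hexp : (fun n : ℕ ↦ Real.exp (-(S.missRate * (n * ε n ^ 2)))) =O[atTop]
      fun n : ℕ ↦ Real.exp (-S.missRate * (n : ℝ) ^ (1 / 2 : ℝ)) := by
    refine IsBigO.of_bound' ?_
    filter_upwards [eventually_sqrt_le_mul_sq hε₀ hε] with n hn
    rw [Real.norm_of_nonneg (Real.exp_pos _).le, Real.norm_of_nonneg (Real.exp_pos _).le,
      Real.exp_le_exp, neg_mul, neg_le_neg_iff]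
    exact mul_le_mul_of_nonneg_left hn S.missRate_pos.le
  refine ((((isBigO_pow_of_isBigO_natCast_rpow hpow S.T).const_mul_left S.weightConst).mul
    hexp).trans_tendsto ?_)
  refine ((tendsto_rpow_mul_exp_neg_mul_atTop_nhds_zero (2 * ((S.r + 2) * S.T)) S.missRate
    S.missRate_pos).comp ((tendsto_rpow_atTop one_half_pos).comp
      tendsto_natCast_atTop_atTop)).congr fun n ↦ ?_
  simp only [Function.comp_apply]
  rw [← Real.rpow_mul (Nat.cast_nonneg n), one_div, inv_mul_cancel_left₀ two_ne_zero]

theorem tendsto_missBound (hε₀ : ∀ n, 1 ≤ n → 0 < ε n)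
    (hε : ∀ η : ℝ, 0 < η → (fun n ↦ (ε n)⁻¹) =O[atTop] fun n : ℕ ↦ (n : ℝ) ^ η)
    (hp : (fun n ↦ (p n : ℝ)) =O[atTop] fun n : ℕ ↦ (n : ℝ) ^ γ)
    (hq : (fun n ↦ (q n : ℝ)) =O[atTop] fun n : ℕ ↦ (n : ℝ) ^ ξ)
    (h : γ + (ξ * (S.r + 1 / 2) - (S.r + 1)) < 0) :
    Tendsto (fun n ↦ S.missBound n (p n) (ε n) (q n)) atTop (𝓝 0) := by
  have hlim := S.tendsto_mul_growthFactor_rpow hε hp hq one_pos (by rwa [one_mul])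
  simp only [Real.rpow_one] at hlim
  simpa [missBound] using
    (S.tendsto_pow_mul_exp_neg hε₀ hε).mul ((Real.continuous_exp.tendsto 0).comp hlim)

theorem tendsto_atypicalBound
    (hp : (fun n ↦ (p n : ℝ)) =O[atTop] fun n : ℕ ↦ (n : ℝ) ^ γ)
    (hq : (fun n ↦ (q n : ℝ)) =O[atTop] fun n : ℕ ↦ (n : ℝ) ^ ξ) (hξζ : ξ < ζ) (hζ : 0 < ζ) :
    Tendsto (fun n : ℕ ↦ S.atypicalBound n (p n) ((n : ℝ) ^ ζ) (q n)) atTop (𝓝 0) := by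
  have h_upper := tendsto_pow_atTop_nhds_zero_of_lt_one (by positivity)
    exp_neg_one_mul_sqrt_two_lt_one
  have h_lower := tendsto_pow_atTop_nhds_zero_of_lt_one (lowerTailBase_nonneg S.κ)
    (lowerTailBase_lt_one S.κ_pos)
  simpa [atypicalBound] using
    (h_upper.add h_lower).add (tendsto_pow_mul_exp_neg_rpow S.T hp hq hξζ hζ)

end Setting

theorem exists_lt_one_add_mul_neg {γ c : ℝ} (h : γ + c < 0) :
    ∃ α : ℝ, 0 < α ∧ α < 1 ∧ γ + α * c < 0 := by
  have hlim : Tendsto (fun α : ℝ ↦ γ + α * c) (𝓝[<] 1) (𝓝 (γ + 1 * c)) :=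
    tendsto_nhdsWithin_of_tendsto_nhds (Continuous.tendsto (by fun_prop) 1)
  rw [one_mul] at hlim
  obtain ⟨α, hneg, hα₀, hα₁⟩ :=
    ((hlim.eventually_lt_const h).and (Ioo_mem_nhdsLT zero_lt_one)).exists
  exact ⟨α, hα₀, hα₁, hneg⟩

theorem Setting.tendstoInMeasure_posterior (S : Setting) {Ω : Type*} [MeasurableSpace Ω]
    {P : Measure Ω} [IsProbabilityMeasure P] {p q : ℕ → ℕ}
    {X : ∀ n, Matrix (Fin n) (Fin (p n)) ℝ} {A : ∀ n, Matrix (Fin (p n)) (Fin (p n)) ℝ}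
    {ε : ℕ → ℝ} {t : ∀ n, Finset (Fin (p n))} {x : ∀ n, Fin (p n) → ℝ}
    {prior : ∀ n, PMF (Finset (Fin (p n)))} {Z : ∀ n, Ω → EuclideanSpace ℝ (Fin n)}
    {γ ξ ζ w α : ℝ}
    (hS : ∀ᶠ n : ℕ in atTop, S.IsRegular (X n) (A n) (ε n) ((n : ℝ) ^ ζ) (q n) (t n) (x n))
    (hZ : ∀ n, HasLaw (Z n) (isotropicGaussian _ S.v) P)
    (hε₀ : ∀ n, 1 ≤ n → 0 < ε n)
    (hε : ∀ η : ℝ, 0 < η → (fun n ↦ (ε n)⁻¹) =O[atTop] fun n : ℕ ↦ (n : ℝ) ^ η)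
    (hp : (fun n ↦ (p n : ℝ)) =O[atTop] fun n : ℕ ↦ (n : ℝ) ^ γ)
    (hq : (fun n ↦ (q n : ℝ)) =O[atTop] fun n : ℕ ↦ (n : ℝ) ^ ξ)
    (hξζ : ξ < ζ) (hζ : 0 < ζ) (hw : 0 < w)
    (hodds : ∀ n, 1 ≤ n → ∀ k, 0 < prior n k →
      w < (prior n (t n)).toReal / (prior n k).toReal)
    (hprior : ∀ n, 1 ≤ n → ∀ k : Finset (Fin (p n)), q n < k.card → prior n k = 0)
    (hα₀ : 0 < α) (hα₁ : α < 1 - 2 * S.κ)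
    (hγα : γ + α * (ξ * (S.r + 1 / 2) - (S.r + 1)) < 0)
    (hγ : γ + (ξ * (S.r + 1 / 2) - (S.r + 1)) < 0) :
    TendstoInMeasure P (fun n ω ↦ posterior S.r S.α₁ S.α₂ (X n) (A n) (prior n) (t n)
      (X n *ᵥ x n + Z n ω)) atTop (fun _ ↦ 1) := by
  rw [tendstoInMeasure_iff_measureReal_dist]
  intro δ hδ
  set s := min 1 (w * δ / 4)
  have hwδ : 0 < w * δ / 4 := by positivity
  have hlim : Tendsto (fun n ↦ S.atypicalBound n (p n) ((n : ℝ) ^ ζ) (q n) +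
      S.supermodelBound n (p n) (ε n) (q n) α / s) atTop (𝓝 0) := by
    simpa using (S.tendsto_atypicalBound hp hq hξζ hζ).add
      ((S.tendsto_supermodelBound hε hp hq hα₀ hγα).div_const s)
  refine tendsto_of_tendsto_of_tendsto_of_le_of_le' tendsto_const_nhds hlim
    (Eventually.of_forall fun _ ↦ measureReal_nonneg) ?_
  filter_upwards [hS, eventually_ge_atTop 1,
    (S.tendsto_missBound hε₀ hε hp hq hγ).eventually_le_const hwδ] with n hSn hn hmiss
  refine hSn.measureReal_le_dist_posterior (hZ n) hw (hodds n hn) (hprior n hn) hα₀ hα₁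
    (lt_min one_pos hwδ) (min_le_left _ _) ?_
  rw [div_lt_iff₀ hw]
  linarith [min_le_right 1 (w * δ / 4)]

section

variable {p : ℕ} {t : Finset ℕ} {β : ℕ → ℝ}

theorem mem_modelOf {j : Fin p} : j ∈ modelOf p t ↔ (j : ℕ) ∈ t := by
  simp [modelOf]

theorem card_modelOf (ht : ∀ j ∈ t, j < p) : (modelOf p t).card = t.card :=
  Finset.card_nbij (fun j : Fin p ↦ (j : ℕ)) (fun _ hj ↦ mem_modelOf.1 hj)
    Fin.val_injective.injOn fun j hj ↦ ⟨⟨j, ht j hj⟩, mem_modelOf.2 hj, rfl⟩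

theorem dotProduct_self_le_sum_sq (hβ : ∀ j ∉ t, β j = 0) :
    (fun j : Fin p ↦ β j) ⬝ᵥ (fun j : Fin p ↦ β j) ≤ ∑ j ∈ t, β j ^ 2 := by
  simp only [dotProduct, ← sq]
  rw [← Finset.sum_range fun j ↦ β j ^ 2, ← Finset.sum_subset Finset.inter_subset_left]
  · exact Finset.sum_le_sum_of_subset_of_nonneg Finset.inter_subset_right fun _ _ _ ↦ sq_nonneg _
  · intro j hj hjt
    rw [hβ j fun h ↦ hjt (Finset.mem_inter.2 ⟨hj, h⟩), zero_pow two_ne_zero]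

theorem exists_pos_le_abs (hβ : ∀ j ∈ t, β j ≠ 0) : ∃ b : ℝ, 0 < b ∧ ∀ j ∈ t, b ≤ |β j| := by
  rcases t.eq_empty_or_nonempty with rfl | ht
  · exact ⟨1, one_pos, by simp⟩
  · obtain ⟨i, hi, hmin⟩ := t.exists_min_image (fun j ↦ |β j|) ht
    exact ⟨|β i|, abs_pos.2 (hβ i hi), hmin⟩

end

theorem isBigO_natCast_rpow_of_isBigO_log_rpow {f : ℕ → ℝ} {a η : ℝ} (hη : 0 < η)
    (hf : f =O[atTop] fun n : ℕ ↦ Real.log n ^ a) : f =O[atTop] fun n : ℕ ↦ (n : ℝ) ^ η :=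
  hf.trans ((isLittleO_log_rpow_rpow_atTop a hη).comp_tendsto
    tendsto_natCast_atTop_atTop).isBigO

theorem lt_add_one_sub_mul_of_lt_one_sub_div {r ξ γ : ℝ} (hr : 0 < r) (hξ : ξ < 1)
    (h : ξ < 1 - 4 * γ / (3 * r)) : γ < r + 1 - ξ * (r + 1 / 2) := by
  rw [lt_sub_comm, div_lt_iff₀ (by positivity)] at h
  linarith [mul_pos hr (sub_pos.2 hξ)]

theorem Setting.eventually_isRegular (S : Setting) {p q : ℕ → ℕ}
    {X : ∀ n, Matrix (Fin n) (Fin (p n)) ℝ} {A : ∀ n, Matrix (Fin (p n)) (Fin (p n)) ℝ}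
    {ε : ℕ → ℝ} {t : Finset ℕ} {β : ℕ → ℝ} {ξ ζ : ℝ}
    (hA : ∀ n, 1 ≤ n → LoewnerBound (A n) S.a₁ S.a₂)
    (hε₀ : ∀ n, 1 ≤ n → 0 < ε n) (hε₁ : ∀ n, 1 ≤ n → ε n < 1)
    (hε : ∀ η : ℝ, 0 < η → (fun n ↦ (ε n)⁻¹) =O[atTop] fun n : ℕ ↦ (n : ℝ) ^ η)
    (hX : ∀ n, 1 ≤ n → ∀ k : Finset (Fin (p n)), k.card ≤ q n + S.T →
      EigenvalueBound (X n) (ε n) k)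
    (hq : (fun n ↦ (q n : ℝ)) =O[atTop] fun n : ℕ ↦ (n : ℝ) ^ ξ)
    (hξζ : ξ ≤ ζ) (hζ₀ : 0 ≤ ζ) (hζ₁ : ζ < 1)
    (ht : ∀ n, 1 ≤ n → (modelOf (p n) t).card = S.T) (htq : ∀ n, 1 ≤ n → S.T ≤ q n)
    (hβ₀ : ∀ j ∉ t, β j = 0) (hβ : ∀ j ∈ t, S.b ≤ |β j|) (hβB : ∑ j ∈ t, β j ^ 2 ≤ S.B) :
    ∀ᶠ n : ℕ in atTop, S.IsRegular (X n) (A n) (ε n) ((n : ℝ) ^ ζ) (q n) (modelOf (p n) t)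
      fun j ↦ β j := by
  filter_upwards [eventually_ge_atTop 1,
    eventually_mul_rpow_add_add_one_le S.load hε₀ hε hq hξζ hζ₀ hζ₁,
    eventually_mul_rpow_add_add_one_le 2 hε₀ hε hq hξζ hζ₀ hζ₁] with n hn hload hsize
  have hrpow : 0 ≤ (n : ℝ) ^ ζ := by positivity
  have hcard : q n + S.T ≤ n := by
    have : (n : ℝ) * ε n ≤ n := mul_le_of_le_one_right (Nat.cast_nonneg _) (hε₁ n hn).le
    have : (S.T : ℝ) ≤ q n := Nat.cast_le.2 (htq n hn)
    exact_mod_cast (by linarith : (q n : ℝ) + S.T ≤ n)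
  exact
    { loewnerBound := hA n hn
      ε_pos := hε₀ n hn
      ε_lt_one := hε₁ n hn
      card_eq := ht n hn
      T_le := htq n hn
      designBound := fun k hk ↦ (hX n hn k hk).designBound hn (hk.trans hcard)
      eq_zero := fun j hj ↦ hβ₀ j (mt mem_modelOf.2 hj)
      le_abs := fun j hj ↦ hβ j (mem_modelOf.1 hj)
      dotProduct_le := (dotProduct_self_le_sum_sq hβ₀).trans hβB
      h_nonneg := hrpow
      load_mul_le := hload }

end HyperPMOM

end

open HyperPMOM in
theorem theorem2_general
    {Ω : Type*} [MeasurableSpace Ω] {P : Measure Ω} [IsProbabilityMeasure P]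
    {r : ℕ} (hr : 1 ≤ r) {α₁ α₂ : ℝ} (hα₁ : 0 < α₁) (hα₂ : 0 < α₂)
    {p : ℕ → ℕ} {X : ∀ n, Matrix (Fin n) (Fin (p n)) ℝ}
    {t : Finset ℕ} {β₀ : ℕ → ℝ} (hβ₀ : ∀ j, β₀ j ≠ 0 ↔ j ∈ t)
    (ht : ∀ n, 1 ≤ n → ∀ j ∈ t, j < p n)
    {σ₀sq : ℝ≥0} (hσ₀ : 0 < σ₀sq)
    {e : ∀ n, Fin n → Ω → ℝ}
    (he_law : ∀ n i, HasLaw (e n i) (gaussianReal 0 σ₀sq) P)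
    (he_indep : ∀ n, iIndepFun (e n) P)
    {A : ∀ n, Matrix (Fin (p n)) (Fin (p n)) ℝ}
    {prior : ∀ n, PMF (Finset (Fin (p n)))}
    {q : ℕ → ℕ} {ξ γ : ℝ}
    {ε : ℕ → ℝ} (hε_pos : ∀ n, 1 ≤ n → 0 < ε n) (hε_lt : ∀ n, 1 ≤ n → ε n < 1)
    (hε : ∀ η : ℝ, 0 < η → (fun n ↦ (ε n)⁻¹) =O[atTop] fun n : ℕ ↦ (n : ℝ) ^ η)
    (hX : ∀ n, 1 ≤ n → ∀ k : Finset (Fin (p n)), k.card ≤ q n + t.card →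
      EigenvalueBound (X n) (ε n) k)
    (hp : (fun n ↦ (p n : ℝ)) =O[atTop] fun n : ℕ ↦ (n : ℝ) ^ γ)
    (hq : (fun n ↦ (q n : ℝ)) =O[atTop] fun n : ℕ ↦ (n : ℝ) ^ ξ) (hξ : ξ < 1)
    (hprior : ∀ n, 1 ≤ n → ∀ k : Finset (Fin (p n)), q n < k.card → prior n k = 0)
    {w : ℝ} (hw : 0 < w)
    (hodds : ∀ n, 1 ≤ n → ∀ k : Finset (Fin (p n)), 0 < prior n k →
      w < (prior n (modelOf (p n) t)).toReal / (prior n k).toReal)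
    {a₁ a₂ : ℝ} (ha₁ : 0 < a₁)
    (hA : ∀ n, 1 ≤ n → ∃ h : (A n).IsHermitian, ∀ i, a₁ < h.eigenvalues i ∧ h.eigenvalues i < a₂)
    (hξγ : γ < r + 1 - ξ * (r + 1 / 2)) :
    TendstoInMeasure P
      (fun n ω ↦ posterior r α₁ α₂ (X n) (A n) (prior n)
        (modelOf (p n) t)
        (response (X n) β₀ (fun i ↦ e n i ω)))
      atTop (fun _ ↦ 1) := by
  obtain ⟨b, hb, hβ⟩ := exists_pos_le_abs fun j hj ↦ (hβ₀ j).2 hj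
  have hγ : γ + (ξ * (r + 1 / 2) - (r + 1)) < 0 := by linarith
  obtain ⟨α, hα₀, hα_lt, hγα⟩ := exists_lt_one_add_mul_neg hγ
  obtain ⟨ζ, hζ, hζ₁⟩ := exists_between (max_lt hξ one_pos)
  obtain ⟨hξζ, hζ₀⟩ := max_lt_iff.1 hζ
  have ha₂ : 0 < max a₂ 1 := lt_max_of_lt_right one_pos
  have hB : 0 ≤ ∑ j ∈ t, β₀ j ^ 2 := Finset.sum_nonneg fun _ _ ↦ sq_nonneg _
  let S : Setting := ⟨r, t.card, α₁, α₂, a₁, max a₂ 1, σ₀sq, b, ∑ j ∈ t, β₀ j ^ 2,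
    (1 - α) / 4, Nat.one_le_iff_ne_zero.1 hr, hα₁, hα₂, ha₁, ha₂, NNReal.coe_pos.2 hσ₀, hb, hB,
    by linarith, by linarith⟩
  have hcard n (hn : 1 ≤ n) : (modelOf (p n) t).card = t.card :=
    card_modelOf (ht n hn)
  have hregular := S.eventually_isRegular
    (fun n hn ↦ loewnerBound_of_eigenvalues (hA n hn).1 fun i ↦
      ⟨((hA n hn).2 i).1.le, ((hA n hn).2 i).2.le.trans (le_max_left _ _)⟩)
    hε_pos hε_lt hε hX hq hξζ.le hζ₀.le hζ₁ hcard
    (fun n hn ↦ (hcard n hn).ge.trans <| not_lt.1 fun h ↦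
      prior_ne_zero_of_odds hw (hodds n hn) (hprior n hn _ h))
    (fun j hj ↦ not_not.1 (mt (hβ₀ j).1 hj)) hβ le_rfl
  have hconsistent := S.tendstoInMeasure_posterior hregular
    (fun n ↦ hasLaw_toLp_isotropicGaussian (he_law n) (he_indep n)) hε_pos hε hp hq hξζ hζ₀ hw
    hodds hprior hα₀ (by dsimp only [S]; linarith) hγα hγ
  exact hconsistent

theorem theorem2
    {Ω : Type*} [MeasurableSpace Ω] (P : Measure Ω) [IsProbabilityMeasure P]
    -- order of the pMOM density, and hyperparameters of the prior on `σ²`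
    (r : ℕ) (hr : 1 ≤ r) (α₁ α₂ : ℝ) (hα₁ : 0 < α₁) (hα₂ : 0 < α₂)
    -- dimension and design matrix, for each sample size `n`
    (p : ℕ → ℕ) (X : ∀ n, Matrix (Fin n) (Fin (p n)) ℝ)
    -- true model, true coefficients and true error variance, not depending on `n`
    (t : Finset ℕ) (β₀ : ℕ → ℝ) (hβ₀ : ∀ j, β₀ j ≠ 0 ↔ j ∈ t)
    (ht : ∀ n, 1 ≤ n → ∀ j ∈ t, j < p n)
    (σ₀sq : ℝ≥0) (hσ₀ : 0 < σ₀sq)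
    -- for each `n`, errors that are i.i.d. `N(0, σ₀²)`
    (e : ∀ n, Fin n → Ω → ℝ)
    (he_law : ∀ n i, HasLaw (e n i) (gaussianReal 0 σ₀sq) P)
    (he_indep : ∀ n, iIndepFun (e n) P)
    -- scale matrix of the pMOM prior, and prior on the space of models
    (A : ∀ n, Matrix (Fin (p n)) (Fin (p n)) ℝ)
    (prior : ∀ n, PMF (Finset (Fin (p n))))
    (q : ℕ → ℕ) (ξ γ : ℝ)
    -- eigenvalues of the Gram matrices
    (ε : ℕ → ℝ) (hε_pos : ∀ n, 1 ≤ n → 0 < ε n) (hε_lt : ∀ n, 1 ≤ n → ε n < 1)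
    (hε : (fun n => (ε n)⁻¹) =O[atTop] fun n : ℕ => Real.log n ^ (1 / 8 : ℝ))
    (hX : ∀ n, 1 ≤ n → ∀ k : Finset (Fin (p n)), k.card ≤ q n + t.card →
      HyperPMOM.EigenvalueBound (X n) (ε n) k)
    -- growth of the dimension
    (hp : (fun n => (p n : ℝ)) =O[atTop] fun n : ℕ => (n : ℝ) ^ γ) (hγ : γ < r)
    -- no prior mass on models that are too large
    (hq : (fun n => (q n : ℝ)) =O[atTop] fun n : ℕ => (n : ℝ) ^ ξ) (hξ : ξ < 1)
    (hprior : ∀ n, 1 ≤ n → ∀ k : Finset (Fin (p n)), q n < k.card → prior n k = 0)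
    -- prior odds of the true model bounded below
    (w : ℝ) (hw : 0 < w)
    (hodds : ∀ n, 1 ≤ n → ∀ k : Finset (Fin (p n)), 0 < prior n k →
      w < (prior n (HyperPMOM.modelOf (p n) t)).toReal / (prior n k).toReal)
    -- eigenvalues of the scale matrix
    (a₁ a₂ : ℝ) (ha₁ : 0 < a₁)
    (hA : ∀ n, 1 ≤ n → ∃ h : (A n).IsHermitian, ∀ i, a₁ < h.eigenvalues i ∧ h.eigenvalues i < a₂)
    -- additional restriction on the model size
    (hξγ : ξ < 1 - 4 * γ / (3 * r)) :
    TendstoInMeasure P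
      (fun n ω => HyperPMOM.posterior r α₁ α₂ (X n) (A n) (prior n)
        (HyperPMOM.modelOf (p n) t)
        (HyperPMOM.response (X n) β₀ (fun i => e n i ω)))
      atTop (fun _ => 1) :=
  theorem2_general hr hα₁ hα₂ hβ₀ ht hσ₀ he_law he_indep hε_pos hε_lt
    (fun _ hη ↦ HyperPMOM.isBigO_natCast_rpow_of_isBigO_log_rpow hη hε) hX hp hq hξ hprior hw hodds
    ha₁ hA (HyperPMOM.lt_add_one_sub_mul_of_lt_one_sub_div (Nat.cast_pos.2 hr) hξ hξγ)
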